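/- **Setting.** Let $d\ge 1$, $K\ge 2$. A $K$-arm contextual linear bandit has unknown parameters $\beta_1^*,\dots,\beta_K^*\in\mathbb R^d$. At each time $t=0,1,2,\dots$ one observes a covariate $X_t\in\mathbb R^d$, draws an exploration coin $\alpha_t\sim\mathrm{Bernoulli}(\pi_t)$ (with deterministic $\pi_t\in[0,1]$), pulls an arm $a_t$, namely a uniformly random arm of $[K]=\{1,\dots,K\}$ if $\alpha_t=1$ and a maximizer of $i\mapsto X_t^\top\beta_i^{(t)}$ if $\alpha_t=0$ (ties broken by any rule depending only on the past and $X_t$), and observes $Y_t=X_t^\top\beta_{a_t}^*+\xi_t$. The coin and the uniform arm drawn at time $t$ are independent of each other and, jointly, of the past, $X_t$ and $\xi_t$. From deterministic initial estimates $\beta_i^{(0)}$ one updates $$\beta_i^{(t+1)}=\beta_i^{(t)}-\eta_t\,\mathbb 1\{a_t=i\}\,(X_t^\top\beta_i^{(t)}-Y_t)\,X_t,\qquad \eta_t=\frac1{\lambda_{\min}}\frac{C_a}{t+C_b d}.$$ Let $\mathcal F_t=\sigma(X_s,\alpha_s,a_s,Y_s:\ s<t)$ and $\mathcal F_t^+=\mathcal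 F_t\vee\sigma(X_t)$. For a real random variable $Z$ and a constant $\kappa>0$, $\|Z|\mathcal F\|_{\Psi_2}\le\kappa$ means $\mathbb E[\exp(|Z/\kappa|^2)\,|\,\mathcal F]\le 2$ a.s.; for a random vector $V$, $\|V|\mathcal F\|_{\Psi_2}\le\kappa$ means that this holds for $u^\top V$ for every $\mathcal F$-measurable random unit vector $u$. **Assumptions**, for constants $\lambda_{\min},\lambda_{\max},\sigma,h>0$ and all $t$, almost surely: * (Covariates) $\mathbb E[X_t|\mathcal F_t]=0$, $\|X_t|\mathcal F_t\|_{\Psi_2}^2\le\lambda_{\max}$, $\mathbb E[X_tX_t^\top|\mathcal F_t]\succeq\lambda_{\min}I_d$. * (Noise) $\mathbb E[\xi_t|\mathcal F_t^+]=0$, $\|\xi_t|\mathcal F_t^+\|_{\Psi_2}\le\sigma$. * (Arm optimality) There is $\mathcal A\subseteq[K]$, with $\mathcal A^c=[K]\setminus\mathcal A$, such that for $i\in\mathcal A$, with $\mathcal U_i(h)=\{x:\ x^\top\beta_i^*-\max_{j\ne i}x^\top\beta_j^*\ge h\|x\|\}$, $\mathbb E[X_tX_t^\top\mathbb 1\{X_t\in\mathcal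 U_i(h)\}|\mathcal F_t]\succeq\lambda_{\min}I_d$, and for $j\in\mathcal A^c$, $\mathbb P(\max_{i}X_t^\top\beta_i^*-X_t^\top\beta_j^*\ge h\|X_t\|\,|\,\mathcal F_t)=1$. * (Initialization) $\|\beta_i^{(0)}-\beta_i^*\|^2\le\sigma^2/\lambda_{\max}$ for all $i\in[K]$. **Theorem.** For every $C_0>0$ there are constants $C,c>0$, depending only on $C_0$, such that the following holds in every such setting. Let $\pi\in(0,1]$, $C_a\ge 2K/\pi$, $C_b\ge 3C_a^2\lambda_{\max}^2/\lambda_{\min}^2$, and let $(\delta_t)_{t\ge0}$ satisfy $0\le\delta_t\le\delta_{t+1}$ and $\delta_t\le C_0t/C_b$ for all $t$. Put $$C^*=C\,C_a^2\frac{\lambda_{\max}}{\lambda_{\min}}+C_b\frac{\lambda_{\min}}{\lambda_{\max}},\qquad C^{**}=C^*+2C\,C_a\frac{\lambda_{\max}}{\lambda_{\min}},\qquad t_1=\frac{16\,C^*d\,\sigma^2}{\lambda_{\min}h^2}-C_bd,\qquad n_1=\max\{0,\lceil t_1\rceil\},$$ and, for integers $m\le n$, $S(m,n)=\sum_{l=m}^{n}e^{-c(d+l/C_a)}+\sum_{l=m}^{n}e^{-c(d+\delta_l)}$.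 1. If $\pi_s\ge\pi$ for all $s$, then for every $t\ge0$, with probability at least $1-K\,S(0,t)$, $$\|\beta_i^{(t)}-\beta_i^*\|^2\le\frac{C^*}{\lambda_{\min}}\,\frac{d+\delta_t}{t+C_bd}\,\sigma^2\qquad\text{for all } i\in[K].$$ 2. Suppose $\pi_s\ge\pi$ for $s<n_1$, while $\pi_s\in[0,1]$ is arbitrary for $s\ge n_1$ (in particular $\pi_s\to0$ or $\pi_s=0$ is allowed). Then for every integer $t\ge n_1$, with probability at least $1-K\,S(0,n_1)-|\mathcal A|\,S(n_1,t+1)$, $$\|\beta_i^{(t)}-\beta_i^*\|^2\le\frac{C^{**}}{\lambda_{\min}}\,\frac{d+\delta_t}{t+C_bd}\,\sigma^2\qquad\text{for all } i\in\mathcal A.\tag{$*$}$$ Moreover, with probability at least $$1-K\,S(0,n_1)-|\mathcal A|\,S(n_1,t+1)-|\mathcal A^c|\,e^{-cd}\sum_{l=n_1}^{t+1}\mathbb 1\{\pi_l\ne0\},$$ $(*)$ holds and in addition $\|\beta_i^{(t)}-\beta_i^*\|^2\le h^2/4$ for all $i\in\mathcal A^c$. -/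

import Mathlib

open MeasureTheory ProbabilityTheory

noncomputable section

/-- `‖Z | m‖_{Ψ₂} ≤ s` for a real random variable `Z` and a constant `s`:
`E[exp(|Z / s|²) | m] ≤ 2` almost surely. Integrability is stated because Mathlib's conditional
expectation of a non-integrable function is `0`. -/
def CondPsiTwoLe {Ω : Type*} (m : MeasurableSpace Ω) [MeasurableSpace Ω] (μ : Measure Ω)
    (Z : Ω → ℝ) (s : ℝ) : Prop :=
  Integrable (fun ω => Real.exp (|Z ω / s| ^ 2)) μ ∧
    μ[fun ω => Real.exp (|Z ω / s| ^ 2) | m] ≤ᵐ[μ] fun _ => 2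

/-- `‖V | m‖_{Ψ₂} ≤ s` for a random vector `V`: the bound holds for `uᵀV`, for every
`m`-measurable random unit vector `u`. -/
def CondPsiTwoVecLe {Ω : Type*} {d : ℕ} (m : MeasurableSpace Ω)
    [MeasurableSpace Ω] (μ : Measure Ω) (V : Ω → EuclideanSpace ℝ (Fin d)) (s : ℝ) : Prop :=
  ∀ u : Ω → EuclideanSpace ℝ (Fin d), Measurable[m] u → (∀ ω, ‖u ω‖ = 1) →
    CondPsiTwoLe m μ (fun ω => inner ℝ (u ω) (V ω)) s

/-- The conditional second moment matrix `E[V Vᵀ 𝟙{V ∈ S} | m]`, evaluated at `ω`. -/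
def condGram {Ω : Type*} {d : ℕ} (m : MeasurableSpace Ω)
    [MeasurableSpace Ω] (μ : Measure Ω) (V : Ω → EuclideanSpace ℝ (Fin d))
    (S : Set (EuclideanSpace ℝ (Fin d))) (ω : Ω) : Matrix (Fin d) (Fin d) ℝ :=
  Matrix.of fun i j => (μ[fun ω' => S.indicator (fun x => x i * x j) (V ω') | m]) ω

/-- The conic decision region `𝒰_i(h)`: all `x` with
`xᵀβ_i - max_{j ≠ i} xᵀβ_j ≥ h ‖x‖` (the origin belongs to it). -/
def conicRegion {d K : ℕ} (b : Fin K → EuclideanSpace ℝ (Fin d)) (i : Fin K) (h : ℝ) :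
    Set (EuclideanSpace ℝ (Fin d)) :=
  {x | ∀ j, j ≠ i → h * ‖x‖ ≤ inner ℝ x (b i) - inner ℝ x (b j)}

/-- The random inputs of a `K`-arm contextual linear bandit in dimension `d` that is run with
`ε`-greedy SGD. Everything else (arms pulled, rewards, estimates) is computed from them. -/
structure Bandit (Ω : Type*) (d K : ℕ) where
  /-- true parameters -/
  betaStar : Fin K → EuclideanSpace ℝ (Fin d)
  /-- initial estimates -/
  betaInit : Fin K → EuclideanSpace ℝ (Fin d)
  /-- stepsizes -/
  step : ℕ → ℝ
  /-- covariates -/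
  X : ℕ → Ω → EuclideanSpace ℝ (Fin d)
  /-- noise -/
  noise : ℕ → Ω → ℝ
  /-- exploration coin (`true` means explore) -/
  coin : ℕ → Ω → Bool
  /-- the arm pulled if the step is an exploration step -/
  randArm : ℕ → Ω → Fin K
  /-- the arm pulled if the step is an exploitation step -/
  greedyArm : ℕ → Ω → Fin K

namespace Bandit

/-- The arm `a_t` pulled at time `t`. -/
def arm {Ω : Type*} {d K : ℕ} (B : Bandit Ω d K) (t : ℕ) (ω : Ω) : Fin K :=
  if B.coin t ω = true then B.randArm t ω else B.greedyArm t ω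

/-- The reward `Y_t = X_tᵀ β*_{a_t} + ξ_t`. -/
def reward {Ω : Type*} {d K : ℕ} (B : Bandit Ω d K) (t : ℕ) (ω : Ω) : ℝ :=
  inner ℝ (B.X t ω) (B.betaStar (B.arm t ω)) + B.noise t ω

/-- The SGD estimates `β_i^{(t)}`; only the arm pulled is updated. -/
def est {Ω : Type*} {d K : ℕ} (B : Bandit Ω d K) :
    ℕ → Ω → Fin K → EuclideanSpace ℝ (Fin d)
  | 0, _, i => B.betaInit i
  | t + 1, ω, i =>
      if B.arm t ω = i then
        B.est t ω i -
          (B.step t * (inner ℝ (B.X t ω) (B.est t ω i) - B.reward t ω)) • B.X t ω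
      else B.est t ω i

/-- `ℱ_t`: the σ-field of the covariates, exploration coins, arms pulled and rewards at the
times `s < t`. -/
abbrev past {Ω : Type*} {d K : ℕ} (B : Bandit Ω d K) (t : ℕ) : MeasurableSpace Ω :=
  ⨆ (s : ℕ) (_ : s < t), MeasurableSpace.comap
    (fun ω => (B.X s ω, B.coin s ω, B.arm s ω, B.reward s ω)) inferInstance

/-- `ℱ_t⁺`: the past together with the current covariate. -/
abbrev pastPlus {Ω : Type*} {d K : ℕ} (B : Bandit Ω d K) (t : ℕ) : MeasurableSpace Ω :=
  B.past t ⊔ MeasurableSpace.comap (B.X t) inferInstance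

/-- The run follows the `ε`-greedy rule with exploration probabilities `p t`: the exploitation
arm maximizes the estimated reward (ties are broken by any rule that uses only the past and the
current covariate), the exploration coin is Bernoulli(`p t`), the exploration arm is uniform and
independent of the coin, and this randomization at time `t` is independent of the past, of the
current covariate and of the current noise. -/
structure IsEpsGreedy {Ω : Type*} [MeasurableSpace Ω] {d K : ℕ} (B : Bandit Ω d K)
    (μ : Measure Ω) (p : ℕ → ℝ) : Prop where
  measurable_X : ∀ t, Measurable (B.X t)
  measurable_noise : ∀ t, Measurable (B.noise t)
  measurable_coin : ∀ t, Measurable (B.coin t)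
  measurable_randArm : ∀ t, Measurable (B.randArm t)
  measurable_greedyArm : ∀ t, Measurable[B.pastPlus t] (B.greedyArm t)
  greedy_max : ∀ t ω i,
    inner ℝ (B.X t ω) (B.est t ω i) ≤ inner ℝ (B.X t ω) (B.est t ω (B.greedyArm t ω))
  coin_law : ∀ t, μ.real {ω | B.coin t ω = true} = p t
  randArm_law : ∀ t i, μ.real {ω | B.randArm t ω = i} = 1 / (K : ℝ)
  coin_indep_randArm : ∀ t, IndepFun (B.coin t) (B.randArm t) μ
  fresh : ∀ t, Indep
    (MeasurableSpace.comap (fun ω => (B.coin t ω, B.randArm t ω)) inferInstance)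
    (B.pastPlus t ⊔ MeasurableSpace.comap (B.noise t) inferInstance) μ

/-- Covariates: martingale difference, conditionally sub-Gaussian with
`‖X_t | ℱ_t‖²_{Ψ₂} ≤ lmax`, and `E[X_t X_tᵀ | ℱ_t] ⪰ lmin I`. -/
structure CovariateAssumption {Ω : Type*} [MeasurableSpace Ω] {d K : ℕ} (B : Bandit Ω d K)
    (μ : Measure Ω) (lmin lmax : ℝ) : Prop where
  mean_zero : ∀ t, μ[B.X t | B.past t] =ᵐ[μ] fun _ => 0
  subGaussian : ∀ t, CondPsiTwoVecLe (B.past t) μ (B.X t) (Real.sqrt lmax)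
  second_moment : ∀ t, ∀ᵐ ω ∂μ,
    (condGram (B.past t) μ (B.X t) Set.univ ω
      - lmin • (1 : Matrix (Fin d) (Fin d) ℝ)).PosSemidef

/-- Noise: martingale difference, conditionally sub-Gaussian with `‖ξ_t | ℱ_t⁺‖_{Ψ₂} ≤ sig`. -/
structure NoiseAssumption {Ω : Type*} [MeasurableSpace Ω] {d K : ℕ} (B : Bandit Ω d K)
    (μ : Measure Ω) (sig : ℝ) : Prop where
  mean_zero : ∀ t, μ[B.noise t | B.pastPlus t] =ᵐ[μ] fun _ => 0
  subGaussian : ∀ t, CondPsiTwoLe (B.pastPlus t) μ (B.noise t) sig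

/-- Arm optimality with margin `h` for the partition of the arms into `A` and its complement. -/
structure ArmOptimality {Ω : Type*} [MeasurableSpace Ω] {d K : ℕ} (B : Bandit Ω d K)
    (μ : Measure Ω) (lmin h : ℝ) (A : Finset (Fin K)) : Prop where
  optimal : ∀ t, ∀ i ∈ A, ∀ᵐ ω ∂μ,
    (condGram (B.past t) μ (B.X t) (conicRegion B.betaStar i h) ω
      - lmin • (1 : Matrix (Fin d) (Fin d) ℝ)).PosSemidef
  suboptimal : ∀ t, ∀ j ∉ A,
    μ[{ω | ∃ i, h * ‖B.X t ω‖ ≤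
        inner ℝ (B.X t ω) (B.betaStar i) - inner ℝ (B.X t ω) (B.betaStar j)}.indicator
        (fun _ => (1 : ℝ)) | B.past t] =ᵐ[μ] fun _ => 1

end Bandit

/-- `C* = C C_a² lmax/lmin + C_b lmin/lmax`. -/
def cStar (C Ca Cb lmin lmax : ℝ) : ℝ :=
  C * Ca ^ 2 * (lmax / lmin) + Cb * (lmin / lmax)

/-- `C** = C* + 2 C C_a lmax/lmin`. -/
def cStarStar (C Ca Cb lmin lmax : ℝ) : ℝ :=
  cStar C Ca Cb lmin lmax + 2 * C * Ca * (lmax / lmin)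

/-- `t_1 = 16 C* d σ² / (lmin h²) - C_b d`, a real number that may be negative. -/
def tOne (C Ca Cb lmin lmax sig h : ℝ) (d : ℕ) : ℝ :=
  16 * cStar C Ca Cb lmin lmax * d * sig ^ 2 / (lmin * h ^ 2) - Cb * d

/-- `∑_{l ∈ I} (exp(-c (d + l/C_a)) + exp(-c (d + δ_l)))`. -/
def tailSum (c Ca : ℝ) (d : ℕ) (δ : ℕ → ℝ) (I : Finset ℕ) : ℝ :=
  ∑ l ∈ I, Real.exp (-(c * (d + l / Ca))) + ∑ l ∈ I, Real.exp (-(c * (d + δ l)))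

end

/-! Fix an arm, let D be its squared error at time t, put n = t + C_b d, and let θ be `expRate`. The
proof controls the exponential moment of θ n D on a good event: earlier covariates lie below a
truncation level and earlier errors of the arm below prescribed bounds of order σ²/λ_max
(`goodSet`).

Suppose the arm is pulled with conditional probability at least 2/C_a on a set of covariates whose
second moment matrix is at least λ_min I. The linear drift of D in one SGD step is then about -4D/n.
Second-order terms and the noise use up part of it, and a relative contraction of 2/n remains. One
1/n pays for the growth of the weight from n to n + 1. The other leaves room for a convex
combination: on average, the new exponential is at most (1 - 1/n) exp(θ n D) + (1/n) exp Λ. Hence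
the bound exp Λ reproduces itself and nothing accumulates over time (`setIntegral_exp_le_of_drift`,
`setIntegral_exp_goodSet_le`). Markov's inequality at the claimed radius costs exp(-c(d + δ)). A
union bound over times and arms, with an induction that removes the restriction to the good event,
gives the first claim (`exploration_bound`).

After exploration stops an arm may have no drift at all. The squared step sizes are summable,
however, so with the weight frozen at its value at n₁ the exponential moment grows by a bounded
power of exp(cd) in total. A maximal inequality then keeps every arm, optimal or not, within twice
its radius at n₁, hence within squared error h²/8 (`sum_measureReal_goodSet_gt_le`). With that
accuracy the greedy rule picks an optimal arm i whenever the covariate lies in the conic region of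
i, where the second moments are large by assumption. The contraction therefore persists for the
optimal arms (`drift_of_accuracy`, `exploitation_bound`).

The conditional sub-Gaussian hypotheses enter through pointwise majorants. Each exponential is
bounded by a combination of a centred variable and of exp(Z²/s²), with coefficients known from the
past, and this bound is integrated. Noise and covariate are treated in succession
(`integral_exp_sgd_update_le`, `integral_truncated_mix_exp_le`), with the choice of arm averaged by
`integral_pull`. -/

noncomputable section

/-! ### Scalar majorants of exponentials -/

section ScalarInequalities

/-- The chord of a convex function. It makes a small multiple in the exponent linear in `exp t`, the
quantity whose conditional mean is controlled. -/
theorem exp_mul_le_one_add_mul {w : ℝ} (hw0 : 0 ≤ w) (hw1 : w ≤ 1) (t : ℝ) :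
    Real.exp (w * t) ≤ 1 + w * (Real.exp t - 1) := by
  have h := convexOn_exp.2 (Set.mem_univ (0 : ℝ)) (Set.mem_univ t) (sub_nonneg.2 hw1) hw0 (by ring)
  simp only [smul_eq_mul, mul_zero, zero_add, Real.exp_zero, mul_one] at h
  linarith

/-- The linear term is kept because it integrates to zero for a centred variable; what is left is of
second order. -/
theorem exp_le_add_exp_sq (x : ℝ) : Real.exp x ≤ x + Real.exp (x ^ 2) := by
  have hsq := Real.add_one_le_exp (x ^ 2)
  rcases le_or_gt (|x|) 1 with h | h
  · have := (abs_le.1 (Real.abs_exp_sub_one_sub_id_le h)).2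
    linarith
  · rcases lt_abs.1 h with h | h
    · have : Real.exp x ≤ Real.exp (x ^ 2) := Real.exp_le_exp.2 (by nlinarith)
      linarith
    · have : Real.exp x ≤ 1 := Real.exp_le_one_iff.2 (by linarith)
      nlinarith

theorem abs_le_exp_sq (x : ℝ) : |x| ≤ Real.exp (x ^ 2) := by
  have hsq := Real.add_one_le_exp (x ^ 2)
  have : x ^ 2 = |x| ^ 2 := (sq_abs x).symm
  nlinarith [sq_nonneg (|x| - 1)]

theorem sq_le_exp_sub_one {x : ℝ} (hx : 0 ≤ x) : x ^ 2 ≤ Real.exp x - 1 := by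
  have h := Real.sum_le_exp_of_nonneg hx 4
  simp [Finset.sum_range_succ, Nat.factorial] at h
  nlinarith [mul_nonneg hx (sq_nonneg (x - 3 / 2))]

/-- After division by `exp (x / 8)` the claim compares x² with exp(7x/8) - exp(-x/8), and short
Taylor polynomials suffice. -/
theorem sq_mul_exp_le_exp_sub_one {x : ℝ} (hx : 0 ≤ x) :
    x ^ 2 * Real.exp (x / 8) ≤ Real.exp x - 1 := by
  have h7 := Real.sum_le_exp_of_nonneg (show 0 ≤ 7 * x / 8 by positivity) 4
  simp [Finset.sum_range_succ, Nat.factorial] at h7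
  have h1 : Real.exp (-(x / 8)) ≤ 1 - x / 8 + x ^ 2 / 128 := by
    have h8 := Real.sum_le_exp_of_nonneg (show 0 ≤ x / 8 by positivity) 3
    simp [Finset.sum_range_succ, Nat.factorial] at h8
    rw [Real.exp_neg, inv_le_comm₀ (Real.exp_pos _) (by nlinarith [sq_nonneg (x - 8)])]
    refine le_trans ?_ h8
    rw [inv_le_iff_one_le_mul₀ (by nlinarith [sq_nonneg (x - 8)])]
    have : 0 ≤ x ^ 4 := by positivity
    nlinarith
  have hmain : x ^ 2 ≤ Real.exp (7 * x / 8) - Real.exp (-(x / 8)) := by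
    nlinarith [mul_nonneg hx (sq_nonneg (x - 14 / 5))]
  have e1 : Real.exp x = Real.exp (7 * x / 8) * Real.exp (x / 8) := by
    rw [← Real.exp_add]; ring_nf
  have e2 : Real.exp (-(x / 8)) * Real.exp (x / 8) = 1 := by
    rw [← Real.exp_add]; simp
  have := mul_le_mul_of_nonneg_right hmain (Real.exp_pos (x / 8)).le
  rw [sub_mul, e2, ← e1] at this
  exact this

/-- AM-GM decouples two dependent variables: later P is a squared coordinate and N the squared
marginal of the same covariate in the error direction, so their exponentials can be controlled only
one at a time. -/
theorem mul_sq_mul_exp_le {P N : ℝ} (hP : 0 ≤ P) (hN : 0 ≤ N) :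
    P * (N * Real.exp (N / 16)) ≤ ((Real.exp P - 1) + (Real.exp N - 1)) / 2 := by
  have h1 := sq_le_exp_sub_one hP
  have h2 := sq_mul_exp_le_exp_sub_one hN
  have e : Real.exp (N / 8) = Real.exp (N / 16) ^ 2 := by
    rw [← Real.exp_nat_mul]; ring_nf
  rw [e] at h2
  nlinarith [sq_nonneg (P - N * Real.exp (N / 16))]

theorem mul_exp_le {P N : ℝ} (hP : 0 ≤ P) (hN : 0 ≤ N) :
    P * Real.exp (N / 16) ≤ ((Real.exp P - 1) + (1 + (Real.exp N - 1))) / 2 := by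
  have h1 := sq_le_exp_sub_one hP
  have h2 : Real.exp (N / 8) ≤ Real.exp N := Real.exp_le_exp.2 (by linarith)
  have e : Real.exp (N / 8) = Real.exp (N / 16) ^ 2 := by
    rw [← Real.exp_nat_mul]; ring_nf
  rw [e] at h2
  nlinarith [sq_nonneg (P - Real.exp (N / 16))]

/-- Coefficient of `z` in the majorant of `exp (a * z + g * z ^ 2)`. -/
def linCoeff (s a : ℝ) : ℝ := if a ^ 2 * s ^ 2 ≤ 1 / 2 then a else 0

/-- Coefficient of `exp (z ^ 2 / s ^ 2) - 2` in the majorant of `exp (a * z + g * z ^ 2)`. -/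
def expCoeff (s a g : ℝ) : ℝ :=
  if a ^ 2 * s ^ 2 ≤ 1 / 2 then 2 * ((a ^ 2 + g) * s ^ 2)
  else Real.exp (a ^ 2 * s ^ 2) * (1 / 4 + g * s ^ 2)

theorem expCoeff_nonneg {s a g : ℝ} (hg : 0 ≤ g) : 0 ≤ expCoeff s a g := by
  unfold expCoeff; split_ifs <;> positivity

/-- The right side has the form (multiple of z) + constant + (nonnegative multiple of exp(z²/s²) -
2), so its conditional mean is at most the constant when z is centred. For small a the linear term
must be retained, to get a constant of order a². For large a the term a z is split by AM-GM and
centring is not needed. The case distinction depends only on a, so the coefficients remain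
measurable with respect to the past. -/
theorem exp_mul_add_mul_sq_le {s g : ℝ} (hs : 0 < s) (hg : 0 ≤ g) (hgs : g * s ^ 2 ≤ 1 / 2)
    (a z : ℝ) :
    Real.exp (a * z + g * z ^ 2) ≤ linCoeff s a * z + Real.exp (2 * ((a ^ 2 + g) * s ^ 2))
      + expCoeff s a g * (Real.exp (|z / s| ^ 2) - 2) := by
  have hW : |z / s| ^ 2 * s ^ 2 = z ^ 2 := by
    rw [sq_abs]; field_simp
  set W := |z / s| ^ 2
  have hgs0 : 0 ≤ g * s ^ 2 := by positivity
  have has0 : 0 ≤ a ^ 2 * s ^ 2 := by positivity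
  unfold linCoeff expCoeff
  split_ifs with h
  · have hw : (a ^ 2 + g) * s ^ 2 ≤ 1 := by nlinarith
    have h1 := exp_le_add_exp_sq (a * z)
    have h2 := abs_le_exp_sq (a * z)
    have hu : 1 ≤ Real.exp ((a * z) ^ 2) := Real.one_le_exp (by positivity)
    have hv : 1 ≤ Real.exp (g * z ^ 2) := Real.one_le_exp (by positivity)
    have huv : Real.exp ((a * z) ^ 2) * Real.exp (g * z ^ 2) ≤
        1 + (a ^ 2 + g) * s ^ 2 * (Real.exp W - 1) := by
      have := exp_mul_le_one_add_mul (w := (a ^ 2 + g) * s ^ 2) (by nlinarith) hw W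
      rw [← Real.exp_add]
      convert this using 2
      linear_combination (-(a ^ 2 + g)) * hW
    have h3 := Real.add_one_le_exp (2 * ((a ^ 2 + g) * s ^ 2))
    rw [Real.exp_add]
    have h4 : a * z * (Real.exp (g * z ^ 2) - 1) ≤
        Real.exp ((a * z) ^ 2) * (Real.exp (g * z ^ 2) - 1) :=
      mul_le_mul_of_nonneg_right ((le_abs_self _).trans h2) (by linarith)
    have h5 := mul_le_mul_of_nonneg_right h1 (Real.exp_pos (g * z ^ 2)).le
    nlinarith
  · push Not at h
    have hq : a * z ≤ a ^ 2 * s ^ 2 + W / 4 := by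
      have : (a * s) * (z / s) = a * z := by field_simp
      have h6 : W = (z / s) ^ 2 := sq_abs _
      nlinarith [sq_nonneg (a * s - z / s / 2)]
    have h1 : Real.exp (a * z + g * z ^ 2) ≤
        Real.exp (a ^ 2 * s ^ 2) * Real.exp ((1 / 4 + g * s ^ 2) * W) := by
      rw [← Real.exp_add]
      apply Real.exp_le_exp.2
      nlinarith
    have h2 := exp_mul_le_one_add_mul (w := 1 / 4 + g * s ^ 2) (by linarith) (by linarith) W
    have h3 : Real.exp (a ^ 2 * s ^ 2) * (1 + (1 / 4 + g * s ^ 2)) ≤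
        Real.exp (2 * ((a ^ 2 + g) * s ^ 2)) := by
      have := Real.add_one_le_exp (1 / 4 + g * s ^ 2)
      calc _ ≤ Real.exp (a ^ 2 * s ^ 2) * Real.exp (1 / 4 + g * s ^ 2) := by gcongr; linarith
        _ = Real.exp (a ^ 2 * s ^ 2 + (1 / 4 + g * s ^ 2)) := (Real.exp_add _ _).symm
        _ ≤ _ := Real.exp_le_exp.2 (by nlinarith)
    have h4 := mul_le_mul_of_nonneg_left h2 (Real.exp_pos (a ^ 2 * s ^ 2)).le
    nlinarith

/-- Pointwise majorant of a mixture of `1` and `exp (-A + G)`. -/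
theorem mix_exp_le {q A G : ℝ} (hq0 : 0 ≤ q) (hq1 : q ≤ 1) (hA : 0 ≤ A) (hG : 0 ≤ G) :
    1 - q + q * Real.exp (-A + G) ≤ 1 - q * A + A ^ 2 + G * Real.exp (2 * G) := by
  have h1 : Real.exp (-A + G) ≤ (Real.exp (-(2 * A)) + Real.exp (2 * G)) / 2 := by
    have e1 : Real.exp (-(2 * A)) = Real.exp (-A) ^ 2 := by rw [← Real.exp_nat_mul]; ring_nf
    have e2 : Real.exp (2 * G) = Real.exp G ^ 2 := by rw [← Real.exp_nat_mul]; ring_nf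
    rw [Real.exp_add, e1, e2]
    nlinarith [sq_nonneg (Real.exp (-A) - Real.exp G)]
  have h2 : Real.exp (-(2 * A)) ≤ 1 - 2 * A + 2 * A ^ 2 := by
    have h8 := Real.sum_le_exp_of_nonneg (show 0 ≤ 2 * A by positivity) 3
    simp [Finset.sum_range_succ, Nat.factorial] at h8
    have hp : 0 < 1 - 2 * A + 2 * A ^ 2 := by nlinarith [sq_nonneg (2 * A - 1)]
    rw [Real.exp_neg, inv_le_comm₀ (Real.exp_pos _) hp]
    refine le_trans ?_ h8
    rw [inv_le_iff_one_le_mul₀ hp]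
    have : 0 ≤ A ^ 4 := by positivity
    nlinarith
  have h3 : Real.exp (2 * G) - 1 ≤ 2 * G * Real.exp (2 * G) := by
    have := Real.add_one_le_exp (-(2 * G))
    have e : Real.exp (-(2 * G)) * Real.exp (2 * G) = 1 := by rw [← Real.exp_add]; simp
    nlinarith [Real.exp_pos (2 * G)]
  have h4 : Real.exp (-A + G) - 1 ≤ -A + (A ^ 2 + G * Real.exp (2 * G)) := by linarith
  have h5 : 0 ≤ A ^ 2 + G * Real.exp (2 * G) := by positivity
  nlinarith [mul_le_mul_of_nonneg_left h4 hq0]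

/-- Companion of `mix_exp_le` with the contraction A thrown away; it avoids the second-order cost A²
when no drift is available. -/
theorem mix_exp_le_of_nonneg {q A G : ℝ} (hq0 : 0 ≤ q) (hq1 : q ≤ 1) (hA : 0 ≤ A) (hG : 0 ≤ G) :
    1 - q + q * Real.exp (-A + G) ≤ 1 + G * Real.exp (2 * G) := by
  have h1 : Real.exp (-A + G) ≤ Real.exp G := Real.exp_le_exp.2 (by linarith)
  have h3 : Real.exp G - 1 ≤ G * Real.exp (2 * G) := by
    have := Real.add_one_le_exp (-G)
    have e : Real.exp (-G) * Real.exp G = 1 := by rw [← Real.exp_add]; simp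
    have h6 : Real.exp G ≤ Real.exp (2 * G) := Real.exp_le_exp.2 (by linarith)
    nlinarith [Real.exp_pos G, mul_le_mul_of_nonneg_left h6 hG]
  have h5 : 0 ≤ G * Real.exp (2 * G) := by positivity
  nlinarith

end ScalarInequalities

/-! ### Conditional bounds in integrated form, against bounded weights known from the past -/

section ConditionalExpectation

variable {Ω : Type*} {m m0 : MeasurableSpace Ω} {μ : Measure Ω}

theorem integrable_mul_of_bounded (hm : m ≤ m0) {v f : Ω → ℝ} (hv : Measurable[m] v) {c : ℝ}
    (hvc : ∀ ω, |v ω| ≤ c) (hf : Integrable f μ) : Integrable (fun ω => v ω * f ω) μ :=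
  hf.bdd_mul (c := c) (hv.mono hm le_rfl).aestronglyMeasurable
    (Filter.Eventually.of_forall fun ω => by simpa using hvc ω)

theorem CondPsiTwoLe.integrable {Z : Ω → ℝ} {s : ℝ} (hs : 0 < s)
    (h : CondPsiTwoLe m μ Z s) (hZ : Measurable Z) : Integrable Z μ := by
  have h1 := h.1.const_mul s
  refine h1.mono' hZ.aestronglyMeasurable (Filter.Eventually.of_forall fun ω => ?_)
  have := abs_le_exp_sq (Z ω / s)
  rw [← sq_abs] at this
  have e : |Z ω| = s * |Z ω / s| := by rw [abs_div, abs_of_pos hs]; field_simp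
  rw [Real.norm_eq_abs, e]
  gcongr

variable [IsProbabilityMeasure μ]

theorem integral_mul_condExp (hm : m ≤ m0) {v f : Ω → ℝ} (hv : Measurable[m] v) {c : ℝ}
    (hvc : ∀ ω, |v ω| ≤ c) (hf : Integrable f μ) :
    ∫ ω, v ω * (μ[f | m]) ω ∂μ = ∫ ω, v ω * f ω ∂μ := by
  have h := condExp_stronglyMeasurable_mul_of_bound hm hv.stronglyMeasurable hf c
    (Filter.Eventually.of_forall fun ω => by simpa using hvc ω)
  rw [← integral_condExp hm (f := fun ω => v ω * f ω)]
  exact integral_congr_ae h.symm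

theorem integral_mul_le_of_condExp_le (hm : m ≤ m0) {v f : Ω → ℝ} (hv : Measurable[m] v)
    {c : ℝ} (hv0 : ∀ ω, 0 ≤ v ω) (hvc : ∀ ω, v ω ≤ c) (hf : Integrable f μ) {k : ℝ}
    (hk : μ[f | m] ≤ᵐ[μ] fun _ => k) :
    ∫ ω, v ω * f ω ∂μ ≤ k * ∫ ω, v ω ∂μ := by
  have hvc' : ∀ ω, |v ω| ≤ c := fun ω => by rw [abs_of_nonneg (hv0 ω)]; exact hvc ω
  rw [← integral_mul_condExp hm hv hvc' hf, ← integral_const_mul]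
  apply integral_mono_ae (integrable_mul_of_bounded hm hv hvc' integrable_condExp)
  · have := (integrable_mul_of_bounded hm hv hvc' (integrable_const k (μ := μ)))
    simpa [mul_comm] using this
  · filter_upwards [hk] with ω h
    have := mul_le_mul_of_nonneg_left h (hv0 ω)
    linarith

theorem integral_mul_eq_zero_of_condExp (hm : m ≤ m0) {v f : Ω → ℝ} (hv : Measurable[m] v)
    {c : ℝ} (hvc : ∀ ω, |v ω| ≤ c) (hf : Integrable f μ) (hk : μ[f | m] =ᵐ[μ] fun _ => 0) :
    ∫ ω, v ω * f ω ∂μ = 0 := by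
  rw [← integral_mul_condExp hm hv hvc hf]
  refine (integral_congr_ae (g := fun _ => (0 : ℝ)) ?_).trans (by simp)
  filter_upwards [hk] with ω h
  simp [h]

theorem integrable_of_measurable_bounded {v : Ω → ℝ} (hv : Measurable v) {c : ℝ}
    (hvc : ∀ ω, |v ω| ≤ c) : Integrable v μ :=
  (integrable_const c).mono' hv.aestronglyMeasurable
    (Filter.Eventually.of_forall fun ω => by simpa using hvc ω)

theorem CondPsiTwoLe.integral_mul_exp_sub_le {Z : Ω → ℝ} {s : ℝ} (hm : m ≤ m0)
    (h : CondPsiTwoLe m μ Z s) {v : Ω → ℝ} (hv : Measurable[m] v)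
    {c : ℝ} (hv0 : ∀ ω, 0 ≤ v ω) (hvc : ∀ ω, v ω ≤ c) :
    ∫ ω, v ω * (Real.exp (|Z ω / s| ^ 2) - 1) ∂μ ≤ ∫ ω, v ω ∂μ := by
  have h1 := integral_mul_le_of_condExp_le hm hv hv0 hvc h.1 h.2
  have hvc' : ∀ ω, |v ω| ≤ c := fun ω => by rw [abs_of_nonneg (hv0 ω)]; exact hvc ω
  have h2 := integrable_mul_of_bounded hm hv hvc' h.1
  have h3 := integrable_of_measurable_bounded (μ := μ) (hv.mono hm le_rfl) hvc'
  simp only [mul_sub, mul_one]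
  rw [integral_sub h2 h3]
  linarith

/-- Conditional moment generating function bound for a centred sub-Gaussian variable. -/
theorem CondPsiTwoLe.integral_mul_exp_le {Z : Ω → ℝ} {s : ℝ} (hs : 0 < s) (hm : m ≤ m0)
    (h : CondPsiTwoLe m μ Z s) (hZ : Measurable Z) (h0 : μ[Z | m] =ᵐ[μ] fun _ => 0)
    {f a g : Ω → ℝ} (hf : Measurable[m] f) (ha : Measurable[m] a) (hg : Measurable[m] g)
    {cf ca : ℝ} (hf0 : ∀ ω, 0 ≤ f ω) (hfc : ∀ ω, f ω ≤ cf) (hac : ∀ ω, |a ω| ≤ ca)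
    (hg0 : ∀ ω, 0 ≤ g ω) (hgs : ∀ ω, g ω * s ^ 2 ≤ 1 / 2) :
    Integrable (fun ω => f ω * Real.exp (a ω * Z ω + g ω * Z ω ^ 2)) μ ∧
    ∫ ω, f ω * Real.exp (a ω * Z ω + g ω * Z ω ^ 2) ∂μ ≤
      ∫ ω, f ω * Real.exp (2 * ((a ω ^ 2 + g ω) * s ^ 2)) ∂μ := by
  have hset : MeasurableSet[m] {ω | a ω ^ 2 * s ^ 2 ≤ 1 / 2} :=
    measurableSet_le ((ha.pow_const 2).mul_const _) measurable_const
  have hl : Measurable[m] fun ω => f ω * linCoeff s (a ω) :=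
    hf.mul (Measurable.ite hset ha measurable_const)
  have he : Measurable[m] fun ω => f ω * expCoeff s (a ω) (g ω) := by
    refine hf.mul (Measurable.ite hset ?_ ?_)
    · exact (((ha.pow_const 2).add hg).mul_const _).const_mul _
    · exact (Real.measurable_exp.comp ((ha.pow_const 2).mul_const _)).mul
        ((hg.mul_const _).const_add _)
  have hca : 0 ≤ ca := by
    obtain ⟨ω⟩ := (inferInstance : (ae μ).NeBot).nonempty
    exact (abs_nonneg _).trans (hac ω)
  have hcf : 0 ≤ cf := by
    obtain ⟨ω⟩ := (inferInstance : (ae μ).NeBot).nonempty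
    exact (hf0 ω).trans (hfc ω)
  have ha2 : ∀ ω, a ω ^ 2 * s ^ 2 ≤ ca ^ 2 * s ^ 2 := fun ω => by
    have : a ω ^ 2 ≤ ca ^ 2 := sq_le_sq' (abs_le.1 (hac ω)).1 (abs_le.1 (hac ω)).2
    gcongr
  have hlb : ∀ ω, |f ω * linCoeff s (a ω)| ≤ cf * ca := fun ω => by
    rw [abs_mul, abs_of_nonneg (hf0 ω)]
    refine mul_le_mul (hfc ω) ?_ (abs_nonneg _) hcf
    unfold linCoeff; split_ifs
    · exact hac ω
    · simpa using hca
  have heb : ∀ ω, |f ω * expCoeff s (a ω) (g ω)| ≤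
      cf * (2 * (ca ^ 2 * s ^ 2 + 1 / 2) + Real.exp (ca ^ 2 * s ^ 2) * (1 / 4 + 1 / 2)) := by
    intro ω
    rw [abs_mul, abs_of_nonneg (hf0 ω), abs_of_nonneg (expCoeff_nonneg (hg0 ω))]
    refine mul_le_mul (hfc ω) ?_ (expCoeff_nonneg (hg0 ω)) hcf
    have h1 := ha2 ω
    have h2 := hgs ω
    have h3 := hg0 ω
    unfold expCoeff; split_ifs
    · have : 0 ≤ Real.exp (ca ^ 2 * s ^ 2) := (Real.exp_pos _).le
      nlinarith
    · have h4 : Real.exp (a ω ^ 2 * s ^ 2) * (1 / 4 + g ω * s ^ 2) ≤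
        Real.exp (ca ^ 2 * s ^ 2) * (1 / 4 + 1 / 2) := by gcongr
      have : 0 ≤ ca ^ 2 * s ^ 2 := by positivity
      linarith
  have hmid : Measurable[m] fun ω => f ω * Real.exp (2 * ((a ω ^ 2 + g ω) * s ^ 2)) :=
    hf.mul (Real.measurable_exp.comp ((((ha.pow_const 2).add hg).mul_const _).const_mul _))
  have hmidb : ∀ ω, |f ω * Real.exp (2 * ((a ω ^ 2 + g ω) * s ^ 2))| ≤
      cf * Real.exp (2 * (ca ^ 2 * s ^ 2 + 1 / 2)) := fun ω => by
    rw [abs_of_nonneg (mul_nonneg (hf0 ω) (Real.exp_pos _).le)]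
    have h1 := ha2 ω
    have h2 := hgs ω
    refine mul_le_mul (hfc ω) (Real.exp_le_exp.2 (by nlinarith)) (Real.exp_pos _).le hcf
  have hZi := h.integrable hs hZ
  have i1 := integrable_mul_of_bounded hm hl hlb hZi
  have i2 := integrable_of_measurable_bounded (μ := μ) (hmid.mono hm le_rfl) hmidb
  have i3' := integrable_mul_of_bounded hm he heb h.1
  have i3'' := integrable_of_measurable_bounded (μ := μ) (he.mono hm le_rfl) heb
  have i3 : Integrable (fun ω => f ω * expCoeff s (a ω) (g ω) *
      (Real.exp (|Z ω / s| ^ 2) - 2)) μ := by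
    simp only [mul_sub]
    exact i3'.sub (i3''.mul_const 2)
  -- The majorant serves twice: it is integrable, which proves integrability of the left side, and
  -- its linear and exponential parts have integral zero and at most zero.
  have hpt : ∀ ω, f ω * Real.exp (a ω * Z ω + g ω * Z ω ^ 2) ≤
      f ω * linCoeff s (a ω) * Z ω + f ω * Real.exp (2 * ((a ω ^ 2 + g ω) * s ^ 2)) +
      f ω * expCoeff s (a ω) (g ω) * (Real.exp (|Z ω / s| ^ 2) - 2) := fun ω => by
    have := mul_le_mul_of_nonneg_left
      (exp_mul_add_mul_sq_le hs (hg0 ω) (hgs ω) (a ω) (Z ω)) (hf0 ω)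
    linarith
  have hmeas : Measurable fun ω => f ω * Real.exp (a ω * Z ω + g ω * Z ω ^ 2) :=
    (hf.mono hm le_rfl).mul (Real.measurable_exp.comp
      (((ha.mono hm le_rfl).mul hZ).add ((hg.mono hm le_rfl).mul (hZ.pow_const 2))))
  have hint : Integrable (fun ω => f ω * Real.exp (a ω * Z ω + g ω * Z ω ^ 2)) μ :=
    ((i1.add i2).add i3).mono' hmeas.aestronglyMeasurable
      (Filter.Eventually.of_forall fun ω => by
        rw [Real.norm_eq_abs, abs_of_nonneg (mul_nonneg (hf0 ω) (Real.exp_pos _).le)]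
        exact hpt ω)
  refine ⟨hint, (integral_mono hint ((i1.add i2).add i3) hpt).trans ?_⟩
  have hz := integral_mul_eq_zero_of_condExp hm hl hlb hZi h0
  have hE := integral_mul_le_of_condExp_le hm he
    (fun ω => mul_nonneg (hf0 ω) (expCoeff_nonneg (hg0 ω)))
    (fun ω => (le_abs_self _).trans (heb ω)) h.1 h.2
  have hE' : ∫ ω, f ω * expCoeff s (a ω) (g ω) * (Real.exp (|Z ω / s| ^ 2) - 2) ∂μ ≤ 0 := by
    simp only [mul_sub]
    rw [integral_sub i3' (i3''.mul_const 2), integral_mul_const]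
    linarith
  have hadd := integral_add (i1.add i2) i3
  have hadd2 := integral_add i1 i2
  simp only [Pi.add_apply] at hadd hadd2 ⊢
  rw [hadd, hadd2, hz]
  linarith

end ConditionalExpectation

/-! ### Norm of a sub-Gaussian vector by Gaussian averaging -/

section GaussianAveraging

variable {Ω : Type*} [m0 : MeasurableSpace Ω] {μ : Measure Ω} [IsProbabilityMeasure μ] {d : ℕ}

theorem lintegral_exp_neg_mul_norm_sq {b : ℝ} (hb : 0 < b) :
    ∫⁻ g : EuclideanSpace ℝ (Fin d), ENNReal.ofReal (Real.exp (-b * ‖g‖ ^ 2)) =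
      ENNReal.ofReal ((Real.pi / b) ^ ((d : ℝ) / 2)) := by
  have h := GaussianFourier.integral_rexp_neg_mul_sq_norm (V := EuclideanSpace ℝ (Fin d)) hb
  have hi : Integrable fun g : EuclideanSpace ℝ (Fin d) => Real.exp (-b * ‖g‖ ^ 2) := by
    -- The Bochner integral of a non-integrable function is 0, but the known value is positive.
    by_contra hn
    rw [integral_undef hn] at h
    have : 0 < (Real.pi / b) ^ ((Module.finrank ℝ (EuclideanSpace ℝ (Fin d)) : ℝ) / 2) := by
      positivity
    exact this.ne h
  rw [← ofReal_integral_eq_lintegral_ofReal hi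
    (Filter.Eventually.of_forall fun _ => (Real.exp_pos _).le), h]
  simp

/-- A vector whose one-dimensional marginals have `Ψ₂`-norm at most `√L` has
`E exp (‖X‖² / (2 L)) ≤ 2 * 2 ^ (d / 2)`. -/
theorem lintegral_exp_norm_sq_le {X : Ω → EuclideanSpace ℝ (Fin d)} (hX : Measurable X) {L : ℝ}
    (hL : 0 < L)
    (h : ∀ u : EuclideanSpace ℝ (Fin d), ‖u‖ = 1 →
      ∫⁻ ω, ENNReal.ofReal (Real.exp ((inner ℝ u (X ω)) ^ 2 / L)) ∂μ ≤ 2) :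
    ∫⁻ ω, ENNReal.ofReal (Real.exp (‖X ω‖ ^ 2 / (2 * L))) ∂μ ≤
      2 * ENNReal.ofReal (2 ^ ((d : ℝ) / 2)) := by
  have hsL : 0 < Real.sqrt L := Real.sqrt_pos.2 hL
  have hsq : Real.sqrt L ^ 2 = L := Real.sq_sqrt hL.le
  let F : Ω → EuclideanSpace ℝ (Fin d) → ENNReal := fun ω g =>
    ENNReal.ofReal (Real.exp (-(1 / 2) * ‖g‖ ^ 2 + (Real.sqrt L)⁻¹ * inner ℝ g (X ω)))
  have hF : Measurable (Function.uncurry F) := by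
    apply ENNReal.measurable_ofReal.comp
    apply Real.measurable_exp.comp
    exact ((measurable_snd.norm.pow_const 2).const_mul _).add
      ((measurable_snd.inner (hX.comp measurable_fst)).const_mul _)
  have hswap := lintegral_lintegral_swap (μ := μ)
    (ν := (volume : Measure (EuclideanSpace ℝ (Fin d)))) hF.aemeasurable
  -- Completing the square: translating g by X/√L turns the integrand into a centred Gaussian times
  -- exp(‖X‖²/(2L)).
  have hleft : ∀ ω, ∫⁻ g, F ω g = ENNReal.ofReal (Real.exp (‖X ω‖ ^ 2 / (2 * L))) *
      ENNReal.ofReal ((Real.pi / (1 / 2)) ^ ((d : ℝ) / 2)) := fun ω => by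
    rw [← lintegral_exp_neg_mul_norm_sq (by norm_num : (0 : ℝ) < 1 / 2),
      ← lintegral_const_mul _ (by fun_prop)]
    rw [← lintegral_add_right_eq_self _ ((Real.sqrt L)⁻¹ • X ω)]
    refine lintegral_congr fun g => ?_
    rw [← ENNReal.ofReal_mul (Real.exp_pos _).le, ← Real.exp_add]
    simp only [F]
    congr 2
    rw [norm_add_sq_real, inner_add_left, inner_smul_right, real_inner_smul_left, norm_smul,
      mul_pow, norm_inv, Real.norm_eq_abs, abs_of_pos hsL, inv_pow, hsq,
      real_inner_self_eq_norm_sq]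
    have h1 : (Real.sqrt L)⁻¹ * ((Real.sqrt L)⁻¹ * ‖X ω‖ ^ 2) = L⁻¹ * ‖X ω‖ ^ 2 := by
      rw [← mul_assoc, ← sq, inv_pow, hsq]
    have h2 : ‖X ω‖ ^ 2 / (2 * L) = L⁻¹ * ‖X ω‖ ^ 2 / 2 := by field_simp
    rw [h2]
    linear_combination h1
  -- For fixed g only the marginal along u = g/‖g‖ occurs. AM-GM spends half of the Gaussian weight,
  -- -‖g‖²/2 becoming -‖g‖²/4, and the ratio of the two Gaussian integrals is the factor 2^(d/2).
  have hright : ∀ g, ∫⁻ ω, F ω g ∂μ ≤ 2 * ENNReal.ofReal (Real.exp (-(1 / 4) * ‖g‖ ^ 2)) := by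
    intro g
    obtain ⟨u, hu, hg⟩ : ∃ u : EuclideanSpace ℝ (Fin d),
        (g = 0 ∨ ‖u‖ = 1) ∧ g = ‖g‖ • u := by
      by_cases hg : g = 0
      · exact ⟨0, by simp [hg]⟩
      · exact ⟨‖g‖⁻¹ • g, by simp [norm_smul, hg], by simp [smul_smul, hg]⟩
    by_cases hg0 : g = 0
    · simp [F, hg0]
    have hu1 := hu.resolve_left hg0
    have hpt : ∀ ω, F ω g ≤ ENNReal.ofReal (Real.exp (-(1 / 4) * ‖g‖ ^ 2)) *
        ENNReal.ofReal (Real.exp ((inner ℝ u (X ω)) ^ 2 / L)) := fun ω => by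
      rw [← ENNReal.ofReal_mul (Real.exp_pos _).le, ← Real.exp_add]
      apply ENNReal.ofReal_le_ofReal
      apply Real.exp_le_exp.2
      have hin : inner ℝ g (X ω) = ‖g‖ * inner ℝ u (X ω) := by
        conv_lhs => rw [hg]
        rw [real_inner_smul_left]
      rw [hin]
      have h1 : (inner ℝ u (X ω)) ^ 2 / L = ((Real.sqrt L)⁻¹ * inner ℝ u (X ω)) ^ 2 := by
        rw [mul_pow, inv_pow, hsq]; field_simp
      rw [h1]
      nlinarith [sq_nonneg ((Real.sqrt L)⁻¹ * inner ℝ u (X ω) - ‖g‖ / 2)]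
    calc ∫⁻ ω, F ω g ∂μ ≤ ∫⁻ ω, ENNReal.ofReal (Real.exp (-(1 / 4) * ‖g‖ ^ 2)) *
        ENNReal.ofReal (Real.exp ((inner ℝ u (X ω)) ^ 2 / L)) ∂μ := lintegral_mono hpt
      _ = ENNReal.ofReal (Real.exp (-(1 / 4) * ‖g‖ ^ 2)) *
        ∫⁻ ω, ENNReal.ofReal (Real.exp ((inner ℝ u (X ω)) ^ 2 / L)) ∂μ := by
          rw [lintegral_const_mul]
          exact ENNReal.measurable_ofReal.comp (Real.measurable_exp.comp
            (((measurable_const.inner hX).pow_const 2).div_const _))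
      _ ≤ ENNReal.ofReal (Real.exp (-(1 / 4) * ‖g‖ ^ 2)) * 2 := by gcongr; exact h u hu1
      _ = _ := mul_comm _ _
  have hmain : (∫⁻ ω, ENNReal.ofReal (Real.exp (‖X ω‖ ^ 2 / (2 * L))) ∂μ) *
      ENNReal.ofReal ((Real.pi / (1 / 2)) ^ ((d : ℝ) / 2)) ≤
      2 * ENNReal.ofReal ((Real.pi / (1 / 4)) ^ ((d : ℝ) / 2)) := by
    rw [← lintegral_exp_neg_mul_norm_sq (by norm_num : (0 : ℝ) < 1 / 4),
      ← lintegral_const_mul _ (by fun_prop), ← lintegral_mul_const _ (by fun_prop)]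
    simp_rw [← hleft]
    rw [hswap]
    exact lintegral_mono hright
  have hpi : (Real.pi / (1 / 4)) ^ ((d : ℝ) / 2) =
      2 ^ ((d : ℝ) / 2) * (Real.pi / (1 / 2)) ^ ((d : ℝ) / 2) := by
    rw [← Real.mul_rpow (by norm_num) (by positivity)]
    congr 1; ring
  rw [hpi, ENNReal.ofReal_mul (by positivity), ← mul_assoc] at hmain
  have hpos : 0 < (Real.pi / (1 / 2)) ^ ((d : ℝ) / 2) := by positivity
  exact (ENNReal.mul_le_mul_iff_left (by simpa using hpos) ENNReal.ofReal_ne_top).1 hmain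

end GaussianAveraging

/-! ### One SGD update: integrating out the noise -/

section NoiseStep

theorem measurable_norm_sq_comp {Ω E : Type*} {m : MeasurableSpace Ω} [NormedAddCommGroup E]
    [MeasurableSpace E] [BorelSpace E] {x : Ω → E} (hx : Measurable[m] x) :
    Measurable[m] fun ω => ‖x ω‖ ^ 2 :=
  (measurable_norm.comp hx).pow_const 2

variable {Ω : Type*} {m m0 : MeasurableSpace Ω} {μ : Measure Ω} [IsProbabilityMeasure μ] {d : ℕ}

theorem norm_sq_sgd_update (x e : EuclideanSpace ℝ (Fin d)) (η z : ℝ) :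
    ‖e - (η * (inner ℝ x e - z)) • x‖ ^ 2 =
      ‖e‖ ^ 2 - 2 * η * (inner ℝ x e - z) * inner ℝ x e
        + η ^ 2 * (inner ℝ x e - z) ^ 2 * ‖x‖ ^ 2 := by
  rw [norm_sub_sq_real, norm_smul, inner_smul_right, real_inner_comm x e, mul_pow,
    Real.norm_eq_abs, sq_abs]
  ring

/-- Exponential moment of one SGD update, conditionally on everything but the noise. -/
theorem CondPsiTwoLe.integral_exp_sgd_update_le {Z : Ω → ℝ} {σ : ℝ} (hσ : 0 < σ) (hm : m ≤ m0)
    (h : CondPsiTwoLe m μ Z σ) (hZ : Measurable Z) (h0 : μ[Z | m] =ᵐ[μ] fun _ => 0)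
    {x e : Ω → EuclideanSpace ℝ (Fin d)} (hx : Measurable[m] x) (he : Measurable[m] e)
    {f : Ω → ℝ} (hf : Measurable[m] f) {cf r R s η ε : ℝ}
    (hf0 : ∀ ω, 0 ≤ f ω) (hfc : ∀ ω, f ω ≤ cf) (hxr : ∀ ω, ‖x ω‖ ^ 2 ≤ r)
    (heR : ∀ ω, ‖e ω‖ ^ 2 ≤ R) (hs : 0 ≤ s) (hη : 0 ≤ η) (hε : ε ≤ 1 / 1000)
    (h1 : s * η * σ ^ 2 ≤ ε) (h2 : s * η ^ 2 * r * σ ^ 2 ≤ ε) :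
    Integrable (fun ω => f ω * Real.exp
      (s * ‖e ω - (η * (inner ℝ (x ω) (e ω) - Z ω)) • x ω‖ ^ 2)) μ ∧
    ∫ ω, f ω * Real.exp (s * ‖e ω - (η * (inner ℝ (x ω) (e ω) - Z ω)) • x ω‖ ^ 2) ∂μ ≤
      ∫ ω, f ω * (Real.exp (s * ‖e ω‖ ^ 2) *
        Real.exp (-(1.9 * (s * η) * inner ℝ (x ω) (e ω) ^ 2) +
          (1.1 * (s * η ^ 2 * ‖x ω‖ ^ 2) * inner ℝ (x ω) (e ω) ^ 2
            + 2 * (s * η ^ 2 * ‖x ω‖ ^ 2) * σ ^ 2))) ∂μ := by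
  set y : Ω → ℝ := fun ω => inner ℝ (x ω) (e ω) with hy
  set γ : Ω → ℝ := fun ω => s * η ^ 2 * ‖x ω‖ ^ 2 with hγ
  obtain ⟨ω₀⟩ := (inferInstance : (ae μ).NeBot).nonempty
  have hr : 0 ≤ r := (sq_nonneg _).trans (hxr ω₀)
  have hR : 0 ≤ R := (sq_nonneg _).trans (heR ω₀)
  have hcf : 0 ≤ cf := (hf0 ω₀).trans (hfc ω₀)
  have hym : Measurable[m] y := hx.inner he
  have hγm : Measurable[m] γ := (measurable_norm_sq_comp hx).const_mul _
  have hγ0 : ∀ ω, 0 ≤ γ ω := fun ω => by positivity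
  have hγr : ∀ ω, γ ω ≤ s * η ^ 2 * r := fun ω => by
    have := hxr ω
    simp only [hγ]; gcongr
  have hγσ : ∀ ω, γ ω * σ ^ 2 ≤ ε := fun ω =>
    (mul_le_mul_of_nonneg_right (hγr ω) (sq_nonneg σ)).trans h2
  have hy2 : ∀ ω, y ω ^ 2 ≤ r * R := fun ω => by
    have h3 := abs_real_inner_le_norm (x ω) (e ω)
    calc y ω ^ 2 = |y ω| ^ 2 := (sq_abs _).symm
      _ ≤ (‖x ω‖ * ‖e ω‖) ^ 2 := by gcongr
      _ = ‖x ω‖ ^ 2 * ‖e ω‖ ^ 2 := by ring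
      _ ≤ r * R := mul_le_mul (hxr ω) (heR ω) (sq_nonneg _) hr
  have hya : ∀ ω, |y ω| ≤ Real.sqrt (r * R) := fun ω => Real.abs_le_sqrt (hy2 ω)
  -- With y = ⟨x, e⟩ and γ = s η² ‖x‖², the new exponent is s‖e‖² + (-2sη + γ) y² + 2(sη - γ) y Z +
  -- γ Z². The part without Z goes into the weight.
  have key := h.integral_mul_exp_le hσ hm hZ h0
    (f := fun ω => f ω * Real.exp (s * ‖e ω‖ ^ 2 + (-2 * (s * η) + γ ω) * y ω ^ 2))
    (a := fun ω => 2 * (s * η - γ ω) * y ω) (g := γ)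
    (cf := cf * Real.exp (s * R + s * η ^ 2 * r * (r * R)))
    (ca := 2 * (s * η + s * η ^ 2 * r) * Real.sqrt (r * R))
    (hf.mul (Real.measurable_exp.comp (((measurable_norm_sq_comp he).const_mul _).add
      ((hγm.const_add _).mul (hym.pow_const 2)))))
    (((hγm.const_sub _).const_mul _).mul hym) hγm
    (fun ω => mul_nonneg (hf0 ω) (Real.exp_pos _).le)
    (fun ω => by
      refine mul_le_mul (hfc ω) (Real.exp_le_exp.2 ?_) (Real.exp_pos _).le hcf
      have a1 := mul_le_mul_of_nonneg_left (heR ω) hs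
      have a2 : γ ω * y ω ^ 2 ≤ s * η ^ 2 * r * (r * R) :=
        mul_le_mul (hγr ω) (hy2 ω) (sq_nonneg _) (by positivity)
      have a3 : 0 ≤ s * η * y ω ^ 2 := by positivity
      nlinarith)
    (fun ω => by
      rw [abs_mul]
      refine mul_le_mul ?_ (hya ω) (abs_nonneg _) (by positivity)
      rw [abs_mul, abs_two]
      refine mul_le_mul_of_nonneg_left ?_ (by norm_num)
      have := hγ0 ω
      have := hγr ω
      have : 0 ≤ s * η := by positivity
      rw [abs_le]; constructor <;> linarith)
    hγ0 (fun ω => (hγσ ω).trans (by linarith))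
  have hfe : ∀ ω, f ω * Real.exp (s * ‖e ω‖ ^ 2 + (-2 * (s * η) + γ ω) * y ω ^ 2) *
      Real.exp (2 * (s * η - γ ω) * y ω * Z ω + γ ω * Z ω ^ 2) =
      f ω * Real.exp (s * ‖e ω - (η * (inner ℝ (x ω) (e ω) - Z ω)) • x ω‖ ^ 2) := fun ω => by
    rw [mul_assoc, ← Real.exp_add, norm_sq_sgd_update]
    congr 2
    simp only [hγ, hy]
    ring
  simp only [hfe] at key
  refine ⟨key.1, key.2.trans ?_⟩
  have hpt : ∀ ω, f ω * Real.exp (s * ‖e ω‖ ^ 2 + (-2 * (s * η) + γ ω) * y ω ^ 2) *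
      Real.exp (2 * (((2 * (s * η - γ ω) * y ω) ^ 2 + γ ω) * σ ^ 2)) ≤
      f ω * (Real.exp (s * ‖e ω‖ ^ 2) *
        Real.exp (-(1.9 * (s * η) * y ω ^ 2) +
          (1.1 * γ ω * y ω ^ 2 + 2 * γ ω * σ ^ 2))) := fun ω => by
    rw [mul_assoc, ← Real.exp_add, ← Real.exp_add]
    refine mul_le_mul_of_nonneg_left (Real.exp_le_exp.2 ?_) (hf0 ω)
    have b1 := hγσ ω
    have b2 := hγ0 ω
    have b3 : 0 ≤ s * η := by positivity
    -- The linear noise term costs 8 (sη - γ)² σ² y², at most 0.008 (sη + γ) y². This lowers the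
    -- drift coefficient 2 to 1.9 and raises the coefficient 1 of γ y² to 1.1.
    have b4 : (s * η - γ ω) ^ 2 * σ ^ 2 ≤ ε * (s * η + γ ω) := by
      have c1 : (s * η) * (s * η * σ ^ 2) ≤ (s * η) * ε := by gcongr
      have c2 : γ ω * (γ ω * σ ^ 2) ≤ γ ω * ε := by gcongr
      have c3 : 0 ≤ s * η * γ ω * σ ^ 2 := by positivity
      nlinarith
    have b5 : (s * η - γ ω) ^ 2 * σ ^ 2 ≤ (s * η + γ ω) / 1000 := by
      have := mul_le_mul_of_nonneg_right hε (add_nonneg b3 b2)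
      linarith
    have b6 := mul_le_mul_of_nonneg_right b5 (sq_nonneg (y ω))
    have b7 : 0 ≤ s * η * y ω ^ 2 := by positivity
    have b8 : 0 ≤ γ ω * y ω ^ 2 := by positivity
    nlinarith
  refine integral_mono_of_nonneg
    (Filter.Eventually.of_forall fun ω => by
      have := hf0 ω
      simp only [Pi.zero_apply]; positivity) ?_ (Filter.Eventually.of_forall hpt)
  refine integrable_of_measurable_bounded (c := cf * (Real.exp (s * R) *
    Real.exp (1.1 * (s * η ^ 2 * r) * (r * R) + 2 * ε))) ?_ fun ω => ?_
  · refine Measurable.mono (hf.mul ((Real.measurable_exp.comp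
      ((measurable_norm_sq_comp he).const_mul _)).mul (Real.measurable_exp.comp
      (((hym.pow_const 2).const_mul _).neg.add (((hγm.const_mul _).mul (hym.pow_const 2)).add
        ((hγm.const_mul _).mul_const _)))))) hm le_rfl
  · have c0 := hf0 ω
    rw [abs_of_nonneg (by positivity)]
    have a1 := mul_le_mul_of_nonneg_left (heR ω) hs
    have a2 : γ ω * y ω ^ 2 ≤ s * η ^ 2 * r * (r * R) :=
      mul_le_mul (hγr ω) (hy2 ω) (sq_nonneg _) (by positivity)
    have a3 : 0 ≤ s * η * y ω ^ 2 := by positivity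
    have a4 := hγσ ω
    refine mul_le_mul (hfc ω) (mul_le_mul (Real.exp_le_exp.2 a1) (Real.exp_le_exp.2 ?_)
      (Real.exp_pos _).le (Real.exp_pos _).le) (by positivity) hcf
    nlinarith

end NoiseStep

/-! ### Errors, measurability and the law of the pulled arm -/

namespace Bandit

variable {Ω : Type*} {d K : ℕ} (B : Bandit Ω d K)

/-- The estimation error of arm `i` at time `t`. -/
def err (t : ℕ) (i : Fin K) (ω : Ω) : EuclideanSpace ℝ (Fin d) := B.est t ω i - B.betaStar i

theorem err_succ (t : ℕ) (i : Fin K) (ω : Ω) :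
    B.err (t + 1) i ω = if B.arm t ω = i then
      B.err t i ω - (B.step t * (inner ℝ (B.X t ω) (B.err t i ω) - B.noise t ω)) • B.X t ω
      else B.err t i ω := by
  unfold err
  simp only [est]
  split_ifs with h
  · rw [reward, h, inner_sub_right, sub_right_comm]
    congr 2
    congr 1
    ring
  · rfl

theorem past_mono {s t : ℕ} (h : s ≤ t) : B.past s ≤ B.past t :=
  iSup₂_le fun k hk => le_iSup₂_of_le k (hk.trans_le h) le_rfl

theorem measurable_observation (t : ℕ) : Measurable[B.past (t + 1)]
    fun ω => (B.X t ω, B.coin t ω, B.arm t ω, B.reward t ω) := by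
  have h : MeasurableSpace.comap
      (fun ω => (B.X t ω, B.coin t ω, B.arm t ω, B.reward t ω)) inferInstance ≤ B.past (t + 1) :=
    le_iSup₂_of_le (f := fun (s : ℕ) (_ : s < t + 1) => MeasurableSpace.comap
      (fun ω => (B.X s ω, B.coin s ω, B.arm s ω, B.reward s ω)) inferInstance)
      t (Nat.lt_succ_self t) le_rfl
  exact (comap_measurable _).mono h le_rfl

theorem measurable_X_past (t : ℕ) : Measurable[B.past (t + 1)] (B.X t) :=
  measurable_fst.comp (B.measurable_observation t)

theorem measurable_est_past (t : ℕ) (i : Fin K) : Measurable[B.past t] fun ω => B.est t ω i := by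
  induction t with
  | zero => exact measurable_const
  | succ t ih =>
    have hX := B.measurable_X_past t
    have ho := B.measurable_observation t
    have ha : Measurable[B.past (t + 1)] (B.arm t) :=
      measurable_fst.comp (measurable_snd.comp (measurable_snd.comp ho))
    have hr : Measurable[B.past (t + 1)] (B.reward t) :=
      measurable_snd.comp (measurable_snd.comp (measurable_snd.comp ho))
    have he := ih.mono (B.past_mono (Nat.le_succ t)) le_rfl
    simp only [est]
    refine Measurable.ite (ha (measurableSet_singleton i)) ?_ he
    exact he.sub ((((hX.inner he).sub hr).const_mul _).smul hX)

theorem measurable_err_past (t : ℕ) (i : Fin K) : Measurable[B.past t] (B.err t i) :=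
  (B.measurable_est_past t i).sub measurable_const

theorem measurable_X_pastPlus (t : ℕ) : Measurable[B.pastPlus t] (B.X t) :=
  (comap_measurable _).mono le_sup_right le_rfl

variable (p : ℕ → ℝ)

/-- Conditional probability of pulling arm `i` given the past and the current covariate. -/
def pullProb (t : ℕ) (i : Fin K) (ω : Ω) : ℝ :=
  p t / K + (1 - p t) * (if B.greedyArm t ω = i then 1 else 0)

variable {B p}

theorem pullProb_nonneg {t : ℕ} (hp : 0 ≤ p t ∧ p t ≤ 1) (i : Fin K) (ω : Ω) :
    0 ≤ pullProb B p t i ω := by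
  unfold pullProb
  have : 0 ≤ 1 - p t := by linarith [hp.2]
  have := hp.1
  split_ifs <;> positivity

theorem pullProb_le_one {t : ℕ} (hp : 0 ≤ p t ∧ p t ≤ 1) (i : Fin K) (ω : Ω) :
    pullProb B p t i ω ≤ 1 := by
  have hK : (1 : ℝ) ≤ K := by exact_mod_cast (Fin.pos i)
  have h1 : p t / K ≤ p t := div_le_self hp.1 hK
  unfold pullProb
  split_ifs <;> linarith [hp.1, hp.2]

variable [m0 : MeasurableSpace Ω] {μ : Measure Ω}

theorem IsEpsGreedy.past_le (h : B.IsEpsGreedy μ p) (t : ℕ) : B.past t ≤ m0 := by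
  induction t using Nat.strong_induction_on with
  | _ t ih =>
    refine iSup₂_le fun s hs => ?_
    have hp : B.pastPlus s ≤ m0 := sup_le (ih s hs) (h.measurable_X s).comap_le
    have hg : Measurable (B.greedyArm s) := (h.measurable_greedyArm s).mono hp le_rfl
    have ha : Measurable (B.arm s) :=
      Measurable.ite (h.measurable_coin s (measurableSet_singleton true))
        (h.measurable_randArm s) hg
    have hb : Measurable fun ω => B.betaStar (B.arm s ω) := (measurable_of_finite _).comp ha
    have hr : Measurable (B.reward s) :=
      ((h.measurable_X s).inner hb).add (h.measurable_noise s)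
    exact ((h.measurable_X s).prodMk ((h.measurable_coin s).prodMk (ha.prodMk hr))).comap_le

theorem IsEpsGreedy.pastPlus_le (h : B.IsEpsGreedy μ p) (t : ℕ) : B.pastPlus t ≤ m0 :=
  sup_le (h.past_le t) (h.measurable_X t).comap_le

theorem IsEpsGreedy.measurable_pullProb (h : B.IsEpsGreedy μ p) (t : ℕ) (i : Fin K) :
    Measurable[B.pastPlus t] (pullProb B p t i) :=
  ((Measurable.ite (h.measurable_greedyArm t (measurableSet_singleton i)) measurable_const
    measurable_const).const_mul _).const_add _

/-- The event of pulling arm i is a disjoint union: coin up and random arm i, or coin down and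
greedy arm i. Coin and random arm are independent of everything else at time t, the noise included,
so the randomization can be averaged before the noise is treated. -/
theorem IsEpsGreedy.integral_pull [IsProbabilityMeasure μ] (h : B.IsEpsGreedy μ p) (t : ℕ)
    (i : Fin K) {F : Ω → ℝ}
    (hF : Measurable[B.pastPlus t ⊔ MeasurableSpace.comap (B.noise t) inferInstance] F)
    (hFi : Integrable F μ) :
    ∫ ω, (if B.arm t ω = i then F ω else 0) ∂μ = ∫ ω, pullProb B p t i ω * F ω ∂μ := by
  have hle : B.pastPlus t ⊔ MeasurableSpace.comap (B.noise t) inferInstance ≤ m0 :=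
    sup_le (h.pastPlus_le t) (h.measurable_noise t).comap_le
  have hcr : Measurable fun ω => (B.coin t ω, B.randArm t ω) :=
    (h.measurable_coin t).prodMk (h.measurable_randArm t)
  -- Factorisation over an event of the randomization. For the exploitation part it is applied to F
  -- times the indicator of the greedy choice, which is known from the past and the covariate.
  have hstep : ∀ (S : Set (Bool × Fin K)) (F : Ω → ℝ),
      Measurable[B.pastPlus t ⊔ MeasurableSpace.comap (B.noise t) inferInstance] F →
      ∫ ω in {ω | (B.coin t ω, B.randArm t ω) ∈ S}, F ω ∂μ =
        μ.real {ω | (B.coin t ω, B.randArm t ω) ∈ S} * ∫ ω, F ω ∂μ := fun S F hF => by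
    have hi := indep_of_indep_of_le_right (h.fresh t) hF.comap_le
    exact hi.setIntegral_eq_mul hcr.comap_le (hF.mono hle le_rfl).aemeasurable
      (f := fun x : ℝ => x) ⟨S, Set.Finite.measurableSet (Set.toFinite S), rfl⟩
      measurable_id.aestronglyMeasurable
  have hgm : MeasurableSet[B.pastPlus t] {ω | B.greedyArm t ω = i} :=
    h.measurable_greedyArm t (measurableSet_singleton i)
  have hF2 : Measurable[B.pastPlus t ⊔ MeasurableSpace.comap (B.noise t) inferInstance]
      ({ω | B.greedyArm t ω = i}.indicator F) :=
    hF.indicator ((le_sup_left : B.pastPlus t ≤ _) _ hgm)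
  have e1 := hstep {(true, i)} F hF
  have e2 := hstep {x | x.1 = false} _ hF2
  have m1 : μ.real {ω | (B.coin t ω, B.randArm t ω) ∈ ({(true, i)} : Set (Bool × Fin K))} =
      p t / K := by
    have hi := (h.coin_indep_randArm t).measure_inter_preimage_eq_mul {true} {i}
      (measurableSet_singleton _) (measurableSet_singleton _)
    have : {ω | (B.coin t ω, B.randArm t ω) ∈ ({(true, i)} : Set (Bool × Fin K))} =
        B.coin t ⁻¹' {true} ∩ B.randArm t ⁻¹' {i} := by ext ω; simp
    rw [this, measureReal_def, hi, ENNReal.toReal_mul]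
    have h1 := h.coin_law t
    have h2 := h.randArm_law t i
    rw [measureReal_def] at h1 h2
    have r1 : μ (B.coin t ⁻¹' {true}) = μ {ω | B.coin t ω = true} := rfl
    have r2 : μ (B.randArm t ⁻¹' {i}) = μ {ω | B.randArm t ω = i} := rfl
    rw [r1, r2, h1, h2]; ring
  have m2 : μ.real {ω | (B.coin t ω, B.randArm t ω) ∈ {x : Bool × Fin K | x.1 = false}} =
      1 - p t := by
    have hc : MeasurableSet {ω | B.coin t ω = true} :=
      h.measurable_coin t (measurableSet_singleton true)
    rw [← h.coin_law t, ← probReal_compl_eq_one_sub hc]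
    congr 1; ext ω; simp
  have s1 : MeasurableSet {ω | (B.coin t ω, B.randArm t ω) ∈ ({(true, i)} : Set (Bool × Fin K))} :=
    hcr (measurableSet_singleton _)
  have s2 : MeasurableSet {ω | (B.coin t ω, B.randArm t ω) ∈
      {x : Bool × Fin K | x.1 = false}} := hcr (Set.Finite.measurableSet (Set.toFinite _))
  have hFgi : Integrable ({ω | B.greedyArm t ω = i}.indicator F) μ :=
    hFi.indicator (h.pastPlus_le t _ hgm)
  rw [m1, ← integral_indicator s1] at e1
  rw [m2, ← integral_indicator s2] at e2
  have hl : ∀ ω, (if B.arm t ω = i then F ω else 0) =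
      {ω | (B.coin t ω, B.randArm t ω) ∈ ({(true, i)} : Set (Bool × Fin K))}.indicator F ω +
      {ω | (B.coin t ω, B.randArm t ω) ∈ {x : Bool × Fin K | x.1 = false}}.indicator
        ({ω | B.greedyArm t ω = i}.indicator F) ω := fun ω => by
    simp only [arm, Set.indicator, Set.mem_ofPred_eq, Set.mem_singleton_iff, Prod.mk.injEq]
    by_cases hc : B.coin t ω = true <;> simp [hc]
  have hr : ∀ ω, pullProb B p t i ω * F ω =
      p t / K * F ω + (1 - p t) * {ω | B.greedyArm t ω = i}.indicator F ω := fun ω => by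
    simp only [pullProb, Set.indicator, Set.mem_ofPred_eq]
    split_ifs <;> ring
  simp only [hl, hr]
  rw [integral_add (hFi.indicator s1) (hFgi.indicator s2), e1, e2,
    integral_add (hFi.const_mul _) (hFgi.const_mul _), integral_const_mul, integral_const_mul]

end Bandit

/-! ### One SGD update: integrating out the covariate -/

section CovariateStep

variable {d : ℕ}

theorem exp_four_thousandths_le : Real.exp (0.004 : ℝ) ≤ 1.01 := by
  have h8 := Real.add_one_le_exp (-0.004 : ℝ)
  have h9 : Real.exp (0.004 : ℝ) * Real.exp (-0.004 : ℝ) = 1 := by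
    rw [← Real.exp_add]; norm_num
  have := Real.exp_pos (0.004 : ℝ)
  nlinarith

/-- The exponent on the left is at most 4ε + 2.2 N/40, which is below 0.004 + N/16. The factor exp
0.004 is absorbed by enlarging 1.1 to 1.2 and 2 to 2.1. -/
theorem perturbation_mul_exp_le {γ y2 N σ2 ε : ℝ} (hγ : 0 ≤ γ) (hy : 0 ≤ y2) (hσ : 0 ≤ σ2)
    (hγσ : γ * σ2 ≤ ε) (hε : ε ≤ 1 / 1000) (hγy : γ * y2 ≤ N / 40) (hN : 0 ≤ N) :
    (1.1 * γ * y2 + 2 * γ * σ2) * Real.exp (2 * (1.1 * γ * y2 + 2 * γ * σ2)) ≤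
      (1.2 * (γ * y2) + 2.1 * (γ * σ2)) * Real.exp (N / 16) := by
  have h1 : 0 ≤ γ * y2 := mul_nonneg hγ hy
  have h2 : 0 ≤ γ * σ2 := mul_nonneg hγ hσ
  have hexp : Real.exp (2 * (1.1 * γ * y2 + 2 * γ * σ2)) ≤ 1.01 * Real.exp (N / 16) :=
    calc _ ≤ Real.exp (0.004 + N / 16) := Real.exp_le_exp.2 (by linarith)
      _ = Real.exp 0.004 * Real.exp (N / 16) := Real.exp_add _ _
      _ ≤ _ := mul_le_mul_of_nonneg_right exp_four_thousandths_le (Real.exp_pos _).le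
  calc _ ≤ (1.1 * γ * y2 + 2 * γ * σ2) * (1.01 * Real.exp (N / 16)) :=
        mul_le_mul_of_nonneg_left hexp (by linarith)
    _ = ((1.1 * γ * y2 + 2 * γ * σ2) * 1.01) * Real.exp (N / 16) := by ring
    _ ≤ _ := mul_le_mul_of_nonneg_right (by linarith) (Real.exp_pos _).le

/-- ‖X‖² is expanded into coordinates and each product with N is decoupled separately. A term
without N leaves the additive 1/2 per coordinate. -/
theorem sum_mul_perturbation_le {ι : Type*} [Fintype ι] {P : ι → ℝ} {N a b : ℝ}
    (hP : ∀ j, 0 ≤ P j) (hN : 0 ≤ N) (ha : 0 ≤ a) (hb : 0 ≤ b) :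
    (a * ((∑ j, P j) * N) + b * ∑ j, P j) * Real.exp (N / 16) ≤
      (a + b) * ∑ j, ((Real.exp (P j) - 1) + (Real.exp N - 1)) / 2
        + b * (Fintype.card ι / 2) := by
  have h2 : (∑ j, P j) * (N * Real.exp (N / 16)) ≤
      ∑ j, ((Real.exp (P j) - 1) + (Real.exp N - 1)) / 2 := by
    rw [Finset.sum_mul]
    exact Finset.sum_le_sum fun j _ => mul_sq_mul_exp_le (hP j) hN
  have h3 : (∑ j, P j) * Real.exp (N / 16) ≤
      ∑ j, ((Real.exp (P j) - 1) + (Real.exp N - 1)) / 2 + Fintype.card ι / 2 := by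
    rw [Finset.sum_mul]
    calc ∑ j, P j * Real.exp (N / 16) ≤
        ∑ j, (((Real.exp (P j) - 1) + (Real.exp N - 1)) / 2 + 1 / 2) :=
          Finset.sum_le_sum fun j _ => by linarith [mul_exp_le (hP j) hN]
      _ = _ := by
        rw [Finset.sum_add_distrib, Finset.sum_const, Finset.card_univ, nsmul_eq_mul]; ring
  have h4 := mul_le_mul_of_nonneg_left h2 ha
  have h5 := mul_le_mul_of_nonneg_left h3 hb
  linarith

/-- Pointwise bound behind the covariate step: `N`, `P j` are the normalised squared marginals. -/
theorem truncated_mix_exp_le {ι : Type*} [Fintype ι] {P : ι → ℝ} {N D L σ s η q ε b κ y2 x2 : ℝ}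
    (hκ : κ = 0 ∨ κ = 1) (hP : ∀ j, 0 ≤ P j) (hN : 0 ≤ N) (hD : 0 ≤ D) (hL : 0 < L)
    (hs : 0 ≤ s) (hη : 0 ≤ η) (hq0 : 0 ≤ q) (hq1 : q ≤ 1)
    (hy : y2 = D * L * N) (hx : x2 = L * ∑ j, P j)
    (hDb : L * D ≤ b * σ ^ 2) (hε : ε ≤ 1 / 1000) (hεb : ε * b ≤ 1 / 40) (hb : 0 ≤ b)
    (G : Prop) [Decidable G] (hG : G → s * η ^ 2 * x2 * σ ^ 2 ≤ ε) :
    (if G then 1 - q + q * Real.exp (-(1.9 * (s * η) * y2) +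
        (1.1 * (s * η ^ 2 * x2) * y2 + 2 * (s * η ^ 2 * x2) * σ ^ 2)) else 0) ≤
      1 - κ * (1.9 * (s * η) * (q * y2)) + κ * (4 * (s * η) ^ 2 * L ^ 2 * D ^ 2)
          * (Real.exp N - 1)
        + (1.2 * s * η ^ 2 * L ^ 2 * D + 2.1 * s * η ^ 2 * σ ^ 2 * L) *
          ∑ j, ((Real.exp (P j) - 1) + (Real.exp N - 1)) / 2
        + 2.1 * s * η ^ 2 * σ ^ 2 * L * (Fintype.card ι / 2) := by
  have hN2 := sq_le_exp_sub_one hN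
  have hPsum : 0 ≤ ∑ j, P j := Finset.sum_nonneg fun j _ => hP j
  have hy0 : 0 ≤ y2 := hy ▸ by positivity
  have hx0 : 0 ≤ x2 := hx ▸ mul_nonneg hL.le hPsum
  have hA0 : 0 ≤ 1.9 * (s * η) * y2 := by positivity
  have hA2 : (1.9 * (s * η) * y2) ^ 2 ≤ (4 * (s * η) ^ 2 * L ^ 2 * D ^ 2) * (Real.exp N - 1) :=
    calc (1.9 * (s * η) * y2) ^ 2 = (4 * (s * η) ^ 2 * L ^ 2 * D ^ 2) * N ^ 2 * (3.61 / 4) := by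
          rw [hy]; ring
      _ ≤ (4 * (s * η) ^ 2 * L ^ 2 * D ^ 2) * N ^ 2 * 1 :=
          mul_le_mul_of_nonneg_left (by norm_num) (by positivity)
      _ = (4 * (s * η) ^ 2 * L ^ 2 * D ^ 2) * N ^ 2 := mul_one _
      _ ≤ _ := mul_le_mul_of_nonneg_left hN2 (by positivity)
  have ha : 0 ≤ 1.2 * s * η ^ 2 * L ^ 2 * D := by positivity
  have hb' : 0 ≤ 2.1 * s * η ^ 2 * σ ^ 2 * L := by positivity
  have hpert := sum_mul_perturbation_le hP hN ha hb'
  have hrest : 0 ≤ (1.2 * s * η ^ 2 * L ^ 2 * D * ((∑ j, P j) * N) +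
      2.1 * s * η ^ 2 * σ ^ 2 * L * ∑ j, P j) * Real.exp (N / 16) := by positivity
  by_cases hGt : G
  · rw [if_pos hGt]
    have hγ0 : 0 ≤ s * η ^ 2 * x2 := by positivity
    have hγσ := hG hGt
    -- The two smallness conditions meet here: truncation gives γ σ² ≤ ε, the error bound gives L D
    -- ≤ b σ², and ε b ≤ 1/40. Thus the quadratic perturbation is a small multiple of N and its
    -- exponential stays integrable.
    have hγy : s * η ^ 2 * x2 * y2 ≤ N / 40 := by
      have h1 : s * η ^ 2 * x2 * (L * D) ≤ s * η ^ 2 * x2 * (b * σ ^ 2) :=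
        mul_le_mul_of_nonneg_left hDb hγ0
      have h2 : b * (s * η ^ 2 * x2 * σ ^ 2) ≤ b * ε := mul_le_mul_of_nonneg_left hγσ hb
      have h3 : s * η ^ 2 * x2 * (L * D) ≤ 1 / 40 := by linarith
      calc s * η ^ 2 * x2 * y2 = s * η ^ 2 * x2 * (L * D) * N := by rw [hy]; ring
        _ ≤ 1 / 40 * N := mul_le_mul_of_nonneg_right h3 hN
        _ = _ := by ring
    have h1 := perturbation_mul_exp_le hγ0 hy0 (sq_nonneg σ) hγσ hε hγy hN
    have hH0 : 0 ≤ 1.1 * (s * η ^ 2 * x2) * y2 + 2 * (s * η ^ 2 * x2) * σ ^ 2 := by positivity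
    have e1 : 1.2 * (s * η ^ 2 * x2 * y2) + 2.1 * (s * η ^ 2 * x2 * σ ^ 2) =
        1.2 * s * η ^ 2 * L ^ 2 * D * ((∑ j, P j) * N) +
          2.1 * s * η ^ 2 * σ ^ 2 * L * ∑ j, P j := by
      rw [hx, hy]; ring
    rw [e1] at h1
    rcases hκ with rfl | rfl
    · have := mix_exp_le_of_nonneg hq0 hq1 hA0 hH0
      linarith
    · have := mix_exp_le hq0 hq1 hA0 hH0
      linarith
  -- Beyond the truncation level the left side is 0, and the right side is nonnegative because 1 -
  -- qA + A² ≥ 0. The drift term is thus the full second moment, not a truncated one.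
  · rw [if_neg hGt]
    rcases hκ with rfl | rfl
    · linarith
    · have h1 : q * (1.9 * (s * η) * y2) ≤ 1.9 * (s * η) * y2 := mul_le_of_le_one_left hA0 hq1
      have h2 := sq_nonneg (1.9 * (s * η) * y2 - 1)
      linarith

variable {Ω : Type*} {m m0 : MeasurableSpace Ω} {μ : Measure Ω} [IsProbabilityMeasure μ]

/-- The sub-Gaussian hypothesis speaks of random unit vectors only, so the error is written as
length times direction, with a fixed basis vector where it vanishes. -/
theorem exists_unit_direction [NeZero d] {e : Ω → EuclideanSpace ℝ (Fin d)}
    (he : Measurable[m] e) : ∃ u : Ω → EuclideanSpace ℝ (Fin d), Measurable[m] u ∧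
      (∀ ω, ‖u ω‖ = 1) ∧ ∀ ω, e ω = ‖e ω‖ • u ω := by
  refine ⟨fun ω => if e ω = 0 then EuclideanSpace.single 0 1 else ‖e ω‖⁻¹ • e ω, ?_, ?_, ?_⟩
  · exact Measurable.ite (he (measurableSet_singleton 0)) measurable_const
      (((measurable_norm.comp he).inv).smul he)
  · intro ω
    dsimp only
    split_ifs with h
    · simp
    · rw [norm_smul, norm_inv, norm_norm, inv_mul_cancel₀ (norm_ne_zero_iff.2 h)]
  · intro ω
    dsimp only
    split_ifs with h
    · simp [h]
    · rw [smul_smul, mul_inv_cancel₀ (norm_ne_zero_iff.2 h), one_smul]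

theorem CondPsiTwoVecLe.integral_truncated_mix_exp_le [NeZero d] (hm : m ≤ m0)
    {X : Ω → EuclideanSpace ℝ (Fin d)} (hXm : Measurable X) {L : ℝ} (hL : 0 < L)
    (hX : CondPsiTwoVecLe m μ X (Real.sqrt L)) {e : Ω → EuclideanSpace ℝ (Fin d)}
    (he : Measurable[m] e) {S : Set Ω} (hS : MeasurableSet[m] S) {R σ s η ε b κ r : ℝ}
    (heR : ∀ ω ∈ S, ‖e ω‖ ^ 2 ≤ R) (hκ : κ = 0 ∨ κ = 1) (hR : 0 ≤ R)
    {q : Ω → ℝ} (hq : Measurable q) (hq0 : ∀ ω, 0 ≤ q ω) (hq1 : ∀ ω, q ω ≤ 1)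
    (hs : 0 ≤ s) (hη : 0 ≤ η) (hRb : L * R ≤ b * σ ^ 2) (hε : ε ≤ 1 / 1000)
    (hεb : ε * b ≤ 1 / 40) (hb : 0 ≤ b) (hr : s * η ^ 2 * r * σ ^ 2 ≤ ε) :
    ∫ ω in S ∩ {ω | ‖X ω‖ ^ 2 ≤ r}, Real.exp (s * ‖e ω‖ ^ 2) *
      (1 - q ω + q ω * Real.exp (-(1.9 * (s * η) * inner ℝ (X ω) (e ω) ^ 2) +
        (1.1 * (s * η ^ 2 * ‖X ω‖ ^ 2) * inner ℝ (X ω) (e ω) ^ 2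
          + 2 * (s * η ^ 2 * ‖X ω‖ ^ 2) * σ ^ 2))) ∂μ ≤
    ∫ ω in S, Real.exp (s * ‖e ω‖ ^ 2) * (1 + κ * (4 * (s * η) ^ 2 * L ^ 2 * (‖e ω‖ ^ 2) ^ 2)
        + (1.2 * s * η ^ 2 * L ^ 2 * d) * ‖e ω‖ ^ 2 + 3.15 * s * η ^ 2 * σ ^ 2 * L * d) ∂μ
      - κ * (1.9 * (s * η) *
        ∫ ω in S, Real.exp (s * ‖e ω‖ ^ 2) * (q ω * inner ℝ (X ω) (e ω) ^ 2) ∂μ) := by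
  classical
  obtain ⟨u, hu, hu1, heu⟩ := exists_unit_direction he
  have hsq : Real.sqrt L ^ 2 = L := Real.sq_sqrt hL.le
  have hκ0 : 0 ≤ κ := by rcases hκ with rfl | rfl <;> norm_num
  set D : Ω → ℝ := fun ω => ‖e ω‖ ^ 2 with hD
  have hD0 : ∀ ω, 0 ≤ D ω := fun ω => sq_nonneg _
  have hDm : Measurable[m] D := measurable_norm_sq_comp he
  set N : Ω → ℝ := fun ω => |inner ℝ (u ω) (X ω) / Real.sqrt L| ^ 2 with hN
  set P : Fin d → Ω → ℝ := fun j ω =>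
    |inner ℝ (EuclideanSpace.single j (1 : ℝ)) (X ω) / Real.sqrt L| ^ 2 with hP
  have hψN := hX u hu hu1
  have hψP : ∀ j, CondPsiTwoLe m μ
      (fun ω => inner ℝ (EuclideanSpace.single j (1 : ℝ)) (X ω)) (Real.sqrt L) := fun j =>
    hX (fun _ => EuclideanSpace.single j (1 : ℝ)) measurable_const (fun _ => by simp)
  have hy : ∀ ω, inner ℝ (X ω) (e ω) ^ 2 = D ω * L * N ω := fun ω => by
    simp only [hD, hN]
    conv_lhs => rw [heu ω]
    rw [inner_smul_right, real_inner_comm, sq_abs, div_pow, hsq]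
    field_simp
  have hx : ∀ ω, ‖X ω‖ ^ 2 = L * ∑ j, P j ω := fun ω => by
    rw [EuclideanSpace.norm_sq_eq, Finset.mul_sum]
    refine Finset.sum_congr rfl fun j _ => ?_
    simp only [hP]
    rw [sq_abs, div_pow, hsq, EuclideanSpace.inner_single_left]
    simp
    field_simp
  set v : Ω → ℝ := S.indicator fun ω => Real.exp (s * D ω) with hv
  have hvm : Measurable[m] v := Measurable.indicator
    (Real.measurable_exp.comp (hDm.const_mul s)) hS
  have hv0 : ∀ ω, 0 ≤ v ω := fun ω => Set.indicator_nonneg (fun _ _ => (Real.exp_pos _).le) ω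
  have hvb : ∀ ω (k : ℕ), v ω * D ω ^ k ≤ Real.exp (s * R) * R ^ k := fun ω k => by
    by_cases hω : ω ∈ S
    · have h1 := heR ω hω
      have h2 : 0 ≤ D ω := hD0 ω
      rw [hv, Set.indicator_of_mem hω]
      gcongr
    · rw [hv, Set.indicator_of_notMem hω, zero_mul]; positivity
  set k1 := κ * (4 * (s * η) ^ 2 * L ^ 2) with hk1
  set k2 := 1.2 * s * η ^ 2 * L ^ 2 with hk2
  set k3 := 2.1 * s * η ^ 2 * σ ^ 2 * L with hk3
  have hk10 : 0 ≤ k1 := by positivity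
  have hk20 : 0 ≤ k2 := by positivity
  have hk30 : 0 ≤ k3 := by positivity
  set w1 : Ω → ℝ := fun ω => v ω * (k1 * D ω ^ 2) with hw1
  set w2 : Ω → ℝ := fun ω => v ω * (k2 * D ω + k3) with hw2
  have hw1m : Measurable[m] w1 := hvm.mul ((hDm.pow_const 2).const_mul _)
  have hw2m : Measurable[m] w2 := hvm.mul ((hDm.const_mul _).add_const _)
  have hw10 : ∀ ω, 0 ≤ w1 ω := fun ω => by have := hv0 ω; positivity
  have hw20 : ∀ ω, 0 ≤ w2 ω := fun ω => by
    have := hv0 ω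
    have := hD0 ω
    positivity
  have hw1b : ∀ ω, w1 ω ≤ k1 * (Real.exp (s * R) * R ^ 2) := fun ω => by
    have := mul_le_mul_of_nonneg_left (hvb ω 2) hk10
    simp only [hw1]; linarith
  have hw2b : ∀ ω, w2 ω ≤ k2 * (Real.exp (s * R) * R) + k3 * Real.exp (s * R) := fun ω => by
    have h1 := mul_le_mul_of_nonneg_left (hvb ω 1) hk20
    have h2 := mul_le_mul_of_nonneg_left (hvb ω 0) hk30
    simp only [hw2]
    simp only [pow_one, pow_zero, mul_one] at h1 h2
    linarith
  have hvb' : ∀ ω, v ω ≤ Real.exp (s * R) := fun ω => by simpa using hvb ω 0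
  have hEN : Integrable (fun ω => Real.exp (N ω) - 1) μ := hψN.1.sub (integrable_const 1)
  have hEP : ∀ j, Integrable (fun ω => Real.exp (P j ω) - 1) μ := fun j =>
    (hψP j).1.sub (integrable_const 1)
  have abs0 : ∀ {f : Ω → ℝ} {c : ℝ}, (∀ ω, 0 ≤ f ω) → (∀ ω, f ω ≤ c) → ∀ ω, |f ω| ≤ c :=
    fun h0 hc ω => by rw [abs_of_nonneg (h0 ω)]; exact hc ω
  have iv := integrable_of_measurable_bounded (μ := μ) (hvm.mono hm le_rfl) (abs0 hv0 hvb')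
  have iw1' := integrable_of_measurable_bounded (μ := μ) (hw1m.mono hm le_rfl) (abs0 hw10 hw1b)
  have iw2' := integrable_of_measurable_bounded (μ := μ) (hw2m.mono hm le_rfl) (abs0 hw20 hw2b)
  have iw1 := integrable_mul_of_bounded hm hw1m (abs0 hw10 hw1b) hEN
  have iw2N := integrable_mul_of_bounded hm hw2m (abs0 hw20 hw2b) hEN
  have iw2P := fun j => integrable_mul_of_bounded hm hw2m (abs0 hw20 hw2b) (hEP j)
  have hNm : Measurable N :=
    ((((hu.mono hm le_rfl).inner hXm).div_const _).abs).pow_const 2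
  have hyi : Integrable (fun ω => v ω * (q ω * inner ℝ (X ω) (e ω) ^ 2)) μ := by
    have hvD := integrable_mul_of_bounded (μ := μ) hm (v := fun ω => v ω * D ω ^ 1 * L)
      ((hvm.mul (hDm.pow_const 1)).mul_const _)
      (abs0 (c := Real.exp (s * R) * R ^ 1 * L)
        (fun ω => mul_nonneg (mul_nonneg (hv0 ω) (pow_nonneg (hD0 ω) 1)) hL.le)
        (fun ω => mul_le_mul_of_nonneg_right (hvb ω 1) hL.le)) hψN.1
    refine hvD.mono' ?_ (Filter.Eventually.of_forall fun ω => ?_)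
    · exact ((hvm.mono hm le_rfl).mul (hq.mul
        ((hXm.inner (he.mono hm le_rfl)).pow_const 2))).aestronglyMeasurable
    · have h1 := hv0 ω
      have h2 := hq0 ω
      rw [Real.norm_eq_abs, abs_of_nonneg (by positivity), hy]
      have h3 : N ω ≤ Real.exp (N ω) := by linarith [Real.add_one_le_exp (N ω)]
      have h4 : q ω * (D ω * L * N ω) ≤ D ω * L * N ω :=
        mul_le_of_le_one_left (mul_nonneg (mul_nonneg (hD0 ω) hL.le) (by positivity)) (hq1 ω)
      calc v ω * (q ω * (D ω * L * N ω)) ≤ v ω * (D ω * L * N ω) := by gcongr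
        _ = v ω * D ω ^ 1 * L * N ω := by ring
        _ ≤ _ := mul_le_mul_of_nonneg_left h3
          (mul_nonneg (mul_nonneg h1 (pow_nonneg (hD0 ω) 1)) hL.le)
  have hGm : MeasurableSet {ω | ‖X ω‖ ^ 2 ≤ r} :=
    measurableSet_le (measurable_norm_sq_comp hXm) measurable_const
  set c4 := κ * (1.9 * (s * η)) with hc4
  -- the integrable majorant
  set M : Ω → ℝ := fun ω => v ω - c4 * (v ω * (q ω * inner ℝ (X ω) (e ω) ^ 2)) +
    w1 ω * (Real.exp (N ω) - 1) +
    (∑ j, (w2 ω * (Real.exp (P j ω) - 1) + w2 ω * (Real.exp (N ω) - 1)) / 2) +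
    k3 * (d / 2) * v ω with hM
  have isum : Integrable (fun ω => ∑ j, (w2 ω * (Real.exp (P j ω) - 1) +
      w2 ω * (Real.exp (N ω) - 1)) / 2) μ :=
    integrable_finsetSum _ fun j _ => ((iw2P j).add iw2N).div_const 2
  have iM : Integrable M μ :=
    (((iv.sub (hyi.const_mul _)).add iw1).add isum).add (iv.const_mul _)
  have hpt : ∀ ω, (S ∩ {ω | ‖X ω‖ ^ 2 ≤ r}).indicator (fun ω => Real.exp (s * D ω) *
      (1 - q ω + q ω * Real.exp (-(1.9 * (s * η) * inner ℝ (X ω) (e ω) ^ 2) +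
        (1.1 * (s * η ^ 2 * ‖X ω‖ ^ 2) * inner ℝ (X ω) (e ω) ^ 2
          + 2 * (s * η ^ 2 * ‖X ω‖ ^ 2) * σ ^ 2)))) ω ≤ M ω := fun ω => by
    by_cases hω : ω ∈ S
    · have h1 := truncated_mix_exp_le (P := fun j => P j ω) (N := N ω) (D := D ω) (L := L)
        (σ := σ) (s := s) (η := η) (q := q ω) (ε := ε) (b := b) (κ := κ)
        (y2 := inner ℝ (X ω) (e ω) ^ 2) (x2 := ‖X ω‖ ^ 2) hκ (fun j => sq_nonneg _)
        (sq_nonneg _) (hD0 ω) hL hs hη (hq0 ω) (hq1 ω) (hy ω) (hx ω)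
        ((mul_le_mul_of_nonneg_left (heR ω hω) hL.le).trans hRb) hε hεb hb (‖X ω‖ ^ 2 ≤ r)
        (fun h => le_trans (by gcongr) hr)
      have hvω : v ω = Real.exp (s * D ω) := Set.indicator_of_mem hω _
      have h2 := mul_le_mul_of_nonneg_left h1 (hv0 ω)
      have h3 : v ω * (if ‖X ω‖ ^ 2 ≤ r then
          1 - q ω + q ω * Real.exp (-(1.9 * (s * η) * inner ℝ (X ω) (e ω) ^ 2) +
          (1.1 * (s * η ^ 2 * ‖X ω‖ ^ 2) * inner ℝ (X ω) (e ω) ^ 2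
          + 2 * (s * η ^ 2 * ‖X ω‖ ^ 2) * σ ^ 2)) else 0) =
          (S ∩ {ω | ‖X ω‖ ^ 2 ≤ r}).indicator (fun ω => Real.exp (s * D ω) *
      (1 - q ω + q ω * Real.exp (-(1.9 * (s * η) * inner ℝ (X ω) (e ω) ^ 2) +
        (1.1 * (s * η ^ 2 * ‖X ω‖ ^ 2) * inner ℝ (X ω) (e ω) ^ 2
          + 2 * (s * η ^ 2 * ‖X ω‖ ^ 2) * σ ^ 2)))) ω := by
        simp only [Set.indicator, Set.mem_inter_iff, hω, true_and, Set.mem_ofPred_eq, hvω]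
        split_ifs <;> simp
      rw [← h3]
      refine h2.trans (le_of_eq ?_)
      simp only [hM, hw1, hw2, hc4, ← mul_add, ← mul_div_assoc, Fintype.card_fin]
      simp only [mul_div_assoc, ← Finset.mul_sum]
      ring
    · have hvω : v ω = 0 := Set.indicator_of_notMem hω _
      rw [Set.indicator_of_notMem (fun h => hω h.1)]
      simp [hM, hw1, hw2, hvω]
  have hSm : MeasurableSet S := hm _ hS
  rw [← integral_indicator (hSm.inter hGm)]
  have hle : ∫ ω, (S ∩ {ω | ‖X ω‖ ^ 2 ≤ r}).indicator (fun ω => Real.exp (s * D ω) *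
      (1 - q ω + q ω * Real.exp (-(1.9 * (s * η) * inner ℝ (X ω) (e ω) ^ 2) +
        (1.1 * (s * η ^ 2 * ‖X ω‖ ^ 2) * inner ℝ (X ω) (e ω) ^ 2
          + 2 * (s * η ^ 2 * ‖X ω‖ ^ 2) * σ ^ 2)))) ω ∂μ ≤ ∫ ω, M ω ∂μ := by
    refine integral_mono_of_nonneg (Filter.Eventually.of_forall fun ω => ?_) iM
      (Filter.Eventually.of_forall hpt)
    refine Set.indicator_nonneg (fun ω _ => mul_nonneg (Real.exp_pos _).le ?_) ω
    have h1 := hq1 ω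
    have h2 := hq0 ω
    have := mul_nonneg h2 (Real.exp_pos (-(1.9 * (s * η) * inner ℝ (X ω) (e ω) ^ 2) +
        (1.1 * (s * η ^ 2 * ‖X ω‖ ^ 2) * inner ℝ (X ω) (e ω) ^ 2
          + 2 * (s * η ^ 2 * ‖X ω‖ ^ 2) * σ ^ 2))).le
    linarith
  refine hle.trans ?_
  have b1 := hψN.integral_mul_exp_sub_le hm hw1m hw10 hw1b
  have b2 := hψN.integral_mul_exp_sub_le hm hw2m hw20 hw2b
  have b3 := fun j => (hψP j).integral_mul_exp_sub_le hm hw2m hw20 hw2b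
  have hMint : ∫ ω, M ω ∂μ ≤ ∫ ω, v ω ∂μ -
      c4 * ∫ ω, v ω * (q ω * inner ℝ (X ω) (e ω) ^ 2) ∂μ + ∫ ω, w1 ω ∂μ +
      d * ∫ ω, w2 ω ∂μ + k3 * (d / 2) * ∫ ω, v ω ∂μ := by
    have i1 := hyi.const_mul c4
    have i2 := iv.const_mul (k3 * (d / 2))
    have e0 : ∫ ω, M ω ∂μ = ∫ ω, v ω ∂μ -
        c4 * ∫ ω, v ω * (q ω * inner ℝ (X ω) (e ω) ^ 2) ∂μ +
        ∫ ω, w1 ω * (Real.exp (N ω) - 1) ∂μ +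
        ∑ j, (∫ ω, w2 ω * (Real.exp (P j ω) - 1) ∂μ +
          ∫ ω, w2 ω * (Real.exp (N ω) - 1) ∂μ) / 2 + k3 * (d / 2) * ∫ ω, v ω ∂μ := by
      simp only [hM]
      have a1 := integral_add (((iv.sub i1).add iw1).add isum) i2
      have a2 := integral_add ((iv.sub i1).add iw1) isum
      have a3 := integral_add (iv.sub i1) iw1
      have a4 := integral_sub iv i1
      simp only [Pi.add_apply, Pi.sub_apply] at a1 a2 a3 a4
      have a5 := integral_finsetSum (μ := μ) Finset.univ
        fun j _ => ((iw2P j).add iw2N).div_const 2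
      simp only [Pi.add_apply] at a5
      rw [a1, a2, a3, a4, a5, integral_const_mul, integral_const_mul]
      congr 2
      refine Finset.sum_congr rfl fun j _ => ?_
      rw [integral_div, integral_add (iw2P j) iw2N]
    rw [e0]
    have hs2 : ∑ j : Fin d, (∫ ω, w2 ω * (Real.exp (P j ω) - 1) ∂μ +
          ∫ ω, w2 ω * (Real.exp (N ω) - 1) ∂μ) / 2 ≤ d * ∫ ω, w2 ω ∂μ := by
      calc _ ≤ ∑ _j : Fin d, ∫ ω, w2 ω ∂μ := Finset.sum_le_sum fun j _ => by
            have := b3 j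
            simp only [hP, hN] at this b2 ⊢
            linarith
        _ = _ := by simp
    have b1' : ∫ ω, w1 ω * (Real.exp (N ω) - 1) ∂μ ≤ ∫ ω, w1 ω ∂μ := b1
    linarith
  refine hMint.trans (le_of_eq ?_)
  -- The constant 3.15 is 2.1 from the exponential terms of the d coordinates plus 1.05 from their
  -- additive halves.
  have hfin : ∫ ω, v ω ∂μ + ∫ ω, w1 ω ∂μ + d * ∫ ω, w2 ω ∂μ + k3 * (d / 2) * ∫ ω, v ω ∂μ =
      ∫ ω in S, Real.exp (s * D ω) * (1 + κ * (4 * (s * η) ^ 2 * L ^ 2 * (D ω) ^ 2)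
        + (1.2 * s * η ^ 2 * L ^ 2 * d) * D ω + 3.15 * s * η ^ 2 * σ ^ 2 * L * d) ∂μ := by
    have a1 := integral_add iv iw1'
    have a2 := integral_add (iv.add iw1') (iw2'.const_mul (d : ℝ))
    have a3 := integral_add ((iv.add iw1').add (iw2'.const_mul (d : ℝ)))
      (iv.const_mul (k3 * (d / 2)))
    simp only [Pi.add_apply] at a1 a2 a3
    rw [← integral_const_mul, ← integral_const_mul, ← a1, ← a2, ← a3, ← integral_indicator hSm]
    refine integral_congr_ae (Filter.Eventually.of_forall fun ω => ?_)
    by_cases hω : ω ∈ S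
    · simp only [Set.indicator_of_mem hω, hw1, hw2, hv, hk1, hk2, hk3]
      ring
    · simp only [Set.indicator_of_notMem hω, hw1, hw2, hv]
      ring
  have hlast : ∫ ω, v ω * (q ω * inner ℝ (X ω) (e ω) ^ 2) ∂μ =
      ∫ ω in S, Real.exp (s * D ω) * (q ω * inner ℝ (X ω) (e ω) ^ 2) ∂μ := by
    rw [← integral_indicator hSm]
    refine integral_congr_ae (Filter.Eventually.of_forall fun ω => ?_)
    by_cases hω : ω ∈ S
    · simp only [Set.indicator_of_mem hω, hv]
    · simp only [Set.indicator_of_notMem hω, hv, zero_mul]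
  rw [← hfin, ← hlast, hc4]
  ring

end CovariateStep

/-! ### Consequences of the covariate assumptions -/

section Covariates

variable {d : ℕ} {Ω : Type*} {m m0 : MeasurableSpace Ω} {μ : Measure Ω}

theorem CondPsiTwoVecLe.integrable_mul_coord {X : Ω → EuclideanSpace ℝ (Fin d)}
    (hXm : Measurable X) {L : ℝ} (hL : 0 < L) (hX : CondPsiTwoVecLe m μ X (Real.sqrt L))
    {T : Set (EuclideanSpace ℝ (Fin d))} (hT : MeasurableSet T) (i j : Fin d) :
    Integrable (fun ω => T.indicator (fun x => x i * x j) (X ω)) μ := by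
  have hψ : ∀ k, CondPsiTwoLe m μ
      (fun ω => inner ℝ (EuclideanSpace.single k (1 : ℝ)) (X ω)) (Real.sqrt L) := fun k =>
    hX (fun _ => EuclideanSpace.single k (1 : ℝ)) measurable_const (fun _ => by simp)
  have hco : ∀ (k : Fin d) (ω : Ω), X ω k ^ 2 ≤ L * Real.exp
      (|inner ℝ (EuclideanSpace.single k (1 : ℝ)) (X ω) / Real.sqrt L| ^ 2) := fun k ω => by
    have h1 := Real.add_one_le_exp
      (|inner ℝ (EuclideanSpace.single k (1 : ℝ)) (X ω) / Real.sqrt L| ^ 2)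
    have h2 : L * |inner ℝ (EuclideanSpace.single k (1 : ℝ)) (X ω) / Real.sqrt L| ^ 2 =
        X ω k ^ 2 := by
      rw [sq_abs, div_pow, Real.sq_sqrt hL.le, EuclideanSpace.inner_single_left]
      simp
      field_simp
    nlinarith
  refine (((hψ i).1.const_mul L).add ((hψ j).1.const_mul L)).mono' ?_
    (Filter.Eventually.of_forall fun ω => ?_)
  · have : Measurable fun x : EuclideanSpace ℝ (Fin d) => x i * x j := by fun_prop
    exact ((this.indicator hT).comp hXm).aestronglyMeasurable
  · have h1 := hco i ω
    have h2 := hco j ω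
    have h3 : |X ω i * X ω j| ≤ X ω i ^ 2 + X ω j ^ 2 := by
      rw [abs_le]; constructor <;> nlinarith [sq_nonneg (X ω i + X ω j), sq_nonneg (X ω i - X ω j)]
    simp only [Pi.add_apply]
    rw [Real.norm_eq_abs]
    by_cases h : X ω ∈ T
    · rw [Set.indicator_of_mem h]; linarith
    · rw [Set.indicator_of_notMem h, abs_zero]
      nlinarith [sq_nonneg (X ω i), sq_nonneg (X ω j)]

variable [IsProbabilityMeasure μ]

/-- Lower bound on conditional second moments in random directions. -/
theorem mul_integral_norm_sq_le_of_condGram (hm : m ≤ m0) {X : Ω → EuclideanSpace ℝ (Fin d)}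
    (hXm : Measurable X) {L : ℝ} (hL : 0 < L) (hX : CondPsiTwoVecLe m μ X (Real.sqrt L))
    {T : Set (EuclideanSpace ℝ (Fin d))} (hT : MeasurableSet T) {l : ℝ}
    (hgram : ∀ᵐ ω ∂μ, (condGram m μ X T ω - l • (1 : Matrix (Fin d) (Fin d) ℝ)).PosSemidef)
    {e : Ω → EuclideanSpace ℝ (Fin d)} (he : Measurable[m] e) {v : Ω → ℝ} (hv : Measurable[m] v)
    (hv0 : ∀ ω, 0 ≤ v ω) {c : ℝ} (hvc : ∀ ω, v ω * ‖e ω‖ ^ 2 ≤ c) :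
    Integrable (fun ω => v ω * T.indicator (fun x => inner ℝ x (e ω) ^ 2) (X ω)) μ ∧
    l * ∫ ω, v ω * ‖e ω‖ ^ 2 ∂μ ≤
      ∫ ω, v ω * T.indicator (fun x => inner ℝ x (e ω) ^ 2) (X ω) ∂μ := by
  have hei : ∀ i, Measurable[m] fun ω => e ω i := fun i =>
    (by fun_prop : Measurable fun x : EuclideanSpace ℝ (Fin d) => x i).comp he
  have hw : ∀ i j, Measurable[m] fun ω => v ω * (e ω i * e ω j) := fun i j =>
    hv.mul ((hei i).mul (hei j))
  have hcoord : ∀ ω i, |e ω i| ≤ ‖e ω‖ := fun ω i => by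
    simpa using PiLp.norm_apply_le (e ω) i
  have hwb : ∀ i j ω, |v ω * (e ω i * e ω j)| ≤ c := fun i j ω => by
    rw [abs_mul, abs_mul, abs_of_nonneg (hv0 ω)]
    refine le_trans ?_ (hvc ω)
    rw [sq]
    have := hv0 ω
    gcongr <;> exact hcoord ω _
  have hint := fun i j => hX.integrable_mul_coord hXm hL hT i j
  -- The conditional Gram matrix is defined entry by entry, so the quadratic form in the random
  -- direction is expanded and the known coefficients are moved across the conditional expectation.
  have hexp : ∀ ω, v ω * T.indicator (fun x => inner ℝ x (e ω) ^ 2) (X ω) =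
      ∑ i, ∑ j, v ω * (e ω i * e ω j) * T.indicator (fun x => x i * x j) (X ω) := fun ω => by
    by_cases h : X ω ∈ T
    · simp only [Set.indicator_of_mem h]
      rw [PiLp.inner_apply, sq, Finset.sum_mul_sum, Finset.mul_sum]
      refine Finset.sum_congr rfl fun i _ => ?_
      rw [Finset.mul_sum]
      refine Finset.sum_congr rfl fun j _ => ?_
      simp
      ring
    · simp [Set.indicator_of_notMem h]
  have hi1 : ∀ i j, Integrable (fun ω => v ω * (e ω i * e ω j) *
      T.indicator (fun x => x i * x j) (X ω)) μ := fun i j =>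
    integrable_mul_of_bounded hm (hw i j) (hwb i j) (hint i j)
  have hi2 : ∀ i j, Integrable (fun ω => v ω * (e ω i * e ω j) *
      condGram m μ X T ω i j) μ := fun i j =>
    integrable_mul_of_bounded hm (hw i j) (hwb i j) integrable_condExp
  have hN : Integrable (fun ω => v ω * ‖e ω‖ ^ 2) μ :=
    integrable_of_measurable_bounded ((hv.mul (measurable_norm_sq_comp he)).mono hm le_rfl)
      fun ω => by rw [abs_of_nonneg (mul_nonneg (hv0 ω) (sq_nonneg _))]; exact hvc ω
  simp only [hexp]
  refine ⟨integrable_finsetSum _ fun i _ => integrable_finsetSum _ fun j _ => hi1 i j, ?_⟩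
  have e1 : ∫ ω, ∑ i, ∑ j, v ω * (e ω i * e ω j) * T.indicator (fun x => x i * x j) (X ω) ∂μ =
      ∫ ω, ∑ i, ∑ j, v ω * (e ω i * e ω j) * condGram m μ X T ω i j ∂μ := by
    rw [integral_finsetSum _ fun i _ => integrable_finsetSum _ fun j _ => hi1 i j,
      integral_finsetSum _ fun i _ => integrable_finsetSum _ fun j _ => hi2 i j]
    refine Finset.sum_congr rfl fun i _ => ?_
    rw [integral_finsetSum _ fun j _ => hi1 i j, integral_finsetSum _ fun j _ => hi2 i j]
    refine Finset.sum_congr rfl fun j _ => ?_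
    exact (integral_mul_condExp hm (hw i j) (hwb i j) (hint i j)).symm
  rw [e1, ← integral_const_mul]
  refine integral_mono_ae (hN.const_mul l)
    (integrable_finsetSum _ fun i _ => integrable_finsetSum _ fun j _ => hi2 i j) ?_
  filter_upwards [hgram] with ω hω
  have h1 := hω.dotProduct_mulVec_nonneg (WithLp.ofLp (e ω))
  have h2 : star (WithLp.ofLp (e ω)) ⬝ᵥ ((condGram m μ X T ω -
      l • (1 : Matrix (Fin d) (Fin d) ℝ)).mulVec (WithLp.ofLp (e ω))) =
      ∑ i, ∑ j, e ω i * e ω j * condGram m μ X T ω i j - l * ‖e ω‖ ^ 2 := by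
    rw [Matrix.sub_mulVec, dotProduct_sub, Matrix.smul_mulVec, Matrix.one_mulVec]
    congr 1
    · simp only [dotProduct, Matrix.mulVec, Finset.mul_sum]
      refine Finset.sum_congr rfl fun i _ => Finset.sum_congr rfl fun j _ => ?_
      simp
      ring
    · rw [EuclideanSpace.norm_sq_eq]
      simp only [dotProduct, Finset.mul_sum]
      refine Finset.sum_congr rfl fun i _ => ?_
      simp
      ring
  rw [h2] at h1
  have h3 : ∑ i, ∑ j, v ω * (e ω i * e ω j) * condGram m μ X T ω i j =
      v ω * ∑ i, ∑ j, e ω i * e ω j * condGram m μ X T ω i j := by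
    simp only [Finset.mul_sum, mul_assoc]
  have := mul_le_mul_of_nonneg_left h1 (hv0 ω)
  rw [h3]
  linarith

/-- A unit marginal has second moment at least l by the Gram bound, and at most L because t ≤ exp t
- 1 and the mean of exp(Z²/L) - 1 is at most 1. -/
theorem CondPsiTwoVecLe.le_of_condGram [NeZero d] (hm : m ≤ m0)
    {X : Ω → EuclideanSpace ℝ (Fin d)}
    (hXm : Measurable X) {L : ℝ} (hL : 0 < L) (hX : CondPsiTwoVecLe m μ X (Real.sqrt L)) {l : ℝ}
    (hgram : ∀ᵐ ω ∂μ,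
      (condGram m μ X Set.univ ω - l • (1 : Matrix (Fin d) (Fin d) ℝ)).PosSemidef) :
    l ≤ L := by
  set e0 : EuclideanSpace ℝ (Fin d) := EuclideanSpace.single 0 1 with he0
  have hn : ‖e0‖ = 1 := by simp [he0]
  obtain ⟨h1, h2⟩ := mul_integral_norm_sq_le_of_condGram hm hXm hL hX MeasurableSet.univ hgram
    (e := fun _ => e0) measurable_const (v := fun _ => 1) measurable_const (by simp) (c := 1)
    (by simp [hn])
  have hψ := hX (fun _ => e0) measurable_const (fun _ => hn)
  have h3 := hψ.integral_mul_exp_sub_le hm (v := fun _ => 1) measurable_const (by simp)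
    (c := 1) (by simp)
  simp only [one_mul, hn, Set.indicator_univ, integral_const, probReal_univ, smul_eq_mul, one_pow,
    mul_one] at h1 h2 h3
  have h4 : ∫ ω, inner ℝ (X ω) e0 ^ 2 ∂μ ≤
      ∫ ω, L * (Real.exp (|inner ℝ e0 (X ω) / Real.sqrt L| ^ 2) - 1) ∂μ := by
    refine integral_mono h1 ((hψ.1.sub (integrable_const 1)).const_mul L) fun ω => ?_
    have h5 := Real.add_one_le_exp (|inner ℝ e0 (X ω) / Real.sqrt L| ^ 2)
    have h6 : L * |inner ℝ e0 (X ω) / Real.sqrt L| ^ 2 = inner ℝ (X ω) e0 ^ 2 := by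
      rw [sq_abs, div_pow, Real.sq_sqrt hL.le, real_inner_comm]
      field_simp
    dsimp only
    nlinarith
  rw [integral_const_mul] at h4
  nlinarith

/-- Markov's inequality for exp(‖X‖²/(2L)): the threshold gives exp(-3(d + τ)), and the moment 2 ·
2^(d/2) is at most exp(2d) because d ≥ 1. -/
theorem CondPsiTwoVecLe.measure_norm_sq_gt_le [NeZero d] (hm : m ≤ m0)
    {X : Ω → EuclideanSpace ℝ (Fin d)}
    (hXm : Measurable X) {L : ℝ} (hL : 0 < L) (hX : CondPsiTwoVecLe m μ X (Real.sqrt L))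
    {τ : ℝ} (hτ : 0 ≤ τ) :
    μ.real {ω | 6 * L * (d + τ) < ‖X ω‖ ^ 2} ≤ Real.exp (-(d + τ)) := by
  have hd : (1 : ℝ) ≤ d := by exact_mod_cast NeZero.one_le
  have hlin := lintegral_exp_norm_sq_le (μ := μ) hXm hL fun u hu => by
    have h := hX (fun _ => u) measurable_const (fun _ => hu)
    have h1 := h.integral_mul_exp_sub_le hm (v := fun _ => 1) measurable_const (by simp)
      (c := 1) (by simp)
    have h2 : ∫ ω, Real.exp (|inner ℝ u (X ω) / Real.sqrt L| ^ 2) ∂μ ≤ 2 := by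
      simp only [one_mul, integral_const, probReal_univ, smul_eq_mul, mul_one] at h1
      rw [integral_sub h.1 (integrable_const 1)] at h1
      simp only [integral_const, probReal_univ, smul_eq_mul, mul_one] at h1
      linarith
    have e : ∀ ω, (inner ℝ u (X ω)) ^ 2 / L = |inner ℝ u (X ω) / Real.sqrt L| ^ 2 := fun ω => by
      rw [sq_abs, div_pow, Real.sq_sqrt hL.le]
    simp only [e]
    rw [← ofReal_integral_eq_lintegral_ofReal h.1
      (Filter.Eventually.of_forall fun _ => (Real.exp_pos _).le)]
    calc _ ≤ ENNReal.ofReal 2 := ENNReal.ofReal_le_ofReal h2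
      _ = 2 := by norm_num
  have hmk := meas_ge_le_lintegral_div (μ := μ)
    (f := fun ω => ENNReal.ofReal (Real.exp (‖X ω‖ ^ 2 / (2 * L))))
    (ENNReal.measurable_ofReal.comp (Real.measurable_exp.comp
      ((measurable_norm_sq_comp hXm).div_const _))).aemeasurable
    (ε := ENNReal.ofReal (Real.exp (3 * (d + τ)))) (by simp [Real.exp_pos]) ENNReal.ofReal_ne_top
  have hsub : {ω | 6 * L * (d + τ) < ‖X ω‖ ^ 2} ⊆
      {ω | ENNReal.ofReal (Real.exp (3 * (d + τ))) ≤
        ENNReal.ofReal (Real.exp (‖X ω‖ ^ 2 / (2 * L)))} := fun ω hω => by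
    refine ENNReal.ofReal_le_ofReal (Real.exp_le_exp.2 ?_)
    have hω' : 6 * L * (d + τ) < ‖X ω‖ ^ 2 := hω
    rw [le_div_iff₀ (by positivity)]
    linarith
  have hnum : (2 : ENNReal) * ENNReal.ofReal (2 ^ ((d : ℝ) / 2)) ≤
      ENNReal.ofReal (Real.exp (2 * d)) := by
    have e2 : (2 : ENNReal) = ENNReal.ofReal 2 := by norm_num
    have h2e : (2 : ℝ) ≤ Real.exp 1 := by linarith [Real.add_one_le_exp (1 : ℝ)]
    rw [e2, ← ENNReal.ofReal_mul (by norm_num)]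
    refine ENNReal.ofReal_le_ofReal ?_
    have h3 : (2 : ℝ) ^ ((d : ℝ) / 2) ≤ Real.exp d := by
      calc (2 : ℝ) ^ ((d : ℝ) / 2) ≤ Real.exp 1 ^ ((d : ℝ) / 2) := by gcongr
        _ = Real.exp (d / 2) := by rw [← Real.exp_mul, one_mul]
        _ ≤ Real.exp d := Real.exp_le_exp.2 (by linarith)
    calc 2 * (2 : ℝ) ^ ((d : ℝ) / 2) ≤ Real.exp d * Real.exp d := by
          refine mul_le_mul (h2e.trans (Real.exp_le_exp.2 hd)) h3 (by positivity)
            (Real.exp_pos _).le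
      _ = Real.exp (2 * d) := by rw [← Real.exp_add]; ring_nf
  have hfin : μ {ω | 6 * L * (d + τ) < ‖X ω‖ ^ 2} ≤ ENNReal.ofReal (Real.exp (-(d + τ))) := by
    calc _ ≤ _ := measure_mono hsub
      _ ≤ _ := hmk
      _ ≤ ENNReal.ofReal (Real.exp (2 * d)) / ENNReal.ofReal (Real.exp (3 * (d + τ))) :=
          ENNReal.div_le_div_right (hlin.trans hnum) _
      _ = ENNReal.ofReal (Real.exp (2 * d) / Real.exp (3 * (d + τ))) :=
          (ENNReal.ofReal_div_of_pos (Real.exp_pos _)).symm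
      _ ≤ _ := by
          rw [← Real.exp_sub]
          exact ENNReal.ofReal_le_ofReal (Real.exp_le_exp.2 (by linarith))
  rw [measureReal_def]
  exact ENNReal.toReal_le_of_le_ofReal (Real.exp_pos _).le hfin

end Covariates

/-! ### One step of the algorithm: arm and noise integrated out -/

namespace Bandit

variable {Ω : Type*} [m0 : MeasurableSpace Ω] {d K : ℕ} {B : Bandit Ω d K} {μ : Measure Ω}
  {p : ℕ → ℝ}

theorem IsEpsGreedy.measurable_err (h : B.IsEpsGreedy μ p) (t : ℕ) (i : Fin K) :
    Measurable (B.err t i) := (B.measurable_err_past t i).mono (h.past_le t) le_rfl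

variable [IsProbabilityMeasure μ]

/-- Exponential moment of the error after one step: arm and noise are integrated out. -/
theorem setIntegral_exp_err_succ_le (h : B.IsEpsGreedy μ p) {sig : ℝ} (hsig : 0 < sig)
    (hnoise : B.NoiseAssumption μ sig) {t : ℕ} (hp : 0 ≤ p t ∧ p t ≤ 1) (i : Fin K)
    {S : Set Ω} (hS : MeasurableSet[B.past t] S) {R r s ε : ℝ}
    (hSR : ∀ ω ∈ S, ‖B.err t i ω‖ ^ 2 ≤ R) (hR : 0 ≤ R) (hr : 0 ≤ r) (hs : 0 ≤ s)
    (hη : 0 ≤ B.step t) (hε : ε ≤ 1 / 1000) (h1 : s * B.step t * sig ^ 2 ≤ ε)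
    (h2 : s * B.step t ^ 2 * r * sig ^ 2 ≤ ε) :
    IntegrableOn (fun ω => Real.exp (s * ‖B.err (t + 1) i ω‖ ^ 2))
      (S ∩ {ω | ‖B.X t ω‖ ^ 2 ≤ r}) μ ∧
    ∫ ω in S ∩ {ω | ‖B.X t ω‖ ^ 2 ≤ r}, Real.exp (s * ‖B.err (t + 1) i ω‖ ^ 2) ∂μ ≤
    ∫ ω in S ∩ {ω | ‖B.X t ω‖ ^ 2 ≤ r}, Real.exp (s * ‖B.err t i ω‖ ^ 2) *
      (1 - pullProb B p t i ω + pullProb B p t i ω *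
        Real.exp (-(1.9 * (s * B.step t) * inner ℝ (B.X t ω) (B.err t i ω) ^ 2) +
        (1.1 * (s * B.step t ^ 2 * ‖B.X t ω‖ ^ 2) * inner ℝ (B.X t ω) (B.err t i ω) ^ 2
          + 2 * (s * B.step t ^ 2 * ‖B.X t ω‖ ^ 2) * sig ^ 2))) ∂μ := by
  classical
  set η := B.step t with hηd
  have hm : B.pastPlus t ≤ m0 := h.pastPlus_le t
  have hpm : B.past t ≤ B.pastPlus t := le_sup_left
  have hXm : Measurable[B.pastPlus t] (B.X t) := B.measurable_X_pastPlus t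
  have hem : Measurable[B.pastPlus t] (B.err t i) := (B.measurable_err_past t i).mono hpm le_rfl
  have hqm : Measurable[B.pastPlus t] (pullProb B p t i) := h.measurable_pullProb t i
  set G : Set Ω := {ω | ‖B.X t ω‖ ^ 2 ≤ r} with hG
  have hGm : MeasurableSet[B.pastPlus t] G := measurableSet_le (measurable_norm_sq_comp hXm) measurable_const
  have hSm : MeasurableSet[B.pastPlus t] S := hpm _ hS
  have hW : MeasurableSet[B.pastPlus t] (S ∩ G) := hSm.inter hGm
  -- The noise step asks for bounds at every sample point. Cutting covariate and error off outside
  -- the good event supplies them and changes nothing where the weight w is nonzero.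
  set x : Ω → EuclideanSpace ℝ (Fin d) := G.indicator (B.X t) with hx
  set e : Ω → EuclideanSpace ℝ (Fin d) := S.indicator (B.err t i) with he
  have hxm : Measurable[B.pastPlus t] x := hXm.indicator hGm
  have hem' : Measurable[B.pastPlus t] e := hem.indicator hSm
  have hxr : ∀ ω, ‖x ω‖ ^ 2 ≤ r := fun ω => by
    by_cases hω : ω ∈ G
    · rw [hx, Set.indicator_of_mem hω]; exact hω
    · rw [hx, Set.indicator_of_notMem hω]; simpa using hr
  have heR : ∀ ω, ‖e ω‖ ^ 2 ≤ R := fun ω => by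
    by_cases hω : ω ∈ S
    · rw [he, Set.indicator_of_mem hω]; exact hSR ω hω
    · rw [he, Set.indicator_of_notMem hω]; simpa using hR
  set w : Ω → ℝ := (S ∩ G).indicator (fun _ => 1) with hw
  have hwm : Measurable[B.pastPlus t] w := measurable_const.indicator hW
  have hw0 : ∀ ω, 0 ≤ w ω := fun ω => Set.indicator_nonneg (fun _ _ => zero_le_one) ω
  have hw1 : ∀ ω, w ω ≤ 1 := fun ω => Set.indicator_le_self' (fun _ _ => zero_le_one) ω
  have hq0 := fun ω => pullProb_nonneg (B := B) hp i ω
  have hq1 := fun ω => pullProb_le_one (B := B) hp i ω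
  have hψ := hnoise.subGaussian t
  obtain ⟨iF, -⟩ := hψ.integral_exp_sgd_update_le hsig hm (h.measurable_noise t)
    (hnoise.mean_zero t) hxm hem' hwm hw0 hw1 hxr heR hs hη hε h1 h2
  obtain ⟨iqF, hqF⟩ := hψ.integral_exp_sgd_update_le hsig hm (h.measurable_noise t)
    (hnoise.mean_zero t) hxm hem' (f := fun ω => w ω * pullProb B p t i ω) (hwm.mul hqm)
    (fun ω => mul_nonneg (hw0 ω) (hq0 ω)) (cf := 1)
    (fun ω => mul_le_one₀ (hw1 ω) (hq0 ω) (hq1 ω)) hxr heR hs hη hε h1 h2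
  set F : Ω → ℝ := fun ω => w ω * Real.exp
    (s * ‖e ω - (η * (inner ℝ (x ω) (e ω) - B.noise t ω)) • x ω‖ ^ 2) with hF
  set F0 : Ω → ℝ := fun ω => w ω * Real.exp (s * ‖e ω‖ ^ 2) with hF0
  have hF0m : Measurable[B.pastPlus t] F0 :=
    hwm.mul (Real.measurable_exp.comp ((measurable_norm_sq_comp hem').const_mul s))
  have iF0 : Integrable F0 μ := integrable_of_measurable_bounded (c := Real.exp (s * R))
    (hF0m.mono hm le_rfl) fun ω => by
      rw [abs_of_nonneg (mul_nonneg (hw0 ω) (Real.exp_pos _).le)]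
      calc w ω * Real.exp (s * ‖e ω‖ ^ 2) ≤ 1 * Real.exp (s * R) :=
            mul_le_mul (hw1 ω) (Real.exp_le_exp.2 (mul_le_mul_of_nonneg_left (heR ω) hs))
              (Real.exp_pos _).le zero_le_one
        _ = _ := one_mul _
  have hmm' : B.pastPlus t ≤
      B.pastPlus t ⊔ MeasurableSpace.comap (B.noise t) inferInstance := le_sup_left
  have hnm' : Measurable[B.pastPlus t ⊔ MeasurableSpace.comap (B.noise t) inferInstance] (B.noise t) := (comap_measurable _).mono le_sup_right le_rfl
  have hFm' : Measurable[B.pastPlus t ⊔ MeasurableSpace.comap (B.noise t) inferInstance] F := by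
    have a1 := hxm.mono hmm' le_rfl
    have a2 := hem'.mono hmm' le_rfl
    exact (hwm.mono hmm' le_rfl).mul (Real.measurable_exp.comp ((measurable_norm_sq_comp
      (a2.sub ((((a1.inner a2).sub hnm').const_mul η).smul a1))).const_mul s))
  have hpull := h.integral_pull t i (hFm'.sub (hF0m.mono hmm' le_rfl)) (iF.sub iF0)
  -- An arm that is not pulled keeps its error. Averaging the correction F - F0 over the choice of
  -- arm produces the mixture with weights 1 - q and q.
  have hsplit : ∀ ω, (S ∩ G).indicator (fun ω => Real.exp (s * ‖B.err (t + 1) i ω‖ ^ 2)) ω =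
      F0 ω + if B.arm t ω = i then (F - F0) ω else 0 := fun ω => by
    by_cases hω : ω ∈ S ∩ G
    · have ex : x ω = B.X t ω := Set.indicator_of_mem hω.2 _
      have ee : e ω = B.err t i ω := Set.indicator_of_mem hω.1 _
      have ew : w ω = 1 := Set.indicator_of_mem hω _
      rw [Set.indicator_of_mem hω, err_succ]
      simp only [hF, hF0, Pi.sub_apply, ex, ee, ew, one_mul]
      split_ifs <;> simp [hηd]
    · have ew : w ω = 0 := Set.indicator_of_notMem hω _
      rw [Set.indicator_of_notMem hω]
      simp [hF, hF0, ew]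
  have harm : MeasurableSet {ω | B.arm t ω = i} := by
    have hg : Measurable (B.greedyArm t) := (h.measurable_greedyArm t).mono hm le_rfl
    exact (Measurable.ite (h.measurable_coin t (measurableSet_singleton true))
        (h.measurable_randArm t) hg) (measurableSet_singleton i)
  have iarm : Integrable (fun ω => if B.arm t ω = i then (F - F0) ω else 0) μ := by
    have := (iF.sub iF0).indicator harm
    refine this.congr (Filter.Eventually.of_forall fun ω => ?_)
    simp only [Set.indicator, Set.mem_ofPred_eq]
    congr
  have hWm0 : MeasurableSet (S ∩ G) := hm _ hW
  constructor
  · rw [← integrable_indicator_iff hWm0]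
    exact (iF0.add iarm).congr (Filter.Eventually.of_forall fun ω => (hsplit ω).symm)
  · rw [← integral_indicator hWm0, ← integral_indicator hWm0]
    simp only [hsplit]
    rw [integral_add iF0 iarm, hpull]
    have iqF' : Integrable (fun ω => pullProb B p t i ω * F ω) μ :=
      iqF.congr (Filter.Eventually.of_forall fun ω => by simp only [hF]; ring)
    have iqF0 : Integrable (fun ω => pullProb B p t i ω * F0 ω) μ :=
      integrable_mul_of_bounded hm hqm (c := 1)
        (fun ω => by rw [abs_of_nonneg (hq0 ω)]; exact hq1 ω) iF0
    have e1 : ∫ ω, pullProb B p t i ω * (F - F0) ω ∂μ =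
        ∫ ω, pullProb B p t i ω * F ω ∂μ - ∫ ω, pullProb B p t i ω * F0 ω ∂μ := by
      rw [← integral_sub iqF' iqF0]
      refine integral_congr_ae (Filter.Eventually.of_forall fun ω => ?_)
      simp only [Pi.sub_apply]; ring
    have e2 : ∫ ω, pullProb B p t i ω * F ω ∂μ = ∫ ω, w ω * pullProb B p t i ω * Real.exp
        (s * ‖e ω - (η * (inner ℝ (x ω) (e ω) - B.noise t ω)) • x ω‖ ^ 2) ∂μ := by
      refine integral_congr_ae (Filter.Eventually.of_forall fun ω => ?_)
      simp only [hF]; ring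
    rw [e1, e2]
    have iT : Integrable (fun ω => w ω * pullProb B p t i ω * (Real.exp (s * ‖e ω‖ ^ 2) *
        Real.exp (-(1.9 * (s * η) * inner ℝ (x ω) (e ω) ^ 2) +
          (1.1 * (s * η ^ 2 * ‖x ω‖ ^ 2) * inner ℝ (x ω) (e ω) ^ 2
            + 2 * (s * η ^ 2 * ‖x ω‖ ^ 2) * sig ^ 2)))) μ := by
      refine integrable_of_measurable_bounded (c := Real.exp (s * R) *
        Real.exp (1.1 * (s * η ^ 2 * r) * (r * R) + 2 * ε)) ?_ fun ω => ?_
      · refine Measurable.mono ((hwm.mul hqm).mul ((Real.measurable_exp.comp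
          ((measurable_norm_sq_comp hem').const_mul s)).mul (Real.measurable_exp.comp ?_)))
          hm le_rfl
        have hy := (hxm.inner (𝕜 := ℝ) hem').pow_const 2
        have hγ : Measurable[B.pastPlus t] fun ω => s * η ^ 2 * ‖x ω‖ ^ 2 :=
          (measurable_norm_sq_comp hxm).const_mul _
        exact (hy.const_mul _).neg.add (((hγ.const_mul _).mul hy).add
          ((hγ.const_mul _).mul_const _))
      · have b1 : w ω * pullProb B p t i ω ≤ 1 := mul_le_one₀ (hw1 ω) (hq0 ω) (hq1 ω)
        have b0 : 0 ≤ w ω * pullProb B p t i ω := mul_nonneg (hw0 ω) (hq0 ω)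
        rw [abs_of_nonneg (by positivity)]
        have hγr : s * η ^ 2 * ‖x ω‖ ^ 2 ≤ s * η ^ 2 * r := by
          have := hxr ω
          gcongr
        have hy2 : (inner ℝ (x ω) (e ω)) ^ 2 ≤ r * R := by
          have h3 := abs_real_inner_le_norm (x ω) (e ω)
          calc (inner ℝ (x ω) (e ω)) ^ 2 = |inner ℝ (x ω) (e ω)| ^ 2 := (sq_abs _).symm
            _ ≤ (‖x ω‖ * ‖e ω‖) ^ 2 := by gcongr
            _ = ‖x ω‖ ^ 2 * ‖e ω‖ ^ 2 := by ring
            _ ≤ r * R := mul_le_mul (hxr ω) (heR ω) (sq_nonneg _) hr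
        have a1 := mul_le_mul_of_nonneg_left (heR ω) hs
        have a2 : s * η ^ 2 * ‖x ω‖ ^ 2 * (inner ℝ (x ω) (e ω)) ^ 2 ≤ s * η ^ 2 * r * (r * R) :=
          mul_le_mul hγr hy2 (sq_nonneg _) (by positivity)
        have a3 : 0 ≤ s * η * (inner ℝ (x ω) (e ω)) ^ 2 := by positivity
        have a4 : s * η ^ 2 * ‖x ω‖ ^ 2 * sig ^ 2 ≤ ε :=
          (mul_le_mul_of_nonneg_right hγr (sq_nonneg sig)).trans h2
        refine (mul_le_of_le_one_left (by positivity) b1).trans ?_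
        refine mul_le_mul (Real.exp_le_exp.2 a1) (Real.exp_le_exp.2 ?_)
          (Real.exp_pos _).le (Real.exp_pos _).le
        nlinarith
    have e3 : ∫ ω, (S ∩ G).indicator (fun ω => Real.exp (s * ‖B.err t i ω‖ ^ 2) *
      (1 - pullProb B p t i ω + pullProb B p t i ω *
        Real.exp (-(1.9 * (s * η) * inner ℝ (B.X t ω) (B.err t i ω) ^ 2) +
        (1.1 * (s * η ^ 2 * ‖B.X t ω‖ ^ 2) * inner ℝ (B.X t ω) (B.err t i ω) ^ 2
          + 2 * (s * η ^ 2 * ‖B.X t ω‖ ^ 2) * sig ^ 2)))) ω ∂μ =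
        ∫ ω, F0 ω ∂μ - ∫ ω, pullProb B p t i ω * F0 ω ∂μ +
        ∫ ω, w ω * pullProb B p t i ω * (Real.exp (s * ‖e ω‖ ^ 2) *
        Real.exp (-(1.9 * (s * η) * inner ℝ (x ω) (e ω) ^ 2) +
          (1.1 * (s * η ^ 2 * ‖x ω‖ ^ 2) * inner ℝ (x ω) (e ω) ^ 2
            + 2 * (s * η ^ 2 * ‖x ω‖ ^ 2) * sig ^ 2))) ∂μ := by
      have a1 := integral_add (iF0.sub iqF0) iT
      simp only [Pi.sub_apply] at a1
      rw [← integral_sub iF0 iqF0, ← a1]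
      refine integral_congr_ae (Filter.Eventually.of_forall fun ω => ?_)
      by_cases hω : ω ∈ S ∩ G
      · have ex : x ω = B.X t ω := Set.indicator_of_mem hω.2 _
        have ee : e ω = B.err t i ω := Set.indicator_of_mem hω.1 _
        have ew : w ω = 1 := Set.indicator_of_mem hω _
        simp only [Set.indicator_of_mem hω, hF0, ex, ee, ew]
        ring
      · have ew : w ω = 0 := Set.indicator_of_notMem hω _
        simp only [Set.indicator_of_notMem hω, hF0, ew]
        ring
    rw [e3]
    linarith

end Bandit

/-! ### Tuned parameters and the one-step moment inequalities -/

theorem integrableOn_of_bounded {Ω : Type*} [MeasurableSpace Ω] {μ : Measure Ω}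
    [IsFiniteMeasure μ] {S : Set Ω} (hS : MeasurableSet S) {f : Ω → ℝ}
    (hf : Measurable f) {M : ℝ} (hM : ∀ ω ∈ S, |f ω| ≤ M) : IntegrableOn f S μ := by
  refine Integrable.mono' (integrable_const M).integrableOn hf.aestronglyMeasurable ?_
  exact (ae_restrict_iff' hS).2 (Filter.Eventually.of_forall fun ω hω => by simpa using hM ω hω)

namespace Bandit

variable {Ω : Type*} [m0 : MeasurableSpace Ω] {d K : ℕ}

/-- An `ε`-greedy SGD run satisfying the covariate and noise assumptions, with the stepsizes
`C_a / (lmin (t + C_b d))`, together with an exponential rate `c` and a radius `b` that are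
compatible with each other. -/
structure TunedRun (B : Bandit Ω d K) (μ : Measure Ω) (p : ℕ → ℝ)
    (lmin lmax sig Ca Cb c b : ℝ) : Prop where
  greedy : B.IsEpsGreedy μ p
  cov : B.CovariateAssumption μ lmin lmax
  noise : B.NoiseAssumption μ sig
  dim_pos : 1 ≤ d
  lmin_pos : 0 < lmin
  lmax_pos : 0 < lmax
  sig_pos : 0 < sig
  prob_mem : ∀ t, 0 ≤ p t ∧ p t ≤ 1
  four_le_Ca : 4 ≤ Ca
  Cb_ge : 3 * Ca ^ 2 * (lmax ^ 2 / lmin ^ 2) ≤ Cb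
  step_eq : ∀ t : ℕ, B.step t = 1 / lmin * (Ca / (t + Cb * d))
  c_pos : 0 < c
  c_le : 6 * c ≤ 1 / 1000
  b_nonneg : 0 ≤ b
  c_mul_b_le : 6 * c * b ≤ 1 / 40

/-- The shifted time `t + C_b d`. -/
def clock (Cb : ℝ) (d t : ℕ) : ℝ := t + Cb * d

/-- The rate in the exponential moment of `(t + C_b d) ‖β^{(t)} - β^*‖²`. -/
def expRate (lmin lmax sig Ca c : ℝ) : ℝ := c * lmin ^ 2 / (Ca ^ 2 * lmax * sig ^ 2)

/-- The level at which the squared norm of the covariate at time `t` is truncated. -/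
def truncLevel (lmax Ca : ℝ) (d t : ℕ) : ℝ := 6 * lmax * (d + t / Ca)

variable {B : Bandit Ω d K} {μ : Measure Ω} [IsProbabilityMeasure μ] {p : ℕ → ℝ}
  {lmin lmax sig Ca Cb c b : ℝ}

theorem Cb_mul_dim_le_clock (Cb : ℝ) (d t : ℕ) : Cb * d ≤ clock Cb d t := by
  unfold clock; linarith [(Nat.cast_nonneg t : (0 : ℝ) ≤ t)]

theorem clock_succ (Cb : ℝ) (d t : ℕ) : clock Cb d (t + 1) = clock Cb d t + 1 := by
  unfold clock; push_cast; ring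

namespace TunedRun

variable (hR : B.TunedRun μ p lmin lmax sig Ca Cb c b)

include hR

omit [IsProbabilityMeasure μ] in
theorem neZero_dim : NeZero d := ⟨Nat.one_le_iff_ne_zero.1 hR.dim_pos⟩

theorem lmin_le_lmax : lmin ≤ lmax :=
  haveI := hR.neZero_dim
  (hR.cov.subGaussian 0).le_of_condGram (hR.greedy.past_le 0) (hR.greedy.measurable_X 0)
    hR.lmax_pos (hR.cov.second_moment 0)

omit [IsProbabilityMeasure μ] in
theorem one_le_dim : (1 : ℝ) ≤ d := by exact_mod_cast hR.dim_pos

omit [IsProbabilityMeasure μ] in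
theorem Ca_pos : 0 < Ca := by linarith [hR.four_le_Ca]

theorem three_mul_sq_le_Cb : 3 * Ca ^ 2 ≤ Cb := by
  refine le_trans ?_ hR.Cb_ge
  have h1 : 1 ≤ lmax ^ 2 / lmin ^ 2 := by
    rw [one_le_div (pow_pos hR.lmin_pos 2)]
    exact pow_le_pow_left₀ hR.lmin_pos.le hR.lmin_le_lmax 2
  exact le_mul_of_one_le_right (by positivity) h1

theorem Cb_pos : 0 < Cb := by
  have := hR.three_mul_sq_le_Cb
  have := hR.four_le_Ca
  nlinarith

/-- 48 = 3 · 4², from C_b ≥ 3 C_a² and C_a ≥ 4. It makes the factor (n + 1)/n harmless in the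
numerical estimates. -/
theorem clock_ge (t : ℕ) : 48 ≤ clock Cb d t := by
  refine le_trans ?_ (Cb_mul_dim_le_clock Cb d t)
  have h1 := hR.three_mul_sq_le_Cb
  have h2 := hR.four_le_Ca
  have h3 := hR.one_le_dim
  nlinarith

theorem clock_pos (t : ℕ) : 0 < clock Cb d t := by linarith [hR.clock_ge t]

theorem dim_add_le (t : ℕ) : d + t / Ca ≤ clock Cb d t / Ca := by
  rw [le_div_iff₀ hR.Ca_pos, add_mul, div_mul_cancel₀ _ hR.Ca_pos.ne']
  unfold clock
  have h1 := hR.three_mul_sq_le_Cb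
  have h2 := hR.four_le_Ca
  have h3 := hR.one_le_dim
  have h4 : Ca ≤ Cb := by nlinarith
  have h5 := mul_le_mul_of_nonneg_right h4 (zero_le_one.trans h3)
  linarith

omit [IsProbabilityMeasure μ] in
theorem expRate_pos : 0 < expRate lmin lmax sig Ca c := by
  have := hR.c_pos
  have := hR.lmin_pos
  have := hR.lmax_pos
  have := hR.sig_pos
  have := hR.Ca_pos
  unfold expRate; positivity

theorem step_pos (t : ℕ) : 0 < B.step t := by
  have h := hR.clock_pos t
  have := hR.lmin_pos
  have := hR.Ca_pos
  rw [hR.step_eq]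
  unfold clock at h
  positivity

omit [IsProbabilityMeasure μ] in
theorem step_eq_clock (t : ℕ) : B.step t = Ca / (lmin * clock Cb d t) := by
  rw [hR.step_eq, clock, div_mul_div_comm, one_mul]

theorem expRate_mul_step (t : ℕ) : expRate lmin lmax sig Ca c * B.step t * sig ^ 2 =
    c * (lmin / lmax) / (Ca * clock Cb d t) := by
  have h0 := (hR.clock_pos t).ne'
  have := hR.lmin_pos.ne'
  have := hR.lmax_pos.ne'
  have := hR.sig_pos.ne'
  have := hR.Ca_pos.ne'
  rw [hR.step_eq_clock, expRate]
  field_simp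

/-- The rate is chosen so that the noise injected by one step, with weight of order n, costs order c
d/n in the exponent, with no other parameter involved. -/
theorem expRate_mul_step_sq (t : ℕ) : expRate lmin lmax sig Ca c * B.step t ^ 2 =
    c / (lmax * sig ^ 2 * clock Cb d t ^ 2) := by
  have h0 := (hR.clock_pos t).ne'
  have := hR.lmin_pos.ne'
  have := hR.lmax_pos.ne'
  have := hR.sig_pos.ne'
  have := hR.Ca_pos.ne'
  rw [hR.step_eq_clock, expRate]
  field_simp

/-- This is what the lower bound on C_b is for: the random second-order term of the update is at
most a third of 1/n, small against the drift 4/n. -/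
theorem step_sq_mul_le (t : ℕ) : B.step t ^ 2 * lmax ^ 2 * d ≤ 1 / (3 * clock Cb d t) := by
  have h0 := hR.clock_pos t
  have h1 := Cb_mul_dim_le_clock Cb d t
  have h2 := hR.Cb_ge
  have h3 := hR.one_le_dim
  have hl := hR.lmin_pos
  have e : B.step t ^ 2 * lmax ^ 2 * d =
      Ca ^ 2 * (lmax ^ 2 / lmin ^ 2) * d / clock Cb d t ^ 2 := by
    rw [hR.step_eq_clock]; field_simp
  rw [e, div_le_div_iff₀ (by positivity) (by positivity)]
  have h4 : 3 * Ca ^ 2 * (lmax ^ 2 / lmin ^ 2) * d ≤ Cb * d := by gcongr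
  nlinarith

/-- The two smallness conditions of the one-step bound. -/
theorem smallness (t : ℕ) {ν : ℝ} (hν0 : 0 ≤ ν) (hν : ν ≤ clock Cb d t + 1) :
    expRate lmin lmax sig Ca c * ν * B.step t * sig ^ 2 ≤ 6 * c ∧
    expRate lmin lmax sig Ca c * ν * B.step t ^ 2 * truncLevel lmax Ca d t * sig ^ 2 ≤ 6 * c := by
  have hn := hR.clock_ge t
  have hn0 := hR.clock_pos t
  have hc := hR.c_pos
  have hCa := hR.Ca_pos
  have hs := hR.sig_pos
  have hL := hR.lmax_pos
  have hνn : ν / clock Cb d t ≤ 2 := by rw [div_le_iff₀ hn0]; linarith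
  have hνn0 : 0 ≤ ν / clock Cb d t := by positivity
  constructor
  · have h1 : lmin / lmax ≤ 1 := (div_le_one hL).2 hR.lmin_le_lmax
    have h10 : 0 ≤ lmin / lmax := div_nonneg hR.lmin_pos.le hL.le
    have h2 : 1 / Ca ≤ 1 := (div_le_one hCa).2 (by linarith [hR.four_le_Ca])
    calc expRate lmin lmax sig Ca c * ν * B.step t * sig ^ 2 =
        (expRate lmin lmax sig Ca c * B.step t * sig ^ 2) * ν := by ring
      _ = c * ((lmin / lmax) * (1 / Ca) * (ν / clock Cb d t)) := by
          rw [hR.expRate_mul_step]; field_simp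
      _ ≤ c * (1 * 1 * 2) := by gcongr
      _ ≤ 6 * c := by linarith
  · have h1 : (d + t / Ca) / clock Cb d t ≤ 1 / 4 := by
      rw [div_le_iff₀ hn0]
      refine (hR.dim_add_le t).trans ?_
      rw [div_le_iff₀ hCa]
      nlinarith [hR.four_le_Ca]
    calc _ = (expRate lmin lmax sig Ca c * B.step t ^ 2) * ν * truncLevel lmax Ca d t * sig ^ 2 := by
          ring
      _ = 6 * c * ((ν / clock Cb d t) * ((d + t / Ca) / clock Cb d t)) := by
          rw [hR.expRate_mul_step_sq, truncLevel]; field_simp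
      _ ≤ 6 * c * (2 * (1 / 4)) := by gcongr
      _ ≤ 6 * c := by linarith

omit [IsProbabilityMeasure μ] in
theorem truncLevel_nonneg (t : ℕ) : 0 ≤ truncLevel lmax Ca d t := by
  have := hR.lmax_pos
  have := hR.Ca_pos
  unfold truncLevel; positivity

theorem integrableOn_exp_succ {t : ℕ} (i : Fin K) {S : Set Ω} (hS : MeasurableSet[B.past t] S)
    {R ν : ℝ} (hSR : ∀ ω ∈ S, ‖B.err t i ω‖ ^ 2 ≤ R)
    (hν0 : 0 ≤ ν) (hν : ν ≤ clock Cb d t + 1) :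
    IntegrableOn (fun ω => Real.exp (expRate lmin lmax sig Ca c * ν * ‖B.err (t + 1) i ω‖ ^ 2))
      (S ∩ {ω | ‖B.X t ω‖ ^ 2 ≤ truncLevel lmax Ca d t}) μ := by
  obtain ⟨h1, h2⟩ := hR.smallness t hν0 hν
  rcases S.eq_empty_or_nonempty with rfl | ⟨ω₀, hω₀⟩
  · simp
  exact (setIntegral_exp_err_succ_le hR.greedy hR.sig_pos hR.noise (hR.prob_mem t) i hS hSR
    ((sq_nonneg _).trans (hSR ω₀ hω₀)) (hR.truncLevel_nonneg t)
    (mul_nonneg hR.expRate_pos.le hν0) (hR.step_pos t).le hR.c_le h1 h2).1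

/-- Combination of the noise step and the covariate step, with (`κ = 1`) or without (`κ = 0`)
the contraction. -/
theorem setIntegral_exp_le {t : ℕ} (i : Fin K) {S : Set Ω} (hS : MeasurableSet[B.past t] S)
    {ν κ : ℝ} (hSR : ∀ ω ∈ S, lmax * ‖B.err t i ω‖ ^ 2 ≤ b * sig ^ 2) (hκ : κ = 0 ∨ κ = 1)
    (hν0 : 0 ≤ ν) (hν : ν ≤ clock Cb d t + 1) :
    ∫ ω in S ∩ {ω | ‖B.X t ω‖ ^ 2 ≤ truncLevel lmax Ca d t},
      Real.exp (expRate lmin lmax sig Ca c * ν * ‖B.err (t + 1) i ω‖ ^ 2) ∂μ ≤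
    ∫ ω in S, Real.exp (expRate lmin lmax sig Ca c * ν * ‖B.err t i ω‖ ^ 2) *
      (1 + κ * (4 * (expRate lmin lmax sig Ca c * ν * B.step t) ^ 2 * lmax ^ 2 *
          (‖B.err t i ω‖ ^ 2) ^ 2)
        + (1.2 * (expRate lmin lmax sig Ca c * ν) * B.step t ^ 2 * lmax ^ 2 * d) *
          ‖B.err t i ω‖ ^ 2
        + 3.15 * (expRate lmin lmax sig Ca c * ν) * B.step t ^ 2 * sig ^ 2 * lmax * d) ∂μ
      - κ * (1.9 * (expRate lmin lmax sig Ca c * ν * B.step t) *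
        ∫ ω in S, Real.exp (expRate lmin lmax sig Ca c * ν * ‖B.err t i ω‖ ^ 2) *
          (pullProb B p t i ω * inner ℝ (B.X t ω) (B.err t i ω) ^ 2) ∂μ) := by
  have := hR.neZero_dim
  obtain ⟨h1, h2⟩ := hR.smallness t hν0 hν
  have hL := hR.lmax_pos
  have hR0 : 0 ≤ b * sig ^ 2 / lmax :=
    div_nonneg (mul_nonneg hR.b_nonneg (sq_nonneg _)) hL.le
  have hSR' : ∀ ω ∈ S, ‖B.err t i ω‖ ^ 2 ≤ b * sig ^ 2 / lmax := fun ω hω => by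
    rw [le_div_iff₀ hL, mul_comm]; exact hSR ω hω
  have hs0 := mul_nonneg hR.expRate_pos.le hν0
  refine (setIntegral_exp_err_succ_le hR.greedy hR.sig_pos hR.noise (hR.prob_mem t) i hS hSR'
    hR0 (hR.truncLevel_nonneg t) hs0 (hR.step_pos t).le hR.c_le h1 h2).2.trans ?_
  exact (hR.cov.subGaussian t).integral_truncated_mix_exp_le (hR.greedy.past_le t)
    (hR.greedy.measurable_X t) hL (B.measurable_err_past t i) hS hSR' hκ hR0
    ((hR.greedy.measurable_pullProb t i).mono (hR.greedy.pastPlus_le t) le_rfl)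
    (fun ω => pullProb_nonneg (hR.prob_mem t) i ω) (fun ω => pullProb_le_one (hR.prob_mem t) i ω)
    hs0 (hR.step_pos t).le (le_of_eq (by field_simp)) hR.c_le hR.c_mul_b_le hR.b_nonneg h2

/-- One step without contraction. -/
theorem setIntegral_exp_le_of_bounded {t : ℕ} (i : Fin K) {S : Set Ω}
    (hS : MeasurableSet[B.past t] S) {ν b' : ℝ} (hb' : b' ≤ b)
    (hSR : ∀ ω ∈ S, lmax * ‖B.err t i ω‖ ^ 2 ≤ b' * sig ^ 2)
    (hν0 : 0 ≤ ν) (hν : ν ≤ clock Cb d t + 1) :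
    ∫ ω in S ∩ {ω | ‖B.X t ω‖ ^ 2 ≤ truncLevel lmax Ca d t},
      Real.exp (expRate lmin lmax sig Ca c * ν * ‖B.err (t + 1) i ω‖ ^ 2) ∂μ ≤
    Real.exp (c * d * (ν / clock Cb d t ^ 2) * (1.2 * b' + 3.15)) *
      ∫ ω in S, Real.exp (expRate lmin lmax sig Ca c * ν * ‖B.err t i ω‖ ^ 2) ∂μ := by
  have hL := hR.lmax_pos
  have hsg := hR.sig_pos
  have hn0 := hR.clock_pos t
  have hc := hR.c_pos
  have hSR2 : ∀ ω ∈ S, lmax * ‖B.err t i ω‖ ^ 2 ≤ b * sig ^ 2 := fun ω hω =>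
    (hSR ω hω).trans (by gcongr)
  refine (hR.setIntegral_exp_le i hS hSR2 (Or.inl rfl) hν0 hν).trans ?_
  simp only [zero_mul, add_zero, sub_zero]
  rw [← integral_const_mul]
  have hSm : MeasurableSet S := hR.greedy.past_le t _ hS
  have hem := hR.greedy.measurable_err t i
  have hs0 := mul_nonneg hR.expRate_pos.le hν0
  set s := expRate lmin lmax sig Ca c * ν with hs
  have hDR : ∀ ω ∈ S, ‖B.err t i ω‖ ^ 2 ≤ b * sig ^ 2 / lmax := fun ω hω => by
    rw [le_div_iff₀ hL, mul_comm]; exact hSR2 ω hω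
  have hDm : Measurable fun ω => ‖B.err t i ω‖ ^ 2 := measurable_norm_sq_comp hem
  have hes : s * B.step t ^ 2 = c * ν / (lmax * sig ^ 2 * clock Cb d t ^ 2) := by
    rw [hs, mul_right_comm, hR.expRate_mul_step_sq]; ring
  have hmul : 0 ≤ c * ν / (lmax * sig ^ 2 * clock Cb d t ^ 2) := by positivity
  have hpt : ∀ ω ∈ S, Real.exp (s * ‖B.err t i ω‖ ^ 2) *
      (1 + (1.2 * s * B.step t ^ 2 * lmax ^ 2 * d) * ‖B.err t i ω‖ ^ 2
        + 3.15 * s * B.step t ^ 2 * sig ^ 2 * lmax * d) ≤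
      Real.exp (c * d * (ν / clock Cb d t ^ 2) * (1.2 * b' + 3.15)) *
        Real.exp (s * ‖B.err t i ω‖ ^ 2) := fun ω hω => by
    rw [mul_comm]
    refine mul_le_mul_of_nonneg_right (le_trans ?_ (Real.add_one_le_exp _)) (Real.exp_pos _).le
    have e1 : (1.2 * s * B.step t ^ 2 * lmax ^ 2 * d) * ‖B.err t i ω‖ ^ 2 =
        (c * ν / (lmax * sig ^ 2 * clock Cb d t ^ 2)) * (1.2 * lmax * d) *
          (lmax * ‖B.err t i ω‖ ^ 2) := by rw [← hes]; ring
    have e2 : 3.15 * s * B.step t ^ 2 * sig ^ 2 * lmax * d =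
        (c * ν / (lmax * sig ^ 2 * clock Cb d t ^ 2)) * (3.15 * sig ^ 2 * lmax * d) := by
      rw [← hes]; ring
    have e3 : c * d * (ν / clock Cb d t ^ 2) * (1.2 * b' + 3.15) =
        (c * ν / (lmax * sig ^ 2 * clock Cb d t ^ 2)) * (1.2 * lmax * d) * (b' * sig ^ 2) +
        (c * ν / (lmax * sig ^ 2 * clock Cb d t ^ 2)) * (3.15 * sig ^ 2 * lmax * d) := by
      field_simp
    rw [e1, e2, e3]
    have := mul_le_mul_of_nonneg_left (hSR ω hω)
      (show 0 ≤ (c * ν / (lmax * sig ^ 2 * clock Cb d t ^ 2)) * (1.2 * lmax * d) by positivity)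
    linarith
  have hexpb : ∀ ω ∈ S, Real.exp (s * ‖B.err t i ω‖ ^ 2) ≤
      Real.exp (s * (b * sig ^ 2 / lmax)) := fun ω hω =>
    Real.exp_le_exp.2 (mul_le_mul_of_nonneg_left (hDR ω hω) hs0)
  have hexpm : Measurable fun ω => Real.exp (s * ‖B.err t i ω‖ ^ 2) :=
    Real.measurable_exp.comp (hDm.const_mul s)
  have hi2 : IntegrableOn (fun ω => Real.exp (c * d * (ν / clock Cb d t ^ 2) *
      (1.2 * b' + 3.15)) * Real.exp (s * ‖B.err t i ω‖ ^ 2)) S μ :=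
    (integrableOn_of_bounded hSm hexpm fun ω hω => by
      rw [abs_of_pos (Real.exp_pos _)]; exact hexpb ω hω).const_mul _
  refine integral_mono_of_nonneg ?_ hi2 ?_
  · refine Filter.Eventually.of_forall fun ω => ?_
    simp only [Pi.zero_apply]; positivity
  · exact (ae_restrict_iff' hSm).2 (Filter.Eventually.of_forall hpt)

/-- One step with contraction. -/
theorem setIntegral_exp_le_of_drift {t : ℕ} (i : Fin K) {S : Set Ω}
    (hS : MeasurableSet[B.past t] S)
    (hSR : ∀ ω ∈ S, lmax * ‖B.err t i ω‖ ^ 2 ≤ b * sig ^ 2)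
    (hdrift : 2 / Ca * lmin * ∫ ω in S, Real.exp (expRate lmin lmax sig Ca c *
        (clock Cb d t + 1) * ‖B.err t i ω‖ ^ 2) * ‖B.err t i ω‖ ^ 2 ∂μ ≤
      ∫ ω in S, Real.exp (expRate lmin lmax sig Ca c * (clock Cb d t + 1) *
        ‖B.err t i ω‖ ^ 2) * (pullProb B p t i ω * inner ℝ (B.X t ω) (B.err t i ω) ^ 2) ∂μ)
    {Λ : ℝ} (hΛ : 4 * c * d ≤ Λ)
    (hmgf : ∫ ω in S, Real.exp (expRate lmin lmax sig Ca c * clock Cb d t *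
      ‖B.err t i ω‖ ^ 2) ∂μ ≤ Real.exp Λ) :
    ∫ ω in S ∩ {ω | ‖B.X t ω‖ ^ 2 ≤ truncLevel lmax Ca d t},
      Real.exp (expRate lmin lmax sig Ca c * clock Cb d (t + 1) * ‖B.err (t + 1) i ω‖ ^ 2) ∂μ ≤
    Real.exp Λ := by
  have hL := hR.lmax_pos
  have hlm := hR.lmin_pos
  have hsg := hR.sig_pos
  have hn := hR.clock_ge t
  have hn0 := hR.clock_pos t
  have hc := hR.c_pos
  have hCa := hR.Ca_pos
  have hθ := hR.expRate_pos
  have hstep := hR.step_pos t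
  have hSm : MeasurableSet S := hR.greedy.past_le t _ hS
  have hDm : Measurable fun ω => ‖B.err t i ω‖ ^ 2 :=
    measurable_norm_sq_comp (hR.greedy.measurable_err t i)
  rw [clock_succ]
  refine (hR.setIntegral_exp_le i hS hSR (Or.inr rfl) (by linarith) le_rfl).trans ?_
  set n := clock Cb d t with hnd
  set θ := expRate lmin lmax sig Ca c with hθd
  set s := θ * (n + 1) with hs
  set η := B.step t with hη
  have hs0 : 0 ≤ s := by positivity
  have hDR : ∀ ω ∈ S, ‖B.err t i ω‖ ^ 2 ≤ b * sig ^ 2 / lmax := fun ω hω => by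
    rw [le_div_iff₀ hL, mul_comm]; exact hSR ω hω
  have hexpb : ∀ ω ∈ S, Real.exp (s * ‖B.err t i ω‖ ^ 2) ≤
      Real.exp (s * (b * sig ^ 2 / lmax)) := fun ω hω =>
    Real.exp_le_exp.2 (mul_le_mul_of_nonneg_left (hDR ω hω) hs0)
  -- The step size turns the guaranteed drift into exactly 2/n; with the factor 1.9 of the noise
  -- step the gain is 3.8 s D/n.
  have hηn : η * (2 / Ca * lmin) = 2 / n := by
    rw [hη, hR.step_eq_clock, ← hnd]; field_simp
  have hbase : ∀ k : ℕ, IntegrableOn (fun ω => Real.exp (s * ‖B.err t i ω‖ ^ 2) *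
      (‖B.err t i ω‖ ^ 2) ^ k) S μ := fun k =>
    integrableOn_of_bounded hSm
      ((Real.measurable_exp.comp (hDm.const_mul s)).mul (hDm.pow_const k))
      (M := Real.exp (s * (b * sig ^ 2 / lmax)) * (b * sig ^ 2 / lmax) ^ k) fun ω hω => by
        rw [abs_of_nonneg (by positivity)]
        exact mul_le_mul (hexpb ω hω) (pow_le_pow_left₀ (sq_nonneg _) (hDR ω hω) k)
          (by positivity) (Real.exp_pos _).le
  have hb0 := hbase 0
  have hb1 := hbase 1
  have hb2 := hbase 2
  simp only [pow_zero, mul_one, pow_one] at hb0 hb1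
  have hpt : ∀ ω ∈ S, Real.exp (s * ‖B.err t i ω‖ ^ 2) *
      (1 + 1 * (4 * (s * η) ^ 2 * lmax ^ 2 * (‖B.err t i ω‖ ^ 2) ^ 2)
        + (1.2 * s * η ^ 2 * lmax ^ 2 * d) * ‖B.err t i ω‖ ^ 2
        + 3.15 * s * η ^ 2 * sig ^ 2 * lmax * d) - 3.8 * (s / n) *
        (Real.exp (s * ‖B.err t i ω‖ ^ 2) * ‖B.err t i ω‖ ^ 2) ≤
      (1 - 1 / n) * Real.exp (θ * n * ‖B.err t i ω‖ ^ 2) + 1 / n * Real.exp Λ := fun ω hω => by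
    have hDb := hSR ω hω
    set D := ‖B.err t i ω‖ ^ 2 with hD
    have hD0 : 0 ≤ D := sq_nonneg _
    set u := s * D / n with hu
    have hu0 : 0 ≤ u := by positivity
    have hsη : s * η ^ 2 * (lmax * sig ^ 2) = c * (n + 1) / n ^ 2 := by
      have : s * η ^ 2 = θ * B.step t ^ 2 * (n + 1) := by rw [hs]; ring
      rw [this, hθd, hR.expRate_mul_step_sq, ← hnd]; field_simp
    have hn1 : (n + 1) / n ≤ 49 / 48 := by
      rw [div_le_iff₀ hn0]; linarith
    have hn10 : 0 ≤ (n + 1) / n := by positivity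
    have hcb : c * b ≤ 1 / 240 := by linarith [hR.c_mul_b_le]
    -- The term is quadratic in D. The bound λ_max D ≤ b σ² linearises it, and c b ≤ 1/240 makes it
    -- small.
    have hT1 : 1 * (4 * (s * η) ^ 2 * lmax ^ 2 * D ^ 2) ≤ 0.1 * u := by
      have h1 : (s * η ^ 2 * lmax) * (lmax * D) ≤ (s * η ^ 2 * lmax) * (b * sig ^ 2) :=
        mul_le_mul_of_nonneg_left hDb (by positivity)
      have h2 : (s * η ^ 2 * lmax) * (b * sig ^ 2) = c * b * ((n + 1) / n) * (1 / n) := by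
        have : (s * η ^ 2 * lmax) * (b * sig ^ 2) = b * (s * η ^ 2 * (lmax * sig ^ 2)) := by ring
        rw [this, hsη]; field_simp
      have h3 : c * b * ((n + 1) / n) * (1 / n) ≤ 1 / 240 * (49 / 48) * (1 / n) := by
        have := hR.b_nonneg
        gcongr
      have h4 : (s * η ^ 2 * lmax) * (lmax * D) ≤ 1 / 48 * (1 / n) := by
        refine h1.trans (h2.trans_le (h3.trans ?_))
        have : 0 ≤ 1 / n := by positivity
        linarith
      calc 1 * (4 * (s * η) ^ 2 * lmax ^ 2 * D ^ 2) =
          (s * η ^ 2 * lmax) * (lmax * D) * (4 * (s * D)) := by ring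
        _ ≤ 1 / 48 * (1 / n) * (4 * (s * D)) := by gcongr
        _ = (1 / 12) * u := by rw [hu]; ring
        _ ≤ _ := by linarith
    have hT2 : (1.2 * s * η ^ 2 * lmax ^ 2 * d) * D ≤ 0.4 * u := by
      calc (1.2 * s * η ^ 2 * lmax ^ 2 * d) * D = 1.2 * (s * D) * (η ^ 2 * lmax ^ 2 * d) := by ring
        _ ≤ 1.2 * (s * D) * (1 / (3 * n)) :=
            mul_le_mul_of_nonneg_left (hR.step_sq_mul_le t) (by positivity)
        _ = 0.4 * u := by rw [hu]; field_simp; ring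
    have hT3 : 3.15 * s * η ^ 2 * sig ^ 2 * lmax * d ≤ 4 * c * d / n := by
      calc 3.15 * s * η ^ 2 * sig ^ 2 * lmax * d =
          3.15 * d * (s * η ^ 2 * (lmax * sig ^ 2)) := by ring
        _ = 3.15 * (c * d / n) * ((n + 1) / n) := by rw [hsη]; field_simp
        _ ≤ 3.15 * (c * d / n) * (49 / 48) := by gcongr
        _ ≤ 4 * (c * d / n) := by
            have : 0 ≤ c * d / n := by positivity
            linarith
        _ = _ := by ring
    -- Of the gain 3.8u at most 0.5u is lost to second-order terms, so more than 2u remains. The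
    -- noise contributes at most Λ/n.
    have hsum : 1 + 1 * (4 * (s * η) ^ 2 * lmax ^ 2 * D ^ 2)
        + (1.2 * s * η ^ 2 * lmax ^ 2 * d) * D
        + 3.15 * s * η ^ 2 * sig ^ 2 * lmax * d - 3.8 * u ≤ Real.exp (-(2 * u) + Λ / n) := by
      refine le_trans ?_ (Real.add_one_le_exp _)
      have : 4 * c * d / n ≤ Λ / n := by gcongr
      linarith
    -- Since s = θ(n + 1) and u = sD/n, s D - 2u is at most (n - 1) θ D, that is (1 - 1/n) times the
    -- old exponent. By convexity the result is then a mixture of the old exponential and exp Λ.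
    have hexp : Real.exp (s * D) * Real.exp (-(2 * u) + Λ / n) ≤
        Real.exp ((1 - 1 / n) * (θ * n * D) + 1 / n * Λ) := by
      rw [← Real.exp_add]
      refine Real.exp_le_exp.2 ?_
      have e1 : s * D + (-(2 * u) + Λ / n) =
          (1 - 1 / n) * (θ * n * D) + 1 / n * Λ - 2 * (θ * D / n) := by
        rw [hu, hs]; field_simp; ring
      rw [e1]
      have : 0 ≤ θ * D / n := by positivity
      linarith
    have hconv := convexOn_exp.2 (Set.mem_univ (θ * n * D)) (Set.mem_univ Λ)
      (show 0 ≤ 1 - 1 / n by rw [sub_nonneg, div_le_one hn0]; linarith)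
      (show 0 ≤ 1 / n by positivity) (by ring)
    simp only [smul_eq_mul] at hconv
    calc _ = Real.exp (s * D) * (1 + 1 * (4 * (s * η) ^ 2 * lmax ^ 2 * D ^ 2)
        + (1.2 * s * η ^ 2 * lmax ^ 2 * d) * D
        + 3.15 * s * η ^ 2 * sig ^ 2 * lmax * d - 3.8 * u) := by rw [hu]; ring
      _ ≤ Real.exp (s * D) * Real.exp (-(2 * u) + Λ / n) :=
          mul_le_mul_of_nonneg_left hsum (Real.exp_pos _).le
      _ ≤ _ := hexp.trans hconv
  have hi1 : IntegrableOn (fun ω => Real.exp (s * ‖B.err t i ω‖ ^ 2) *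
      (1 + 1 * (4 * (s * η) ^ 2 * lmax ^ 2 * (‖B.err t i ω‖ ^ 2) ^ 2)
        + (1.2 * s * η ^ 2 * lmax ^ 2 * d) * ‖B.err t i ω‖ ^ 2
        + 3.15 * s * η ^ 2 * sig ^ 2 * lmax * d)) S μ := by
    refine (((hb0.const_mul (1 + 3.15 * s * η ^ 2 * sig ^ 2 * lmax * d)).add
      (hb1.const_mul (1.2 * s * η ^ 2 * lmax ^ 2 * d))).add
      (hb2.const_mul (4 * (s * η) ^ 2 * lmax ^ 2))).congr
      (Filter.Eventually.of_forall fun ω => ?_)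
    simp only [Pi.add_apply]; ring
  have hi2 : IntegrableOn (fun ω => Real.exp (θ * n * ‖B.err t i ω‖ ^ 2)) S μ :=
    integrableOn_of_bounded hSm (Real.measurable_exp.comp (hDm.const_mul _))
      (M := Real.exp (θ * n * (b * sig ^ 2 / lmax))) fun ω hω => by
        rw [abs_of_pos (Real.exp_pos _)]
        exact Real.exp_le_exp.2 (mul_le_mul_of_nonneg_left (hDR ω hω) (by positivity))
  have hi3 : IntegrableOn (fun _ : Ω => 1 / n * Real.exp Λ) S μ :=
    (integrable_const _).integrableOn
  have hmain := setIntegral_mono_on (hi1.sub (hb1.const_mul (3.8 * (s / n))))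
    ((hi2.const_mul (1 - 1 / n)).add hi3) hSm hpt
  have a1 := integral_sub hi1 (hb1.const_mul (3.8 * (s / n)))
  have a2 := integral_add (hi2.const_mul (1 - 1 / n)) hi3
  simp only [Pi.sub_apply, Pi.add_apply] at a1 a2 hmain
  rw [a1, a2, integral_const_mul, integral_const_mul, setIntegral_const, smul_eq_mul] at hmain
  have hd2 := mul_le_mul_of_nonneg_left hdrift (show 0 ≤ 1.9 * (s * η) by positivity)
  have e4 : 1.9 * (s * η) * (2 / Ca * lmin * ∫ ω in S, Real.exp (s * ‖B.err t i ω‖ ^ 2) *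
      ‖B.err t i ω‖ ^ 2 ∂μ) = 3.8 * (s / n) * ∫ ω in S, Real.exp (s * ‖B.err t i ω‖ ^ 2) *
      ‖B.err t i ω‖ ^ 2 ∂μ := by
    have : 1.9 * (s * η) * (2 / Ca * lmin * ∫ ω in S, Real.exp (s * ‖B.err t i ω‖ ^ 2) *
      ‖B.err t i ω‖ ^ 2 ∂μ) = 1.9 * s * (η * (2 / Ca * lmin)) *
      ∫ ω in S, Real.exp (s * ‖B.err t i ω‖ ^ 2) * ‖B.err t i ω‖ ^ 2 ∂μ := by ring
    rw [this, hηn]; ring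
  rw [e4] at hd2
  have hn1 : 0 ≤ 1 - 1 / n := by rw [sub_nonneg, div_le_one hn0]; linarith
  have hm1 := mul_le_mul_of_nonneg_left hmgf hn1
  have hμS : μ.real S * (1 / n * Real.exp Λ) ≤ 1 * (1 / n * Real.exp Λ) :=
    mul_le_mul_of_nonneg_right measureReal_le_one (by positivity)
  rw [one_mul]
  linarith

end TunedRun

end Bandit

/-! ### Good events, drift, and moment bounds over time -/

/-- Markov's inequality that keeps the integral over the complement. That remainder starts the next
step when exit events are summed in the maximal inequality. -/
theorem measureReal_inter_mul_le_setIntegral {Ω : Type*} [MeasurableSpace Ω] {μ : Measure Ω}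
    [IsFiniteMeasure μ] {S T : Set Ω} (hS : MeasurableSet S) (hT : MeasurableSet T) {f : Ω → ℝ}
    (hf : IntegrableOn f S μ) {a : ℝ} (ha : ∀ ω ∈ S ∩ T, a ≤ f ω) :
    μ.real (S ∩ T) * a + ∫ ω in S \ T, f ω ∂μ ≤ ∫ ω in S, f ω ∂μ := by
  rw [← integral_inter_add_sdiff hT hf]
  gcongr
  calc μ.real (S ∩ T) * a = ∫ _ω in S ∩ T, a ∂μ := by rw [setIntegral_const, smul_eq_mul]
    _ ≤ _ := setIntegral_mono_on (integrable_const a).integrableOn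
      (hf.mono_set Set.inter_subset_left) (hS.inter hT) ha

namespace Bandit

variable {Ω : Type*} [m0 : MeasurableSpace Ω] {d K : ℕ}

theorem measurableSet_conicRegion (β : Fin K → EuclideanSpace ℝ (Fin d)) (i : Fin K) (h : ℝ) :
    MeasurableSet (conicRegion β i h) := by
  have : conicRegion β i h = ⋂ j, ⋂ (_ : j ≠ i),
      {x : EuclideanSpace ℝ (Fin d) | h * ‖x‖ ≤ inner ℝ x (β i) - inner ℝ x (β j)} := by
    ext x; simp [conicRegion]
  rw [this]
  refine MeasurableSet.iInter fun j => MeasurableSet.iInter fun _ => ?_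
  exact measurableSet_le (by fun_prop) (by fun_prop)

/-- The event that before time `t` all covariates are below the truncation level, the errors of
arm `i` are below `R`, and the side events `Q` hold. -/
def goodSet (B : Bandit Ω d K) (lmax Ca : ℝ) (R : ℕ → ℝ) (Q : ℕ → Set Ω) (i : Fin K) (t : ℕ) :
    Set Ω :=
  {ω | ∀ l < t, ‖B.X l ω‖ ^ 2 ≤ truncLevel lmax Ca d l ∧ ‖B.err l i ω‖ ^ 2 ≤ R l ∧ ω ∈ Q l}

variable {B : Bandit Ω d K} {μ : Measure Ω} [IsProbabilityMeasure μ] {p : ℕ → ℝ}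
  {lmin lmax sig Ca Cb c b : ℝ}

omit m0 in
theorem goodSet_zero (R : ℕ → ℝ) (Q : ℕ → Set Ω) (i : Fin K) :
    B.goodSet lmax Ca R Q i 0 = Set.univ := by
  simp [goodSet]

omit m0 in
theorem goodSet_succ (R : ℕ → ℝ) (Q : ℕ → Set Ω) (i : Fin K) (t : ℕ) :
    B.goodSet lmax Ca R Q i (t + 1) =
      (B.goodSet lmax Ca R Q i t ∩ {ω | ‖B.err t i ω‖ ^ 2 ≤ R t} ∩ Q t) ∩
        {ω | ‖B.X t ω‖ ^ 2 ≤ truncLevel lmax Ca d t} := by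
  ext ω
  simp only [goodSet, Set.mem_inter_iff, Set.mem_ofPred_eq, Nat.forall_lt_succ_right]
  tauto

omit m0 in
theorem measurableSet_goodSet {R : ℕ → ℝ} {Q : ℕ → Set Ω}
    (hQ : ∀ l, MeasurableSet[B.past l] (Q l)) (i : Fin K) (t : ℕ) :
    MeasurableSet[B.past t] (B.goodSet lmax Ca R Q i t) := by
  induction t with
  | zero => rw [goodSet_zero]; exact MeasurableSet.univ
  | succ t ih =>
    rw [goodSet_succ]
    have hle := B.past_mono (Nat.le_succ t)
    refine MeasurableSet.inter (hle _ ((ih.inter ?_).inter (hQ t))) ?_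
    · exact measurableSet_le (measurable_norm_sq_comp (B.measurable_err_past t i)) measurable_const
    · exact measurableSet_le (measurable_norm_sq_comp (B.measurable_X_past t)) measurable_const

namespace TunedRun

/-- The contraction holds if, on `S`, arm `i` is pulled with conditional probability at least
`2 / C_a` whenever the covariate lies in a region with large second moments. -/
theorem drift_of_region (hR : B.TunedRun μ p lmin lmax sig Ca Cb c b) {t : ℕ} (i : Fin K)
    {S : Set Ω} (hS : MeasurableSet[B.past t] S)
    (hSR : ∀ ω ∈ S, lmax * ‖B.err t i ω‖ ^ 2 ≤ b * sig ^ 2)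
    {T : Set (EuclideanSpace ℝ (Fin d))} (hT : MeasurableSet T)
    (hgram : ∀ᵐ ω ∂μ, (condGram (B.past t) μ (B.X t) T ω
      - lmin • (1 : Matrix (Fin d) (Fin d) ℝ)).PosSemidef)
    (hq : ∀ ω ∈ S, 2 / Ca * T.indicator (fun x => inner ℝ x (B.err t i ω) ^ 2) (B.X t ω) ≤
      pullProb B p t i ω * inner ℝ (B.X t ω) (B.err t i ω) ^ 2) {s : ℝ} (hs : 0 ≤ s) :
    2 / Ca * lmin * ∫ ω in S, Real.exp (s * ‖B.err t i ω‖ ^ 2) * ‖B.err t i ω‖ ^ 2 ∂μ ≤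
      ∫ ω in S, Real.exp (s * ‖B.err t i ω‖ ^ 2) *
        (pullProb B p t i ω * inner ℝ (B.X t ω) (B.err t i ω) ^ 2) ∂μ := by
  have hL := hR.lmax_pos
  have hm := hR.greedy.past_le t
  have hSm : MeasurableSet S := hm _ hS
  have hem := B.measurable_err_past t i
  have hCa := hR.Ca_pos
  set D0 := b * sig ^ 2 / lmax with hD0
  have hDR : ∀ ω ∈ S, ‖B.err t i ω‖ ^ 2 ≤ D0 := fun ω hω => by
    rw [hD0, le_div_iff₀ hL, mul_comm]; exact hSR ω hω
  have hD00 : 0 ≤ D0 := div_nonneg (mul_nonneg hR.b_nonneg (sq_nonneg _)) hL.le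
  set v : Ω → ℝ := S.indicator fun ω => Real.exp (s * ‖B.err t i ω‖ ^ 2) with hv
  have hvm : Measurable[B.past t] v :=
    (Real.measurable_exp.comp ((measurable_norm_sq_comp hem).const_mul s)).indicator hS
  have hv0 : ∀ ω, 0 ≤ v ω := fun ω => Set.indicator_nonneg (fun _ _ => (Real.exp_pos _).le) ω
  have hvc : ∀ ω, v ω * ‖B.err t i ω‖ ^ 2 ≤ Real.exp (s * D0) * D0 := fun ω => by
    by_cases hω : ω ∈ S
    · rw [hv, Set.indicator_of_mem hω]
      have := hDR ω hω
      gcongr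
    · rw [hv, Set.indicator_of_notMem hω, zero_mul]; positivity
  have hXm := hR.greedy.measurable_X t
  have hψ := hR.cov.subGaussian t
  obtain ⟨iT, hTle⟩ := mul_integral_norm_sq_le_of_condGram hm hXm hL hψ hT hgram hem hvm hv0 hvc
  obtain ⟨iU, -⟩ := mul_integral_norm_sq_le_of_condGram hm hXm hL hψ MeasurableSet.univ
    (hR.cov.second_moment t) hem hvm hv0 hvc
  simp only [Set.indicator_univ] at iU
  have hqm := (hR.greedy.measurable_pullProb t i).mono (hR.greedy.pastPlus_le t) le_rfl
  have iq : Integrable (fun ω => v ω * (pullProb B p t i ω *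
      inner ℝ (B.X t ω) (B.err t i ω) ^ 2)) μ := by
    refine (iU.bdd_mul (c := 1) hqm.aestronglyMeasurable
      (Filter.Eventually.of_forall fun ω => ?_)).congr (Filter.Eventually.of_forall fun ω => ?_)
    · rw [Real.norm_eq_abs, abs_of_nonneg (pullProb_nonneg (hR.prob_mem t) i ω)]
      exact pullProb_le_one (hR.prob_mem t) i ω
    · dsimp only; ring
  have hind : ∀ f : Ω → ℝ, ∫ ω in S, Real.exp (s * ‖B.err t i ω‖ ^ 2) * f ω ∂μ =
      ∫ ω, v ω * f ω ∂μ := fun f => by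
    rw [← integral_indicator hSm]
    refine integral_congr_ae (Filter.Eventually.of_forall fun ω => ?_)
    by_cases hω : ω ∈ S
    · simp only [hv, Set.indicator_of_mem hω]
    · simp only [hv, Set.indicator_of_notMem hω, zero_mul]
  rw [hind, hind, mul_assoc]
  calc 2 / Ca * (lmin * ∫ ω, v ω * ‖B.err t i ω‖ ^ 2 ∂μ) ≤ 2 / Ca *
      ∫ ω, v ω * T.indicator (fun x => inner ℝ x (B.err t i ω) ^ 2) (B.X t ω) ∂μ := by gcongr
    _ = ∫ ω, 2 / Ca * (v ω * T.indicator (fun x => inner ℝ x (B.err t i ω) ^ 2) (B.X t ω)) ∂μ :=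
        (integral_const_mul _ _).symm
    _ ≤ _ := by
        refine integral_mono (iT.const_mul _) iq fun ω => ?_
        by_cases hω : ω ∈ S
        · have := mul_le_mul_of_nonneg_left (hq ω hω) (hv0 ω)
          dsimp only
          linarith
        · simp only [hv, Set.indicator_of_notMem hω, zero_mul, mul_zero, le_refl]

/-- Contraction from forced exploration. -/
theorem drift_of_exploration (hR : B.TunedRun μ p lmin lmax sig Ca Cb c b) {t : ℕ} (i : Fin K)
    (hp : 2 / Ca ≤ p t / K) {S : Set Ω} (hS : MeasurableSet[B.past t] S)
    (hSR : ∀ ω ∈ S, lmax * ‖B.err t i ω‖ ^ 2 ≤ b * sig ^ 2) {s : ℝ} (hs : 0 ≤ s) :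
    2 / Ca * lmin * ∫ ω in S, Real.exp (s * ‖B.err t i ω‖ ^ 2) * ‖B.err t i ω‖ ^ 2 ∂μ ≤
      ∫ ω in S, Real.exp (s * ‖B.err t i ω‖ ^ 2) *
        (pullProb B p t i ω * inner ℝ (B.X t ω) (B.err t i ω) ^ 2) ∂μ := by
  refine hR.drift_of_region i hS hSR MeasurableSet.univ (hR.cov.second_moment t)
    (fun ω _ => ?_) hs
  rw [Set.indicator_univ]
  refine mul_le_mul_of_nonneg_right (hp.trans ?_) (sq_nonneg _)
  have : 0 ≤ (1 - p t) * (if B.greedyArm t ω = i then 1 else 0) := by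
    have := (hR.prob_mem t).2
    refine mul_nonneg (by linarith) ?_
    split_ifs <;> norm_num
  unfold pullProb
  linarith

omit [IsProbabilityMeasure μ] in
-- Two estimation errors below h/2 perturb a difference of rewards by less than h ‖X‖, the margin of
-- the region. At X = 0 strictness fails.
theorem greedyArm_eq_of_mem_conicRegion (hR : B.TunedRun μ p lmin lmax sig Ca Cb c b) {t : ℕ}
    {i : Fin K} {h : ℝ} {ω : Ω} (herr : ∀ j, ‖B.err t j ω‖ < h / 2)
    (hX : B.X t ω ∈ conicRegion B.betaStar i h) (hX0 : B.X t ω ≠ 0) : B.greedyArm t ω = i := by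
  by_contra hne
  have h1 := hX _ hne
  have h2 := hR.greedy.greedy_max t ω i
  set j := B.greedyArm t ω
  have hXp : 0 < ‖B.X t ω‖ := norm_pos_iff.2 hX0
  have e1 : ∀ k, inner ℝ (B.X t ω) (B.est t ω k) =
      inner ℝ (B.X t ω) (B.betaStar k) + inner ℝ (B.X t ω) (B.err t k ω) := fun k => by
    rw [← inner_add_right]; congr 1; simp [err]
  have h3 := (abs_le.1 (abs_real_inner_le_norm (B.X t ω) (B.err t i ω))).1
  have h4 := (abs_le.1 (abs_real_inner_le_norm (B.X t ω) (B.err t j ω))).2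
  have h5 := mul_lt_mul_of_pos_left (herr i) hXp
  have h6 := mul_lt_mul_of_pos_left (herr j) hXp
  rw [e1, e1] at h2
  linarith

/-- Contraction from greedy pulls when all arms are estimated accurately. -/
theorem drift_of_accuracy (hR : B.TunedRun μ p lmin lmax sig Ca Cb c b) {t : ℕ} {h : ℝ}
    {A : Finset (Fin K)} (hA : B.ArmOptimality μ lmin h A) {i : Fin K} (hi : i ∈ A)
    (hK : 2 / Ca ≤ 1 / K) {S : Set Ω} (hS : MeasurableSet[B.past t] S)
    (hSR : ∀ ω ∈ S, lmax * ‖B.err t i ω‖ ^ 2 ≤ b * sig ^ 2)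
    (herr : ∀ ω ∈ S, ∀ j, ‖B.err t j ω‖ < h / 2) {s : ℝ} (hs : 0 ≤ s) :
    2 / Ca * lmin * ∫ ω in S, Real.exp (s * ‖B.err t i ω‖ ^ 2) * ‖B.err t i ω‖ ^ 2 ∂μ ≤
      ∫ ω in S, Real.exp (s * ‖B.err t i ω‖ ^ 2) *
        (pullProb B p t i ω * inner ℝ (B.X t ω) (B.err t i ω) ^ 2) ∂μ := by
  refine hR.drift_of_region i hS hSR (measurableSet_conicRegion B.betaStar i h)
    (hA.optimal t i hi) (fun ω hω => ?_) hs
  have hq0 := pullProb_nonneg (B := B) (hR.prob_mem t) i ω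
  by_cases hX : B.X t ω ∈ conicRegion B.betaStar i h
  · rw [Set.indicator_of_mem hX]
    -- The origin lies in the conic region and the greedy choice is arbitrary there, but both sides
    -- vanish.
    by_cases hX0 : B.X t ω = 0
    · simp [hX0]
    · have hg := hR.greedyArm_eq_of_mem_conicRegion (herr ω hω) hX hX0
      -- If i is the greedy arm, its pull probability p/K + 1 - p is at least 1/K for every
      -- exploration rate p.
      refine mul_le_mul_of_nonneg_right (hK.trans ?_) (sq_nonneg _)
      unfold pullProb
      rw [if_pos hg]
      have hK1 : (1 : ℝ) ≤ K := by exact_mod_cast (Fin.pos i)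
      have h1 : 1 / (K : ℝ) ≤ 1 := (div_le_one (by linarith)).2 hK1
      have h2 : p t / K = p t * (1 / K) := by ring
      have h3 := hR.prob_mem t
      rw [h2]
      nlinarith
  · rw [Set.indicator_of_notMem hX, mul_zero]
    positivity

/-- The good set at time t does not bound the error at time t itself. Integrability there comes from
the noise step of the preceding update. -/
theorem integrableOn_exp_goodSet (hR : B.TunedRun μ p lmin lmax sig Ca Cb c b)
    {R : ℕ → ℝ} {Q : ℕ → Set Ω} (hQ : ∀ l, MeasurableSet[B.past l] (Q l)) (i : Fin K)
    (t : ℕ) {ν : ℝ} (hν0 : 0 ≤ ν) (hν : ν ≤ clock Cb d t) :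
    IntegrableOn (fun ω => Real.exp (expRate lmin lmax sig Ca c * ν * ‖B.err t i ω‖ ^ 2))
      (B.goodSet lmax Ca R Q i t) μ := by
  cases t with
  | zero =>
    refine integrableOn_of_bounded
      ((hR.greedy.past_le 0) _ (measurableSet_goodSet hQ i 0)) (Real.measurable_exp.comp
      ((measurable_norm_sq_comp (hR.greedy.measurable_err 0 i)).const_mul _))
      (M := Real.exp (expRate lmin lmax sig Ca c * ν * ‖B.betaInit i - B.betaStar i‖ ^ 2))
      fun ω _ => ?_
    rw [abs_of_pos (Real.exp_pos _)]
    exact le_rfl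
  | succ t =>
    rw [goodSet_succ]
    rw [clock_succ] at hν
    refine hR.integrableOn_exp_succ i (R := R t) ?_ (fun ω hω => hω.1.2) hν0 hν
    exact ((measurableSet_goodSet hQ i t).inter (measurableSet_le
      (measurable_norm_sq_comp (B.measurable_err_past t i)) measurable_const)).inter (hQ t)

/-- The exponential moment of the normalised squared error stays bounded on the good events as
long as the contraction holds. -/
theorem setIntegral_exp_goodSet_le (hR : B.TunedRun μ p lmin lmax sig Ca Cb c b)
    {R : ℕ → ℝ} {Q : ℕ → Set Ω} (hQ : ∀ l, MeasurableSet[B.past l] (Q l)) (i : Fin K)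
    (hRb : ∀ l, lmax * R l ≤ b * sig ^ 2) {N : ℕ} {Λ : ℝ} (hΛ : 4 * c * d ≤ Λ)
    (hinit : expRate lmin lmax sig Ca c * clock Cb d 0 * ‖B.betaInit i - B.betaStar i‖ ^ 2 ≤ Λ)
    (hdrift : ∀ l < N, ∀ S : Set Ω, MeasurableSet[B.past l] S → S ⊆ Q l →
      (∀ ω ∈ S, lmax * ‖B.err l i ω‖ ^ 2 ≤ b * sig ^ 2) → ∀ s : ℝ, 0 ≤ s →
      2 / Ca * lmin * ∫ ω in S, Real.exp (s * ‖B.err l i ω‖ ^ 2) * ‖B.err l i ω‖ ^ 2 ∂μ ≤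
      ∫ ω in S, Real.exp (s * ‖B.err l i ω‖ ^ 2) *
        (pullProb B p l i ω * inner ℝ (B.X l ω) (B.err l i ω) ^ 2) ∂μ)
    {t : ℕ} (ht : t ≤ N) :
    ∫ ω in B.goodSet lmax Ca R Q i t, Real.exp (expRate lmin lmax sig Ca c * clock Cb d t *
      ‖B.err t i ω‖ ^ 2) ∂μ ≤ Real.exp Λ := by
  induction t with
  | zero =>
    rw [goodSet_zero, setIntegral_univ]
    have : ∀ ω, B.err 0 i ω = B.betaInit i - B.betaStar i := fun ω => rfl
    simp only [this, integral_const, probReal_univ, one_smul]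
    exact Real.exp_le_exp.2 hinit
  | succ t ih =>
    rw [goodSet_succ]
    have hGm := measurableSet_goodSet (lmax := lmax) (Ca := Ca) (R := R) hQ i t
    have hDm : MeasurableSet[B.past t] {ω | ‖B.err t i ω‖ ^ 2 ≤ R t} := measurableSet_le
      (measurable_norm_sq_comp (B.measurable_err_past t i)) measurable_const
    have hSm := (hGm.inter hDm).inter (hQ t)
    have hSR : ∀ ω ∈ B.goodSet lmax Ca R Q i t ∩ {ω | ‖B.err t i ω‖ ^ 2 ≤ R t} ∩ Q t,
        lmax * ‖B.err t i ω‖ ^ 2 ≤ b * sig ^ 2 := fun ω hω =>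
      (mul_le_mul_of_nonneg_left hω.1.2 hR.lmax_pos.le).trans (hRb t)
    refine hR.setIntegral_exp_le_of_drift i hSm hSR ?_ hΛ ?_
    · refine hdrift t (by omega) _ hSm Set.inter_subset_right hSR _ ?_
      have := hR.clock_pos t
      have := hR.expRate_pos
      positivity
    · refine le_trans ?_ (ih (by omega))
      refine setIntegral_mono_set (hR.integrableOn_exp_goodSet hQ i t (hR.clock_pos t).le le_rfl)
        (Filter.Eventually.of_forall fun ω => (Real.exp_pos _).le) ?_
      exact LE.le.eventuallyLE (fun ω hω => hω.1.1)

theorem measureReal_goodSet_gt_le (hR : B.TunedRun μ p lmin lmax sig Ca Cb c b)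
    {R : ℕ → ℝ} {Q : ℕ → Set Ω} (hQ : ∀ l, MeasurableSet[B.past l] (Q l)) (i : Fin K)
    {t : ℕ} {Λ : ℝ} (hmgf : ∫ ω in B.goodSet lmax Ca R Q i t,
      Real.exp (expRate lmin lmax sig Ca c * clock Cb d t * ‖B.err t i ω‖ ^ 2) ∂μ ≤ Real.exp Λ)
    (r : ℝ) :
    μ.real (B.goodSet lmax Ca R Q i t ∩ {ω | r < ‖B.err t i ω‖ ^ 2}) ≤
      Real.exp (Λ - expRate lmin lmax sig Ca c * clock Cb d t * r) := by
  have hS : MeasurableSet (B.goodSet lmax Ca R Q i t) :=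
    hR.greedy.past_le t _ (measurableSet_goodSet hQ i t)
  have hT : MeasurableSet {ω | r < ‖B.err t i ω‖ ^ 2} :=
    measurableSet_lt measurable_const (measurable_norm_sq_comp (hR.greedy.measurable_err t i))
  have hθ := hR.expRate_pos
  have hn := hR.clock_pos t
  have h1 := measureReal_inter_mul_le_setIntegral hS hT
    (hR.integrableOn_exp_goodSet (R := R) hQ i t (hR.clock_pos t).le le_rfl)
    (a := Real.exp (expRate lmin lmax sig Ca c * clock Cb d t * r)) fun ω hω => by
      have : r < ‖B.err t i ω‖ ^ 2 := hω.2
      exact Real.exp_le_exp.2 (by gcongr)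
  have h2 : 0 ≤ ∫ ω in B.goodSet lmax Ca R Q i t \ {ω | r < ‖B.err t i ω‖ ^ 2},
      Real.exp (expRate lmin lmax sig Ca c * clock Cb d t * ‖B.err t i ω‖ ^ 2) ∂μ :=
    integral_nonneg fun ω => (Real.exp_pos _).le
  rw [Real.exp_sub, le_div_iff₀ (Real.exp_pos _)]
  linarith

/-- Telescoping: 1/n² ≤ 1/(n - 1) - 1/n. -/
theorem sum_inv_clock_sq_le (hR : B.TunedRun μ p lmin lmax sig Ca Cb c b) {n l : ℕ} (h : n ≤ l) :
    ∑ k ∈ Finset.Ico n l, 1 / clock Cb d k ^ 2 ≤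
      1 / (clock Cb d n - 1) - 1 / (clock Cb d l - 1) := by
  induction l, h using Nat.le_induction with
  | base => simp
  | succ l hl ih =>
    rw [Finset.sum_Ico_succ_top hl, clock_succ]
    have hn := hR.clock_ge l
    have h1 : 0 < clock Cb d l - 1 := by linarith
    have h2 : 0 < clock Cb d l := by linarith
    have : 1 / clock Cb d l ^ 2 ≤ 1 / (clock Cb d l - 1) - 1 / (clock Cb d l + 1 - 1) := by
      rw [add_sub_cancel_right, div_sub_div _ _ h1.ne' h2.ne', div_le_div_iff₀ (by positivity)
        (by positivity)]
      nlinarith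
    linarith

/-- Maximal inequality without contraction, from time `n` on. -/
theorem sum_measureReal_goodSet_gt_le (hR : B.TunedRun μ p lmin lmax sig Ca Cb c b)
    {R : ℕ → ℝ} (i : Fin K) {n l : ℕ} {ρ b' Λ : ℝ} (hb' : b' ≤ b)
    (hb'0 : 0 ≤ b') (hρ : lmax * ρ ≤ b' * sig ^ 2) (hRρ : ∀ k, n ≤ k → R k = ρ)
    (hmgf : ∫ ω in B.goodSet lmax Ca R (fun _ => Set.univ) i n,
      Real.exp (expRate lmin lmax sig Ca c * clock Cb d n * ‖B.err n i ω‖ ^ 2) ∂μ ≤ Real.exp Λ)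
    (hl : n ≤ l) :
    ∑ k ∈ Finset.Ico n l,
      μ.real (B.goodSet lmax Ca R (fun _ => Set.univ) i k ∩ {ω | ρ < ‖B.err k i ω‖ ^ 2}) ≤
    Real.exp (Λ + c * d * (48 / 47) * (1.2 * b' + 3.15) -
      expRate lmin lmax sig Ca c * clock Cb d n * ρ) := by
  have hθ := hR.expRate_pos
  have hν := hR.clock_pos n
  have hc := hR.c_pos
  have hQ : ∀ l, MeasurableSet[B.past l] ((fun _ => Set.univ : ℕ → Set Ω) l) :=
    fun l => MeasurableSet.univ
  -- The weight is frozen at its value at n. The invariant adds the accumulated exit probabilities,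
  -- scaled by the exponential at the level ρ, to the moment over paths that have not exited; each
  -- step multiplies it by at most exp of a summable quantity.
  have hstep : ∀ l, n ≤ l →
      (∑ k ∈ Finset.Ico n l,
        μ.real (B.goodSet lmax Ca R (fun _ => Set.univ) i k ∩ {ω | ρ < ‖B.err k i ω‖ ^ 2})) *
        Real.exp (expRate lmin lmax sig Ca c * clock Cb d n * ρ) +
      ∫ ω in B.goodSet lmax Ca R (fun _ => Set.univ) i l,
        Real.exp (expRate lmin lmax sig Ca c * clock Cb d n * ‖B.err l i ω‖ ^ 2) ∂μ ≤
      Real.exp (Λ + ∑ k ∈ Finset.Ico n l,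
        c * d * (clock Cb d n / clock Cb d k ^ 2) * (1.2 * b' + 3.15)) := by
    intro l hl
    induction l, hl using Nat.le_induction with
    | base => simpa using hmgf
    | succ l hl ih =>
      rw [Finset.sum_Ico_succ_top hl, Finset.sum_Ico_succ_top hl]
      have hclock : clock Cb d n ≤ clock Cb d l := by
        unfold clock
        have : (n : ℝ) ≤ l := by exact_mod_cast hl
        linarith
      have hGm := measurableSet_goodSet (lmax := lmax) (Ca := Ca) (R := R) hQ i l
      have hS : MeasurableSet (B.goodSet lmax Ca R (fun _ => Set.univ) i l) :=
        hR.greedy.past_le l _ hGm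
      have hT : MeasurableSet {ω | ρ < ‖B.err l i ω‖ ^ 2} := measurableSet_lt measurable_const
        (measurable_norm_sq_comp (hR.greedy.measurable_err l i))
      have h1 := measureReal_inter_mul_le_setIntegral hS hT
        (hR.integrableOn_exp_goodSet (R := R) hQ i l hν.le hclock)
        (a := Real.exp (expRate lmin lmax sig Ca c * clock Cb d n * ρ)) fun ω hω => by
          have : ρ < ‖B.err l i ω‖ ^ 2 := hω.2
          exact Real.exp_le_exp.2 (by gcongr)
      -- From n on the error bound is ρ itself, so the next good set is the current one without the
      -- exit event, up to truncation.
      have hset : B.goodSet lmax Ca R (fun _ => Set.univ) i (l + 1) =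
          (B.goodSet lmax Ca R (fun _ => Set.univ) i l \ {ω | ρ < ‖B.err l i ω‖ ^ 2}) ∩
          {ω | ‖B.X l ω‖ ^ 2 ≤ truncLevel lmax Ca d l} := by
        rw [goodSet_succ, hRρ l hl, Set.inter_univ]
        congr 1
        ext ω
        simp
      have hdm : MeasurableSet[B.past l] (B.goodSet lmax Ca R (fun _ => Set.univ) i l \
          {ω | ρ < ‖B.err l i ω‖ ^ 2}) := hGm.diff (measurableSet_lt measurable_const
        (measurable_norm_sq_comp (B.measurable_err_past l i)))
      have h2 := hR.setIntegral_exp_le_of_bounded i hdm hb' (fun ω hω => by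
        have : ‖B.err l i ω‖ ^ 2 ≤ ρ := not_lt.1 hω.2
        exact (mul_le_mul_of_nonneg_left this hR.lmax_pos.le).trans hρ) hν.le
        (hclock.trans (by linarith))
      rw [hset, ← add_assoc, Real.exp_add]
      set ε := c * d * (clock Cb d n / clock Cb d l ^ 2) * (1.2 * b' + 3.15) with hε
      have hε1 : 1 ≤ Real.exp ε := Real.one_le_exp (by positivity)
      have hsum0 : 0 ≤ (∑ k ∈ Finset.Ico n l,
        μ.real (B.goodSet lmax Ca R (fun _ => Set.univ) i k ∩ {ω | ρ < ‖B.err k i ω‖ ^ 2})) *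
        Real.exp (expRate lmin lmax sig Ca c * clock Cb d n * ρ) :=
        mul_nonneg (Finset.sum_nonneg fun _ _ => measureReal_nonneg) (Real.exp_pos _).le
      have hP0 : 0 ≤ μ.real (B.goodSet lmax Ca R (fun _ => Set.univ) i l ∩
          {ω | ρ < ‖B.err l i ω‖ ^ 2}) *
          Real.exp (expRate lmin lmax sig Ca c * clock Cb d n * ρ) :=
        mul_nonneg measureReal_nonneg (Real.exp_pos _).le
      rw [add_mul]
      generalize (∑ k ∈ Finset.Ico n l,
        μ.real (B.goodSet lmax Ca R (fun _ => Set.univ) i k ∩ {ω | ρ < ‖B.err k i ω‖ ^ 2})) *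
        Real.exp (expRate lmin lmax sig Ca c * clock Cb d n * ρ) = a1 at *
      generalize μ.real (B.goodSet lmax Ca R (fun _ => Set.univ) i l ∩
          {ω | ρ < ‖B.err l i ω‖ ^ 2}) *
          Real.exp (expRate lmin lmax sig Ca c * clock Cb d n * ρ) = a2 at *
      generalize Real.exp (Λ + ∑ k ∈ Finset.Ico n l,
        c * d * (clock Cb d n / clock Cb d k ^ 2) * (1.2 * b' + 3.15)) = a3 at *
      have h3 : a1 + a2 ≤ Real.exp ε * (a1 + a2) :=
        le_mul_of_one_le_left (add_nonneg hsum0 hP0) hε1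
      have h4 := mul_le_mul_of_nonneg_left (ih.trans' (add_le_add_right h1 a1))
        (Real.exp_pos ε).le
      linarith
  have h1 := hstep l hl
  have h2 : 0 ≤ ∫ ω in B.goodSet lmax Ca R (fun _ => Set.univ) i l,
        Real.exp (expRate lmin lmax sig Ca c * clock Cb d n * ‖B.err l i ω‖ ^ 2) ∂μ :=
    integral_nonneg fun ω => (Real.exp_pos _).le
  have h3 : ∑ k ∈ Finset.Ico n l,
        c * d * (clock Cb d n / clock Cb d k ^ 2) * (1.2 * b' + 3.15) ≤
      c * d * (48 / 47) * (1.2 * b' + 3.15) := by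
    have h4 := hR.sum_inv_clock_sq_le hl
    have h5 := hR.clock_ge n
    have h6 : 0 ≤ 1 / (clock Cb d l - 1) := by
      have := hR.clock_ge l
      exact div_nonneg zero_le_one (by linarith)
    -- The value 48/47 is that of n/(n - 1) at n = 48.
    have h7 : clock Cb d n * ∑ k ∈ Finset.Ico n l, 1 / clock Cb d k ^ 2 ≤ 48 / 47 := by
      calc _ ≤ clock Cb d n * (1 / (clock Cb d n - 1)) := by gcongr; linarith
        _ ≤ 48 / 47 := by
          rw [mul_one_div, div_le_div_iff₀ (by linarith) (by norm_num)]
          linarith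
    calc _ = c * d * (clock Cb d n * ∑ k ∈ Finset.Ico n l, 1 / clock Cb d k ^ 2) *
        (1.2 * b' + 3.15) := by
          rw [Finset.mul_sum, Finset.mul_sum, Finset.sum_mul]
          refine Finset.sum_congr rfl fun k _ => ?_
          ring
      _ ≤ _ := by gcongr
  rw [Real.exp_sub, le_div_iff₀ (Real.exp_pos _)]
  have h8 : Real.exp (Λ + ∑ k ∈ Finset.Ico n l,
        c * d * (clock Cb d n / clock Cb d k ^ 2) * (1.2 * b' + 3.15)) ≤
      Real.exp (Λ + c * d * (48 / 47) * (1.2 * b' + 3.15)) := Real.exp_le_exp.2 (by linarith)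
  linarith

theorem measureReal_truncLevel_lt_le (hR : B.TunedRun μ p lmin lmax sig Ca Cb c b) (t : ℕ) :
    μ.real {ω | truncLevel lmax Ca d t < ‖B.X t ω‖ ^ 2} ≤ Real.exp (-(c * (d + t / Ca))) := by
  have := hR.neZero_dim
  have hCa := hR.Ca_pos
  have ht : 0 ≤ (t : ℝ) / Ca := by positivity
  have h1 := (hR.cov.subGaussian t).measure_norm_sq_gt_le (hR.greedy.past_le t)
    (hR.greedy.measurable_X t) hR.lmax_pos ht
  refine h1.trans (Real.exp_le_exp.2 ?_)
  have h2 := hR.c_le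
  have h3 := hR.one_le_dim
  nlinarith

end TunedRun

end Bandit

/-! ### Calibration of the radius and the union bounds -/

theorem one_sub_le_measureReal_of_compl_subset {Ω : Type*} [MeasurableSpace Ω] {μ : Measure Ω}
    [IsProbabilityMeasure μ] {S T : Set Ω} (h : Sᶜ ⊆ T) {e : ℝ} (hT : μ.real T ≤ e) :
    1 - e ≤ μ.real S := by
  have h1 := measureReal_union_le (μ := μ) S Sᶜ
  rw [Set.union_compl_self, probReal_univ] at h1
  linarith [measureReal_mono (μ := μ) h]

namespace Bandit

variable {Ω : Type*} [m0 : MeasurableSpace Ω] {d K : ℕ}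

/-- The squared radius `C^* (d + x) σ² / (lmin (t + C_b d))` with `C = 20`. -/
def radius (lmin lmax sig Ca Cb : ℝ) (d : ℕ) (x : ℝ) (t : ℕ) : ℝ :=
  cStar 20 Ca Cb lmin lmax / lmin * ((d + x) / clock Cb d t) * sig ^ 2

/-- The dimensionless ratio `C_b lmin² / (lmax² C_a²)`, the size of the initial error. -/
def initRatio (lmin lmax Ca Cb : ℝ) : ℝ := Cb * lmin ^ 2 / (lmax ^ 2 * Ca ^ 2)

variable {B : Bandit Ω d K} {μ : Measure Ω} [IsProbabilityMeasure μ] {p δ : ℕ → ℝ}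
  {lmin lmax sig Ca Cb c b : ℝ}

/-- A unit lower bound on the second moments forces some arm to be optimal. -/
theorem ArmOptimality.nonempty {h : ℝ} {A : Finset (Fin K)} (hA : B.ArmOptimality μ lmin h A)
    (hgreedy : B.IsEpsGreedy μ p) (hcov : B.CovariateAssumption μ lmin lmax) (hlmin : 0 < lmin)
    (hlmax : 0 < lmax) (hh : 0 < h) (hd : 1 ≤ d) (hK : 1 ≤ K) : A.Nonempty := by
  by_contra hne
  rw [Finset.not_nonempty_iff_eq_empty] at hne
  have : NeZero d := ⟨by omega⟩
  have : NeZero K := ⟨by omega⟩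
  have hXm := hgreedy.measurable_X 0
  have hae : ∀ j, ∀ᵐ ω ∂μ, ω ∈ {ω | ∃ i, h * ‖B.X 0 ω‖ ≤
      inner ℝ (B.X 0 ω) (B.betaStar i) - inner ℝ (B.X 0 ω) (B.betaStar j)} := fun j => by
    have hS : MeasurableSet {ω | ∃ i, h * ‖B.X 0 ω‖ ≤
        inner ℝ (B.X 0 ω) (B.betaStar i) - inner ℝ (B.X 0 ω) (B.betaStar j)} := by
      rw [Set.ofPred_exists]
      exact MeasurableSet.iUnion fun i => measurableSet_le (by fun_prop) (by fun_prop)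
    have h1 := integral_congr_ae (hA.suboptimal 0 j (by simp [hne]))
    rw [integral_condExp (hgreedy.past_le 0), integral_indicator_const _ hS, smul_eq_mul, mul_one] at h1
    simp only [integral_const, probReal_univ, one_smul] at h1
    rw [measureReal_def, ENNReal.toReal_eq_one_iff] at h1
    exact (mem_ae_iff_prob_eq_one hS).2 h1
  -- Were no arm optimal, even the best arm at X₀ would be beaten by h ‖X₀‖, which forces X₀ = 0 and
  -- contradicts the second moment bound.
  have hX0 : ∀ᵐ ω ∂μ, B.X 0 ω = 0 := by
    filter_upwards [ae_all_iff.2 hae] with ω hω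
    obtain ⟨j, hj⟩ := Finite.exists_max fun j => inner ℝ (B.X 0 ω) (B.betaStar j)
    obtain ⟨i, hi⟩ := hω j
    have h1 := hj i
    by_contra h0
    have := mul_pos hh (norm_pos_iff.2 h0)
    linarith
  obtain ⟨-, h2⟩ := mul_integral_norm_sq_le_of_condGram (hgreedy.past_le 0) hXm hlmax
    (hcov.subGaussian 0) MeasurableSet.univ (hcov.second_moment 0)
    (e := fun _ => EuclideanSpace.single 0 1) measurable_const (v := fun _ => 1) measurable_const
    (by simp) (c := 1) (by simp)
  have h3 : ∫ ω, (1 : ℝ) * Set.univ.indicator (fun x => inner ℝ x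
      (EuclideanSpace.single (0 : Fin d) (1 : ℝ)) ^ 2) (B.X 0 ω) ∂μ = 0 :=
    integral_eq_zero_of_ae (hX0.mono fun ω hω => by simp [hω])
  rw [h3] at h2
  simp at h2
  linarith

namespace TunedRun

theorem cStar_div_pos (hR : B.TunedRun μ p lmin lmax sig Ca Cb c b) :
    0 < cStar 20 Ca Cb lmin lmax / lmin := by
  have := hR.Cb_pos
  have := hR.Ca_pos
  have := hR.lmin_pos
  have := hR.lmax_pos
  unfold cStar; positivity

theorem initRatio_nonneg (hR : B.TunedRun μ p lmin lmax sig Ca Cb c b) :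
    0 ≤ initRatio lmin lmax Ca Cb := by
  have := hR.Cb_pos
  unfold initRatio; positivity

/-- In the units of the exponential moment the radius reads c (20 + r)(d + x), with r the initial
ratio. The moment bound is Λ = c (4 + r) d, so the two summands of C^* cover noise and initial
error. -/
theorem expRate_mul_clock_mul_radius (hR : B.TunedRun μ p lmin lmax sig Ca Cb c b) (x : ℝ) (t : ℕ) :
    expRate lmin lmax sig Ca c * clock Cb d t * radius lmin lmax sig Ca Cb d x t =
      c * (20 + initRatio lmin lmax Ca Cb) * (d + x) := by
  have := (hR.clock_pos t).ne'
  have := hR.lmin_pos.ne'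
  have := hR.lmax_pos.ne'
  have := hR.sig_pos.ne'
  have := hR.Ca_pos.ne'
  unfold expRate radius initRatio cStar
  field_simp

/-- The constant is 23/3 = 20/3 + 1, because C_a² λ_max²/λ_min² ≤ C_b/3. -/
theorem lmax_mul_radius_le (hR : B.TunedRun μ p lmin lmax sig Ca Cb c b) {x a : ℝ} {t : ℕ}
    (hx : 0 ≤ x) (ha : Cb * (d + x) ≤ a * clock Cb d t) :
    lmax * radius lmin lmax sig Ca Cb d x t ≤ 23 / 3 * a * sig ^ 2 := by
  have hn := hR.clock_pos t
  have hl := hR.lmin_pos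
  have hL := hR.lmax_pos
  have h1 := hR.Cb_ge
  have e : lmax * radius lmin lmax sig Ca Cb d x t =
      (20 * Ca ^ 2 * (lmax ^ 2 / lmin ^ 2) + Cb) * ((d + x) / clock Cb d t) * sig ^ 2 := by
    unfold radius cStar; field_simp
  rw [e]
  refine mul_le_mul_of_nonneg_right ?_ (sq_nonneg _)
  have h2 : Cb * ((d + x) / clock Cb d t) ≤ a := by
    rw [mul_div_assoc', div_le_iff₀ hn]; exact ha
  have h3 : 0 ≤ (d + x) / clock Cb d t := by positivity
  calc _ ≤ (23 / 3 * Cb) * ((d + x) / clock Cb d t) := by gcongr; linarith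
    _ = 23 / 3 * (Cb * ((d + x) / clock Cb d t)) := by ring
    _ ≤ _ := by gcongr

theorem expRate_mul_init_le (hR : B.TunedRun μ p lmin lmax sig Ca Cb c b) {i : Fin K}
    (hi : ‖B.betaInit i - B.betaStar i‖ ^ 2 ≤ sig ^ 2 / lmax) :
    expRate lmin lmax sig Ca c * clock Cb d 0 * ‖B.betaInit i - B.betaStar i‖ ^ 2 ≤
      c * (4 + initRatio lmin lmax Ca Cb) * d := by
  have hθ := hR.expRate_pos
  have hn := hR.clock_pos 0
  have hc := hR.c_pos
  have := hR.lmin_pos.ne'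
  have := hR.lmax_pos.ne'
  have := hR.sig_pos.ne'
  have := hR.Ca_pos.ne'
  have e : expRate lmin lmax sig Ca c * clock Cb d 0 * (sig ^ 2 / lmax) =
      c * initRatio lmin lmax Ca Cb * d := by
    unfold expRate clock initRatio; simp only [Nat.cast_zero, zero_add]; field_simp
  calc _ ≤ expRate lmin lmax sig Ca c * clock Cb d 0 * (sig ^ 2 / lmax) := by gcongr
    _ = c * initRatio lmin lmax Ca Cb * d := e
    _ ≤ _ := by
      have : 0 ≤ c * d := by positivity
      nlinarith

theorem init_le_radius (hR : B.TunedRun μ p lmin lmax sig Ca Cb c b) {i : Fin K}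
    (hi : ‖B.betaInit i - B.betaStar i‖ ^ 2 ≤ sig ^ 2 / lmax) {x : ℝ} (hx : 0 ≤ x) :
    ‖B.betaInit i - B.betaStar i‖ ^ 2 ≤ radius lmin lmax sig Ca Cb d x 0 := by
  refine hi.trans ?_
  have hCb := hR.Cb_pos
  have hl := hR.lmin_pos
  have hL := hR.lmax_pos
  have hCa := hR.Ca_pos
  have hd := hR.one_le_dim
  have h1 : Cb / lmax ≤ cStar 20 Ca Cb lmin lmax / lmin := by
    have : cStar 20 Ca Cb lmin lmax / lmin = 20 * Ca ^ 2 * (lmax / lmin) / lmin + Cb / lmax := by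
      unfold cStar; field_simp
    rw [this]
    have : 0 ≤ 20 * Ca ^ 2 * (lmax / lmin) / lmin := by positivity
    linarith
  have h2 : 1 / Cb ≤ (d + x) / clock Cb d 0 := by
    rw [div_le_div_iff₀ hCb (hR.clock_pos 0)]
    unfold clock
    push_cast
    nlinarith
  calc sig ^ 2 / lmax = Cb / lmax * (1 / Cb) * sig ^ 2 := by field_simp
    _ ≤ _ := by
      unfold radius
      have := hR.cStar_div_pos
      gcongr

/-- The growth condition on δ keeps the target radius of order σ²/λ_max at all times, as the
one-step bounds require. -/
theorem lmax_mul_radius_le_of_le (hR : B.TunedRun μ p lmin lmax sig Ca Cb c b) {C₀ x : ℝ} {t : ℕ}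
    (hC : 0 ≤ C₀) (hb : 23 / 3 * (1 + C₀) ≤ b) (hx : 0 ≤ x) (hx' : x ≤ C₀ * t / Cb) :
    lmax * radius lmin lmax sig Ca Cb d x t ≤ b * sig ^ 2 := by
  have hCb := hR.Cb_pos
  refine (hR.lmax_mul_radius_le hx (a := 1 + C₀) ?_).trans (by gcongr)
  rw [le_div_iff₀ hCb] at hx'
  have h1 : (0 : ℝ) ≤ t := Nat.cast_nonneg t
  have h2 : 0 ≤ C₀ * (Cb * d) := by positivity
  unfold clock
  linarith

omit m0 in
theorem measurableSet_past_univ (B : Bandit Ω d K) (l : ℕ) :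
    MeasurableSet[B.past l] ((fun _ => Set.univ : ℕ → Set Ω) l) := MeasurableSet.univ

/-- Exponential moments during exploration. -/
theorem setIntegral_exp_le_of_exploration (hR : B.TunedRun μ p lmin lmax sig Ca Cb c b)
    {R : ℕ → ℝ} (i : Fin K) (hRb : ∀ l, lmax * R l ≤ b * sig ^ 2) {n : ℕ}
    (hp : ∀ s < n, 2 / Ca ≤ p s / K)
    (hi : ‖B.betaInit i - B.betaStar i‖ ^ 2 ≤ sig ^ 2 / lmax) {t : ℕ} (ht : t ≤ n) :
    ∫ ω in B.goodSet lmax Ca R (fun _ => Set.univ) i t,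
      Real.exp (expRate lmin lmax sig Ca c * clock Cb d t * ‖B.err t i ω‖ ^ 2) ∂μ ≤
      Real.exp (c * (4 + initRatio lmin lmax Ca Cb) * d) := by
  refine hR.setIntegral_exp_goodSet_le (measurableSet_past_univ B) i hRb ?_
    (hR.expRate_mul_init_le hi) (fun l hl S hS _ hSR s hs =>
      hR.drift_of_exploration i (hp l hl) hS hSR hs) ht
  have h1 := hR.initRatio_nonneg
  have h2 := hR.c_pos
  have : 0 ≤ c * d * initRatio lmin lmax Ca Cb := by positivity
  linarith

/-- Exponential moments for an optimal arm with exploration before time `n` and accurate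
estimates of all arms afterwards. -/
theorem setIntegral_exp_le_of_accuracy (hR : B.TunedRun μ p lmin lmax sig Ca Cb c b) {h ρ : ℝ}
    {A : Finset (Fin K)} (hA : B.ArmOptimality μ lmin h A) {i : Fin K} (hiA : i ∈ A)
    (hK : 2 / Ca ≤ 1 / K) (hh : 0 < h) (hρ : 8 * ρ ≤ h ^ 2)
    {R : ℕ → ℝ} (hRb : ∀ l, lmax * R l ≤ b * sig ^ 2) {n : ℕ}
    (hp : ∀ s < n, 2 / Ca ≤ p s / K)
    (hi : ‖B.betaInit i - B.betaStar i‖ ^ 2 ≤ sig ^ 2 / lmax) (t : ℕ)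
    {Q : ℕ → Set Ω} (hQm : ∀ l, MeasurableSet[B.past l] (Q l))
    (hQ : ∀ l, n ≤ l → ∀ ω ∈ Q l, ∀ j, ‖B.err l j ω‖ ^ 2 ≤ ρ) :
    ∫ ω in B.goodSet lmax Ca R Q i t,
      Real.exp (expRate lmin lmax sig Ca c * clock Cb d t * ‖B.err t i ω‖ ^ 2) ∂μ ≤
      Real.exp (c * (4 + initRatio lmin lmax Ca Cb) * d) := by
  refine hR.setIntegral_exp_goodSet_le hQm i hRb ?_
    (hR.expRate_mul_init_le hi) (fun l hl S hS hSQ hSR s hs => ?_) le_rfl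
  · have h1 := hR.initRatio_nonneg
    have h2 := hR.c_pos
    have : 0 ≤ c * d * initRatio lmin lmax Ca Cb := by positivity
    linarith
  rcases lt_or_ge l n with hln | hln
  · exact hR.drift_of_exploration i (hp l hln) hS hSR hs
  · refine hR.drift_of_accuracy hA hiA hK hS hSR (fun ω hω j => ?_) hs
    have h1 := hQ l hln ω (hSQ hω) j
    refine lt_of_pow_lt_pow_left₀ 2 (by positivity) ?_
    nlinarith [pow_pos hh 2]

/-- The exponent is Λ - c (20 + r)(d + x) ≤ -16cd - 20cx: the initial contribution cancels and more
than c (d + x) is left. -/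
theorem measureReal_goodSet_radius_lt_le (hR : B.TunedRun μ p lmin lmax sig Ca Cb c b)
    {R : ℕ → ℝ} {Q : ℕ → Set Ω} (hQ : ∀ l, MeasurableSet[B.past l] (Q l)) (i : Fin K)
    {t : ℕ} (hmgf : ∫ ω in B.goodSet lmax Ca R Q i t,
      Real.exp (expRate lmin lmax sig Ca c * clock Cb d t * ‖B.err t i ω‖ ^ 2) ∂μ ≤
      Real.exp (c * (4 + initRatio lmin lmax Ca Cb) * d)) {x : ℝ} (hx : 0 ≤ x) :
    μ.real (B.goodSet lmax Ca R Q i t ∩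
      {ω | radius lmin lmax sig Ca Cb d x t < ‖B.err t i ω‖ ^ 2}) ≤
      Real.exp (-(c * (d + x))) := by
  refine (hR.measureReal_goodSet_gt_le hQ i hmgf _).trans (Real.exp_le_exp.2 ?_)
  rw [hR.expRate_mul_clock_mul_radius]
  have h1 := hR.initRatio_nonneg
  have h2 := hR.c_pos
  have h3 : 0 ≤ c * x * initRatio lmin lmax Ca Cb := by positivity
  have h4 : 0 ≤ c * x := by positivity
  have h5 : 0 ≤ c * d := by positivity
  linarith

theorem sum_measureReal_truncLevel_lt_le (hR : B.TunedRun μ p lmin lmax sig Ca Cb c b)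
    (I : Finset ℕ) : μ.real (⋃ l ∈ I, {ω | truncLevel lmax Ca d l < ‖B.X l ω‖ ^ 2}) ≤
      ∑ l ∈ I, Real.exp (-(c * (d + l / Ca))) :=
  (measureReal_biUnion_finset_le _ _).trans
    (Finset.sum_le_sum fun l _ => hR.measureReal_truncLevel_lt_le l)

/-- The error bound for all arms when exploration persists. -/
theorem exploration_bound (hR : B.TunedRun μ p lmin lmax sig Ca Cb c b) {C₀ : ℝ} (hC : 0 ≤ C₀)
    (hb : 23 / 3 * (1 + C₀) ≤ b) (hK1 : 1 ≤ K)
    (hi : ∀ i, ‖B.betaInit i - B.betaStar i‖ ^ 2 ≤ sig ^ 2 / lmax)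
    (hδ0 : ∀ t, 0 ≤ δ t) (hδ : ∀ t : ℕ, δ t ≤ C₀ * t / Cb)
    (hp : ∀ s, 2 / Ca ≤ p s / K) (t : ℕ) :
    1 - K * tailSum c Ca d δ (Finset.Icc 0 t) ≤
      μ.real {ω | ∀ i, ‖B.err t i ω‖ ^ 2 ≤ radius lmin lmax sig Ca Cb d (δ t) t} := by
  set R : ℕ → ℝ := fun l => radius lmin lmax sig Ca Cb d (δ l) l with hRd
  have hRb : ∀ l, lmax * R l ≤ b * sig ^ 2 := fun l =>
    hR.lmax_mul_radius_le_of_le hC hb (hδ0 l) (hδ l)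
  set T : Set Ω := ⋃ l ∈ Finset.range t, {ω | truncLevel lmax Ca d l < ‖B.X l ω‖ ^ 2} with hT
  set G : Fin K → ℕ → Set Ω := fun i l => B.goodSet lmax Ca R (fun _ => Set.univ) i l ∩
    {ω | R l < ‖B.err l i ω‖ ^ 2} with hG
  refine one_sub_le_measureReal_of_compl_subset
    (T := T ∪ ⋃ i ∈ (Finset.univ : Finset (Fin K)), ⋃ l ∈ Finset.range (t + 1), G i l) ?_ ?_
  · intro ω hω
    by_contra hcon
    refine hω ?_
    simp only [hT, hG, Set.mem_union, Set.mem_iUnion, Finset.mem_range, Finset.mem_univ,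
      Set.mem_ofPred_eq, Set.mem_inter_iff, exists_prop, true_and, not_or, not_exists, not_and,
      not_lt] at hcon
    intro i
    -- Off the bad events, the bounds before l place the path in the good set at l, and so the bound
    -- holds at l.
    have key : ∀ l ≤ t, ‖B.err l i ω‖ ^ 2 ≤ R l := by
      intro l
      induction l using Nat.strong_induction_on with
      | _ l ih =>
        intro hl
        exact hcon.2 i l (by omega) fun k hk => ⟨hcon.1 k (by omega), ih k hk (by omega), trivial⟩
    exact key t le_rfl
  · have hG1 : ∀ i l, μ.real (G i l) ≤ Real.exp (-(c * (d + δ l))) := fun i l =>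
      hR.measureReal_goodSet_radius_lt_le (measurableSet_past_univ B) i
        (hR.setIntegral_exp_le_of_exploration i hRb (n := l) (fun s _ => hp s) (hi i) le_rfl)
        (hδ0 l)
    have hG2 : μ.real (⋃ i ∈ (Finset.univ : Finset (Fin K)), ⋃ l ∈ Finset.range (t + 1), G i l) ≤
        K * ∑ l ∈ Finset.range (t + 1), Real.exp (-(c * (d + δ l))) := by
      calc _ ≤ ∑ i : Fin K, ∑ l ∈ Finset.range (t + 1), μ.real (G i l) :=
            (measureReal_biUnion_finset_le _ _).trans
              (Finset.sum_le_sum fun i _ => measureReal_biUnion_finset_le _ _)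
        _ ≤ ∑ _i : Fin K, ∑ l ∈ Finset.range (t + 1), Real.exp (-(c * (d + δ l))) :=
            Finset.sum_le_sum fun i _ => Finset.sum_le_sum fun l _ => hG1 i l
        _ = _ := by simp
    have hK1' : (1 : ℝ) ≤ K := by exact_mod_cast hK1
    have hT1 := hR.sum_measureReal_truncLevel_lt_le (Finset.range t)
    have hT2 : ∑ l ∈ Finset.range t, Real.exp (-(c * (d + l / Ca))) ≤
        ∑ l ∈ Finset.Icc 0 t, Real.exp (-(c * (d + l / Ca))) :=
      Finset.sum_le_sum_of_subset_of_nonneg (fun l hl => by simp at hl ⊢; omega)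
        fun _ _ _ => (Real.exp_pos _).le
    have hT3 : ∑ l ∈ Finset.Icc 0 t, Real.exp (-(c * (d + l / Ca))) ≤
        K * ∑ l ∈ Finset.Icc 0 t, Real.exp (-(c * (d + l / Ca))) :=
      le_mul_of_one_le_left (Finset.sum_nonneg fun _ _ => (Real.exp_pos _).le) hK1'
    have hr : Finset.range (t + 1) = Finset.Icc 0 t := by ext l; simp
    rw [hr] at hG2
    have := measureReal_union_le (μ := μ) T
      (⋃ i ∈ (Finset.univ : Finset (Fin K)), ⋃ l ∈ Finset.range (t + 1), G i l)
    rw [hr] at this ⊢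
    unfold tailSum
    rw [mul_add]
    linarith

/-- The error bound for the optimal arms when exploration stops after the arms are separated. -/
theorem exploitation_bound (hR : B.TunedRun μ p lmin lmax sig Ca Cb c b) {C₀ h : ℝ} (hC : 0 ≤ C₀)
    (hb : 23 / 3 * (1 + C₀) ≤ b) (hb2 : 46 / 3 ≤ b) (hK1 : 1 ≤ K)
    (hi : ∀ i, ‖B.betaInit i - B.betaStar i‖ ^ 2 ≤ sig ^ 2 / lmax)
    (hδ0 : ∀ t, 0 ≤ δ t) (hδ : ∀ t : ℕ, δ t ≤ C₀ * t / Cb)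
    {A : Finset (Fin K)} (hA : B.ArmOptimality μ lmin h A) (hAne : A.Nonempty) (hh : 0 < h)
    (hK : 2 / Ca ≤ 1 / K) {n : ℕ} (hp : ∀ s < n, 2 / Ca ≤ p s / K)
    (hn : 16 * radius lmin lmax sig Ca Cb d 0 n ≤ h ^ 2) {t : ℕ} (hnt : n ≤ t) :
    1 - K * tailSum c Ca d δ (Finset.Icc 0 n) - A.card * tailSum c Ca d δ (Finset.Icc n (t + 1)) ≤
      μ.real {ω | (∀ i ∈ A, ‖B.err t i ω‖ ^ 2 ≤ radius lmin lmax sig Ca Cb d (δ t) t) ∧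
        ∀ i, ‖B.err t i ω‖ ^ 2 ≤ 2 * radius lmin lmax sig Ca Cb d 0 n} := by
  set R : ℕ → ℝ := fun l => radius lmin lmax sig Ca Cb d (δ l) l with hRd
  set ρ := 2 * radius lmin lmax sig Ca Cb d 0 n with hρd
  have hRb : ∀ l, lmax * R l ≤ b * sig ^ 2 := fun l =>
    hR.lmax_mul_radius_le_of_le hC hb (hδ0 l) (hδ l)
  have hρ1 : lmax * ρ ≤ 46 / 3 * sig ^ 2 := by
    have := hR.lmax_mul_radius_le le_rfl (a := 1) (x := 0) (t := n)
      (by rw [add_zero, one_mul]; exact Cb_mul_dim_le_clock Cb d n)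
    rw [hρd]; linarith
  -- Two families of good sets are needed. The bounds `R'`, constant from n on, track all arms
  -- without drift. The bounds `R` with the side events `Q`, accuracy of all arms from n on, track
  -- the optimal arms with drift.
  set R' : ℕ → ℝ := fun l => if l < n then R l else ρ with hR'
  have hR'b : ∀ l, lmax * R' l ≤ b * sig ^ 2 := fun l => by
    simp only [hR']
    split_ifs
    · exact hRb l
    · exact hρ1.trans (by gcongr)
  have hR'ρ : ∀ k, n ≤ k → R' k = ρ := fun k hk => if_neg (not_lt.2 hk)
  set Q : ℕ → Set Ω := fun l => if n ≤ l then {ω | ∀ j, ‖B.err l j ω‖ ^ 2 ≤ ρ} else Set.univ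
    with hQ
  have hQm : ∀ l, MeasurableSet[B.past l] (Q l) := fun l => by
    simp only [hQ]
    split_ifs
    · have : {ω | ∀ j, ‖B.err l j ω‖ ^ 2 ≤ ρ} = ⋂ j, {ω | ‖B.err l j ω‖ ^ 2 ≤ ρ} := by
        ext ω; simp
      rw [this]
      exact MeasurableSet.iInter fun j => measurableSet_le
        (measurable_norm_sq_comp (B.measurable_err_past l j)) measurable_const
    · exact MeasurableSet.univ
  set T : Set Ω := ⋃ l ∈ Finset.range t, {ω | truncLevel lmax Ca d l < ‖B.X l ω‖ ^ 2} with hT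
  set G1 : Fin K → ℕ → Set Ω := fun i l => B.goodSet lmax Ca R' (fun _ => Set.univ) i l ∩
    {ω | R l < ‖B.err l i ω‖ ^ 2} with hG1
  set G2 : Fin K → ℕ → Set Ω := fun i l => B.goodSet lmax Ca R' (fun _ => Set.univ) i l ∩
    {ω | ρ < ‖B.err l i ω‖ ^ 2} with hG2
  set G3 : Fin K → ℕ → Set Ω := fun i l => B.goodSet lmax Ca R Q i l ∩
    {ω | R l < ‖B.err l i ω‖ ^ 2} with hG3
  -- Time 0 is left out because the initial error satisfies the bound deterministically. Its term
  -- exp(-cd) in the stated sum is saved for `U2`.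
  set U1 := ⋃ i ∈ (Finset.univ : Finset (Fin K)), ⋃ l ∈ Finset.Ico 1 n, G1 i l with hU1
  set U2 := ⋃ i ∈ (Finset.univ : Finset (Fin K)), ⋃ l ∈ Finset.Ico n (t + 1), G2 i l with hU2
  set U3 := ⋃ i ∈ A, ⋃ l ∈ Finset.Ico n (t + 1), G3 i l with hU3
  rw [sub_sub]
  refine one_sub_le_measureReal_of_compl_subset (T := T ∪ U1 ∪ U2 ∪ U3) ?_ ?_
  · intro ω hω
    by_contra hcon
    refine hω ?_
    simp only [hT, hU1, hU2, hU3, hG1, hG2, hG3, Set.mem_union, Set.mem_iUnion, Finset.mem_range,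
      Finset.mem_univ, Finset.mem_Ico,
      Set.mem_ofPred_eq, Set.mem_inter_iff, exists_prop, true_and, not_or, not_exists, not_and,
      not_lt, and_imp] at hcon
    obtain ⟨⟨⟨c0, c1⟩, c2⟩, c3⟩ := hcon
    have key1 : ∀ l ≤ t, ∀ j, ‖B.err l j ω‖ ^ 2 ≤ R' l := by
      intro l
      induction l using Nat.strong_induction_on with
      | _ l ih =>
        intro hl j
        have hg : ω ∈ B.goodSet lmax Ca R' (fun _ => Set.univ) j l := fun k hk =>
          ⟨c0 k (by omega), ih k hk (by omega) j, trivial⟩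
        simp only [hR']
        split_ifs with hln
        · rcases Nat.eq_zero_or_pos l with rfl | hl0
          · exact hR.init_le_radius (hi j) (hδ0 0)
          · exact c1 j l hl0 hln hg
        · exact c2 j l (by omega) (by omega) hg
    -- The accuracy of all arms in `key1` supplies the side events `Q`, on which the sharper bound
    -- for optimal arms rests.
    have key2 : ∀ l ≤ t, ∀ j ∈ A, ‖B.err l j ω‖ ^ 2 ≤ R l := by
      intro l
      induction l using Nat.strong_induction_on with
      | _ l ih =>
        intro hl j hj
        rcases lt_or_ge l n with hln | hln
        · have := key1 l hl j
          rwa [show R' l = R l from if_pos hln] at this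
        · refine c3 j hj l hln (by omega) fun k hk => ⟨c0 k (by omega), ih k hk (by omega) j hj, ?_⟩
          simp only [hQ]
          split_ifs with hnk
          · intro j'
            have := key1 k (by omega) j'
            rwa [hR'ρ k hnk] at this
          · trivial
    refine ⟨key2 t le_rfl, fun j => ?_⟩
    have := key1 t le_rfl j
    rwa [hR'ρ t hnt] at this
  · have hc := hR.c_pos
    have hmgf : ∀ i, ∀ l ≤ n, ∫ ω in B.goodSet lmax Ca R' (fun _ => Set.univ) i l,
        Real.exp (expRate lmin lmax sig Ca c * clock Cb d l * ‖B.err l i ω‖ ^ 2) ∂μ ≤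
        Real.exp (c * (4 + initRatio lmin lmax Ca Cb) * d) := fun i l hl =>
      hR.setIntegral_exp_le_of_exploration i hR'b hp (hi i) hl
    have b1 : μ.real U1 ≤ K * ∑ l ∈ Finset.Ico 1 n, Real.exp (-(c * (d + δ l))) := by
      calc _ ≤ ∑ i : Fin K, ∑ l ∈ Finset.Ico 1 n, μ.real (G1 i l) :=
            (measureReal_biUnion_finset_le _ _).trans
              (Finset.sum_le_sum fun i _ => measureReal_biUnion_finset_le _ _)
        _ ≤ ∑ _i : Fin K, ∑ l ∈ Finset.Ico 1 n, Real.exp (-(c * (d + δ l))) :=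
            Finset.sum_le_sum fun i _ => Finset.sum_le_sum fun l hl =>
              hR.measureReal_goodSet_radius_lt_le (measurableSet_past_univ B) i
                (hmgf i l (Finset.mem_Ico.1 hl).2.le) (hδ0 l)
        _ = _ := by simp
    have b2 : μ.real U2 ≤ K * Real.exp (-(c * d)) := by
      calc _ ≤ ∑ i : Fin K, ∑ l ∈ Finset.Ico n (t + 1), μ.real (G2 i l) :=
            (measureReal_biUnion_finset_le _ _).trans
              (Finset.sum_le_sum fun i _ => measureReal_biUnion_finset_le _ _)
        _ ≤ ∑ _i : Fin K, Real.exp (-(c * d)) := Finset.sum_le_sum fun i _ => by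
            refine (hR.sum_measureReal_goodSet_gt_le i hb2 (by norm_num) hρ1 hR'ρ
              (hmgf i n le_rfl) (by omega)).trans (Real.exp_le_exp.2 ?_)
            -- The budget in units of cd: the level gives 2(20 + r), the moment at n costs 4 + r,
            -- and the drift-free growth costs (48/47)(1.2 · 46/3 + 3.15) < 23. More than 1 remains.
            have e : expRate lmin lmax sig Ca c * clock Cb d n * ρ =
                2 * (c * (20 + initRatio lmin lmax Ca Cb) * (d + 0)) := by
              rw [← hR.expRate_mul_clock_mul_radius, hρd]; ring
            rw [e]
            have h1 : 0 ≤ c * d * initRatio lmin lmax Ca Cb := by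
              have := hR.initRatio_nonneg
              positivity
            have h2 : 0 ≤ c * d := by positivity
            linarith
        _ = _ := by simp
    have b3 : μ.real U3 ≤ A.card * ∑ l ∈ Finset.Ico n (t + 1), Real.exp (-(c * (d + δ l))) := by
      calc _ ≤ ∑ i ∈ A, ∑ l ∈ Finset.Ico n (t + 1), μ.real (G3 i l) :=
            (measureReal_biUnion_finset_le _ _).trans
              (Finset.sum_le_sum fun i _ => measureReal_biUnion_finset_le _ _)
        _ ≤ ∑ _i ∈ A, ∑ l ∈ Finset.Ico n (t + 1), Real.exp (-(c * (d + δ l))) :=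
            Finset.sum_le_sum fun i hiA => Finset.sum_le_sum fun l hl =>
              hR.measureReal_goodSet_radius_lt_le hQm i
                (hR.setIntegral_exp_le_of_accuracy (ρ := ρ) hA hiA hK hh (by rw [hρd]; linarith) hRb hp
                  (hi i) l hQm fun k hk ω hω => by
                    simp only [hQ, if_pos hk] at hω
                    exact hω) (hδ0 l)
        _ = _ := by simp
    have b0 := hR.sum_measureReal_truncLevel_lt_le (Finset.range t)
    have hK1' : (1 : ℝ) ≤ K := by exact_mod_cast hK1
    have hA1 : (1 : ℝ) ≤ A.card := by exact_mod_cast hAne.card_pos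
    have b0' : ∑ l ∈ Finset.range t, Real.exp (-(c * (d + l / Ca))) ≤
        K * ∑ l ∈ Finset.Icc 0 n, Real.exp (-(c * (d + l / Ca))) +
        A.card * ∑ l ∈ Finset.Icc n (t + 1), Real.exp (-(c * (d + l / Ca))) := by
      have hpos : ∀ I : Finset ℕ, 0 ≤ ∑ l ∈ I, Real.exp (-(c * (d + l / Ca))) := fun I =>
        Finset.sum_nonneg fun _ _ => (Real.exp_pos _).le
      have h1 : ∑ l ∈ Finset.range t, Real.exp (-(c * (d + l / Ca))) =
          ∑ l ∈ Finset.Ico 0 n, Real.exp (-(c * (d + l / Ca))) +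
          ∑ l ∈ Finset.Ico n t, Real.exp (-(c * (d + l / Ca))) := by
        rw [Finset.range_eq_Ico, Finset.sum_Ico_consecutive _ (Nat.zero_le n) hnt]
      have h2 : ∑ l ∈ Finset.Ico 0 n, Real.exp (-(c * (d + l / Ca))) ≤
          ∑ l ∈ Finset.Icc 0 n, Real.exp (-(c * (d + l / Ca))) :=
        Finset.sum_le_sum_of_subset_of_nonneg Finset.Ico_subset_Icc_self
          fun _ _ _ => (Real.exp_pos _).le
      have h3 : ∑ l ∈ Finset.Ico n t, Real.exp (-(c * (d + l / Ca))) ≤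
          ∑ l ∈ Finset.Icc n (t + 1), Real.exp (-(c * (d + l / Ca))) :=
        Finset.sum_le_sum_of_subset_of_nonneg (fun l hl => by simp at hl ⊢; omega)
          fun _ _ _ => (Real.exp_pos _).le
      have h4 := le_mul_of_one_le_left (hpos (Finset.Icc 0 n)) hK1'
      have h5 := le_mul_of_one_le_left (hpos (Finset.Icc n (t + 1))) hA1
      linarith
    -- The growth condition forces δ₀ = 0, so the unused term at time 0 equals the cost exp(-cd) of
    -- the maximal inequality.
    have hδz : δ 0 = 0 := le_antisymm (by simpa using hδ 0) (hδ0 0)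
    have b1' : Real.exp (-(c * d)) + ∑ l ∈ Finset.Ico 1 n, Real.exp (-(c * (d + δ l))) ≤
        ∑ l ∈ Finset.Icc 0 n, Real.exp (-(c * (d + δ l))) := by
      have h1 : ∑ l ∈ insert 0 (Finset.Ico 1 n), Real.exp (-(c * (d + δ l))) =
          Real.exp (-(c * d)) + ∑ l ∈ Finset.Ico 1 n, Real.exp (-(c * (d + δ l))) := by
        rw [Finset.sum_insert (by simp), hδz, add_zero]
      rw [← h1]
      refine Finset.sum_le_sum_of_subset_of_nonneg (fun l hl => ?_)
          fun _ _ _ => (Real.exp_pos _).le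
      simp at hl ⊢
      omega
    have b3' : ∑ l ∈ Finset.Ico n (t + 1), Real.exp (-(c * (d + δ l))) ≤
        ∑ l ∈ Finset.Icc n (t + 1), Real.exp (-(c * (d + δ l))) :=
      Finset.sum_le_sum_of_subset_of_nonneg Finset.Ico_subset_Icc_self
        fun _ _ _ => (Real.exp_pos _).le
    have h1 := measureReal_union_le (μ := μ) (T ∪ U1 ∪ U2) U3
    have h2 := measureReal_union_le (μ := μ) (T ∪ U1) U2
    have h3 := measureReal_union_le (μ := μ) T U1
    have h4 := mul_le_mul_of_nonneg_left b1' (zero_le_one.trans hK1')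
    have h5 := mul_le_mul_of_nonneg_left b3' (zero_le_one.trans hA1)
    unfold tailSum
    rw [mul_add] at h4
    rw [mul_add, mul_add]
    linarith

end TunedRun

end Bandit

end

/-! ### The main theorem -/

theorem mainTheorem1 (C₀ : ℝ) (hC₀ : 0 < C₀) :
    ∃ C c : ℝ, 0 < C ∧ 0 < c ∧
      ∀ (Ω : Type*) [MeasurableSpace Ω] (μ : Measure Ω) [IsProbabilityMeasure μ]
        (d K : ℕ) (B : Bandit Ω d K) (A : Finset (Fin K))
        (lmin lmax sig h Ca Cb piLow : ℝ) (p δ : ℕ → ℝ),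
        1 ≤ d → 2 ≤ K → 0 < lmin → 0 < lmax → 0 < sig → 0 < h →
        0 < piLow → piLow ≤ 1 → (∀ t, 0 ≤ p t ∧ p t ≤ 1) →
        B.IsEpsGreedy μ p →
        B.CovariateAssumption μ lmin lmax →
        B.NoiseAssumption μ sig →
        B.ArmOptimality μ lmin h A →
        (∀ t : ℕ, B.step t = 1 / lmin * (Ca / (t + Cb * d))) →
        2 * K / piLow ≤ Ca →
        3 * Ca ^ 2 * (lmax ^ 2 / lmin ^ 2) ≤ Cb →
        (∀ i, ‖B.betaInit i - B.betaStar i‖ ^ 2 ≤ sig ^ 2 / lmax) →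
        (∀ t, 0 ≤ δ t ∧ δ t ≤ δ (t + 1)) →
        (∀ t : ℕ, δ t ≤ C₀ * t / Cb) →
        -- (1) exploration rate bounded below at all times
        ((∀ s, piLow ≤ p s) → ∀ t : ℕ,
          1 - K * tailSum c Ca d δ (Finset.Icc 0 t) ≤
            μ.real {ω | ∀ i, ‖B.est t ω i - B.betaStar i‖ ^ 2 ≤
              cStar C Ca Cb lmin lmax / lmin * ((d + δ t) / (t + Cb * d)) * sig ^ 2}) ∧
        -- (2) exploration rate bounded below only before `t_1`, arbitrary from then on
        (∀ n₁ : ℕ, n₁ = ⌈tOne C Ca Cb lmin lmax sig h d⌉₊ →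
          (∀ s, s < n₁ → piLow ≤ p s) → ∀ t : ℕ, n₁ ≤ t →
          1 - K * tailSum c Ca d δ (Finset.Icc 0 n₁)
              - A.card * tailSum c Ca d δ (Finset.Icc n₁ (t + 1)) ≤
            μ.real {ω | ∀ i ∈ A, ‖B.est t ω i - B.betaStar i‖ ^ 2 ≤
              cStarStar C Ca Cb lmin lmax / lmin * ((d + δ t) / (t + Cb * d)) * sig ^ 2} ∧
          1 - K * tailSum c Ca d δ (Finset.Icc 0 n₁)
              - A.card * tailSum c Ca d δ (Finset.Icc n₁ (t + 1))
              - Aᶜ.card * (Real.exp (-(c * d)) *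
                  ∑ l ∈ Finset.Icc n₁ (t + 1), if p l ≠ 0 then 1 else 0) ≤
            μ.real {ω |
              (∀ i ∈ A, ‖B.est t ω i - B.betaStar i‖ ^ 2 ≤
                cStarStar C Ca Cb lmin lmax / lmin * ((d + δ t) / (t + Cb * d)) * sig ^ 2) ∧
              ∀ i, i ∉ A → ‖B.est t ω i - B.betaStar i‖ ^ 2 ≤ h ^ 2 / 4}) := by
  -- The error bound is b = 8(2 + C₀), above both 23(1 + C₀)/3 and 46/3. This c then gives 6c ≤
  -- 1/1000 and 6cb = 1/125 ≤ 1/40.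
  refine ⟨20, 1 / (6000 * (2 + C₀)), by norm_num, by positivity, ?_⟩
  intro Ω _ μ _ d K B A lmin lmax sig h Ca Cb piLow p δ hd hK hlmin hlmax hsig hh hpi hpi1 hp
    hgreedy hcov hnoise hA hstep hCa hCb hinit hδ hδ'
  have hK2 : (2 : ℝ) ≤ K := by exact_mod_cast hK
  have hK1 : 1 ≤ K := by omega
  have hKpi : 2 * (K : ℝ) ≤ Ca * piLow := (div_le_iff₀ hpi).1 hCa
  have hCa4 : 4 ≤ Ca := by
    refine le_trans ?_ hCa
    rw [le_div_iff₀ hpi]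
    linarith
  have hCa0 : 0 < Ca := by linarith
  have hb : 23 / 3 * (1 + C₀) ≤ 8 * (2 + C₀) := by linarith
  have hb2 : (46 : ℝ) / 3 ≤ 8 * (2 + C₀) := by linarith
  have hR : B.TunedRun μ p lmin lmax sig Ca Cb (1 / (6000 * (2 + C₀))) (8 * (2 + C₀)) :=
    { greedy := hgreedy
      cov := hcov
      noise := hnoise
      dim_pos := hd
      lmin_pos := hlmin
      lmax_pos := hlmax
      sig_pos := hsig
      prob_mem := hp
      four_le_Ca := hCa4
      Cb_ge := hCb
      step_eq := hstep
      c_pos := by positivity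
      c_le := by
        rw [mul_one_div, div_le_div_iff₀ (by positivity) (by norm_num)]
        linarith
      b_nonneg := by positivity
      c_mul_b_le := by
        have : 6 * (1 / (6000 * (2 + C₀))) * (8 * (2 + C₀)) = 1 / 125 := by
          field_simp
          norm_num
        rw [this]
        norm_num }
  have hexp : ∀ s, piLow ≤ p s → 2 / Ca ≤ p s / K := fun s hs => by
    rw [div_le_div_iff₀ hCa0 (by linarith)]
    nlinarith
  have hδ0 : ∀ t, 0 ≤ δ t := fun t => (hδ t).1
  refine ⟨fun hps t => hR.exploration_bound hC₀.le hb hK1 hinit hδ0 hδ'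
    (fun s => hexp s (hps s)) t, ?_⟩
  rintro n rfl hps t ht
  have hAne := hA.nonempty hgreedy hcov hlmin hlmax hh hd hK1
  have hK' : 2 / Ca ≤ 1 / (K : ℝ) := by
    rw [div_le_div_iff₀ hCa0 (by linarith)]
    nlinarith
  set n := ⌈tOne 20 Ca Cb lmin lmax sig h d⌉₊
  -- The time t₁ solves 16 · radius = h² at δ = 0; the natural-number ceiling also covers a negative
  -- t₁.
  have hn : 16 * Bandit.radius lmin lmax sig Ca Cb d 0 n ≤ h ^ 2 := by
    have h1 : tOne 20 Ca Cb lmin lmax sig h d ≤ n := Nat.le_ceil _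
    have h2 := hR.clock_pos n
    have h3 : 16 * cStar 20 Ca Cb lmin lmax * d * sig ^ 2 / (lmin * h ^ 2) ≤
        Bandit.clock Cb d n := by
      unfold tOne at h1
      unfold Bandit.clock
      linarith
    rw [div_le_iff₀ (by positivity)] at h3
    have e : 16 * Bandit.radius lmin lmax sig Ca Cb d 0 n =
        16 * cStar 20 Ca Cb lmin lmax * d * sig ^ 2 / (lmin * Bandit.clock Cb d n) := by
      unfold Bandit.radius
      rw [add_zero]
      field_simp
    rw [e, div_le_iff₀ (by positivity)]
    linarith
  have hmain := hR.exploitation_bound hC₀.le hb hb2 hK1 hinit hδ0 hδ' hA hAne hh hK'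
    (fun s hs => hexp s (hps s hs)) hn ht
  have hsub : {ω | (∀ i ∈ A, ‖B.err t i ω‖ ^ 2 ≤
        Bandit.radius lmin lmax sig Ca Cb d (δ t) t) ∧
        ∀ i, ‖B.err t i ω‖ ^ 2 ≤ 2 * Bandit.radius lmin lmax sig Ca Cb d 0 n} ⊆
      {ω | (∀ i ∈ A, ‖B.est t ω i - B.betaStar i‖ ^ 2 ≤
          cStarStar 20 Ca Cb lmin lmax / lmin * ((d + δ t) / (t + Cb * d)) * sig ^ 2) ∧
        ∀ i, i ∉ A → ‖B.est t ω i - B.betaStar i‖ ^ 2 ≤ h ^ 2 / 4} := by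
    rintro ω ⟨h1, h2⟩
    refine ⟨fun i hi => (h1 i hi).trans ?_, fun i _ => (h2 i).trans ?_⟩
    · have h3 : cStar 20 Ca Cb lmin lmax ≤ cStarStar 20 Ca Cb lmin lmax := by
        unfold cStarStar
        have : 0 ≤ 2 * 20 * Ca * (lmax / lmin) := by positivity
        linarith
      have h4 := hR.clock_pos t
      have h5 := hδ0 t
      change cStar 20 Ca Cb lmin lmax / lmin * ((d + δ t) / Bandit.clock Cb d t) * sig ^ 2 ≤
        cStarStar 20 Ca Cb lmin lmax / lmin * ((d + δ t) / Bandit.clock Cb d t) * sig ^ 2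
      gcongr
    · have := pow_pos hh 2
      linarith
  -- The joint event already has the larger of the two stated probabilities: the maximal inequality
  -- for all arms was paid for in the time-0 term. The further term for the suboptimal arms is
  -- nonnegative and only subtracted.
  have hjoint := hmain.trans (measureReal_mono hsub)
  refine ⟨hjoint.trans (measureReal_mono fun ω hω => hω.1), le_trans ?_ hjoint⟩
  refine sub_le_self _ (mul_nonneg (Nat.cast_nonneg _) (mul_nonneg (Real.exp_pos _).le
    (Finset.sum_nonneg fun l _ => ?_)))
  split_ifs <;> norm_num
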